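/- Let $d\ge 1$, $\|s\|_1=\sum_{i=1}^d|s_i|$ and $\mathcal S=\{s\in[0,1]^d:\|s\|_1\le 1\}$. For $\alpha_1,\dots,\alpha_d,\beta>0$ and $x\in\mathcal S$ let $$K_{\alpha,\beta}(x)=\frac{\Gamma(\|\alpha\|_1+\beta)}{\Gamma(\beta)\prod_{i=1}^d\Gamma(\alpha_i)}\,(1-\|x\|_1)^{\beta-1}\prod_{i=1}^d x_i^{\alpha_i-1}.$$ Let $X_1,X_2,\dots$ be i.i.d. with a probability density $f$ supported on $\mathcal S$ which is twice continuously differentiable on $\mathcal S$, and for $b>0$ let $$\hat f_{n,b}(s)=\frac1n\sum_{i=1}^n K_{s/b+1,\,(1-\|s\|_1)/b+1}(X_i),\qquad \mathrm{MAE}[\hat f_{n,b}]=\int_{\mathcal S}\mathbb E\big|\hat f_{n,b}(s)-f(s)\big|\,ds .$$ Put $$g(s)=\sum_{i=1}^d(1-(d+1)s_i)\,\partial_i f(s)+\tfrac12\sum_{i,j=1}^d s_i(\mathbf 1_{\{i=j\}}-s_j)\,\partial_i\partial_j f(s),\qquad \psi(s)=\Big[(4\pi)^d(1-\|s\|_1)\prod_{i=1}^d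 s_i\Big]^{-1/2},$$ $w(s)=n^{-1/2}b^{-d/4}\sqrt{\psi(s)f(s)}$, $A=\int_{\mathcal S}\sqrt{\psi(s)f(s)}\,ds$ and $G=\int_{\mathcal S}|g(s)|\,ds$, and let $Z\sim\mathcal N(0,1)$. Then all integrals and expectations below are finite, and the following hold, where $b=b(n)>0$. (1) As $n\to\infty$ and $b\to0$, $$\mathrm{MAE}[\hat f_{n,b}]=\int_{\mathcal S}w(s)\,\mathbb E\Big|Z-\frac{b\,g(s)}{w(s)}\Big|\,ds+O(n^{-1}b^{-d/2})+o(n^{-1/2}b^{-d/4})+o(b),$$ where the integrand is read as its limit $b|g(s)|$ where $w(s)=0$, and the constant in $O(\cdot)$ depends only on $d$ and $f$. (2) If $b\to0$ and $n^{1/2}b^{d/4}\to\infty$ as $n\to\infty$, then $$\mathrm{MAE}[\hat f_{n,b}]\le n^{-1/2}b^{-d/4}\sqrt{\tfrac2\pi}\,A+b\,G+o(n^{-1/2}b^{-d/4})+o(b).$$ (3) If $G>0$, then for every $n\ge1$ the leading part $b\mapsto n^{-1/2}b^{-d/4}\sqrt{2/\pi}\,A+b\,G$ of the bound in (2) has on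 $(0,\infty)$ the unique minimizer $$b_{\mathrm{opt}}=n^{-2/(d+4)}\Big[\tfrac d4\sqrt{\tfrac2\pi}\cdot\frac AG\Big]^{4/(d+4)},$$ it satisfies $b_{\mathrm{opt}}\to0$ and $n^{1/2}b_{\mathrm{opt}}^{d/4}\to\infty$, and, as $n\to\infty$, $$\mathrm{MAE}[\hat f_{n,b_{\mathrm{opt}}}]\le n^{-2/(d+4)}\,\frac{1+\frac d4}{(\frac d4)^{d/(d+4)}}\cdot\frac{\big(\sqrt{2/\pi}\,A\big)^{4/(d+4)}}{G^{-d/(d+4)}}+o(n^{-2/(d+4)}).$$ (4) If $n^{2/(d+4)}b\to\lambda$ for some $\lambda>0$, then, as $n\to\infty$, $$\mathrm{MAE}[\hat f_{n,b}]\le n^{-2/(d+4)}\Big[\lambda^{-d/4}\sqrt{\tfrac2\pi}\,A+\lambda\,G\Big]+o(n^{-2/(d+4)}).$$ -/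

import Mathlib

open Filter Topology MeasureTheory ProbabilityTheory Asymptotics

noncomputable section

namespace DirichletKernel

/-- The `ℓ¹` norm on `ℝ^d`. -/
def l1norm {d : ℕ} (s : Fin d → ℝ) : ℝ := ∑ i, |s i|

/-- The (closed, full-dimensional) simplex in `ℝ^d`. -/
def simplex (d : ℕ) : Set (Fin d → ℝ) :=
  {s | (∀ i, s i ∈ Set.Icc (0 : ℝ) 1) ∧ l1norm s ≤ 1}

/-- The density at `x` of the Dirichlet distribution with parameters `(α, β)`. -/
def dirichletDensity {d : ℕ} (α : Fin d → ℝ) (β : ℝ) (x : Fin d → ℝ) : ℝ :=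
  Real.Gamma (l1norm α + β) / (Real.Gamma β * ∏ i, Real.Gamma (α i))
    * (1 - l1norm x) ^ (β - 1) * ∏ i, x i ^ (α i - 1)

/-- The Dirichlet kernel with bandwidth `b` at the position `s`, evaluated at `x`. -/
def kernel {d : ℕ} (b : ℝ) (s x : Fin d → ℝ) : ℝ :=
  dirichletDensity (fun i => s i / b + 1) ((1 - l1norm s) / b + 1) x

/-- The Dirichlet kernel estimator at `s` built from the first `n` observations. -/
def estimator {d : ℕ} {Ω : Type*} (X : ℕ → Ω → (Fin d → ℝ)) (n : ℕ) (b : ℝ)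
    (s : Fin d → ℝ) (ω : Ω) : ℝ :=
  (1 / (n : ℝ)) * ∑ i ∈ Finset.range n, kernel b s (X i ω)

/-- `f` is a probability density on the simplex (its values elsewhere are irrelevant). -/
structure IsSimplexDensity {d : ℕ} (f : (Fin d → ℝ) → ℝ) : Prop where
  nonneg : ∀ s ∈ simplex d, 0 ≤ f s
  integral_eq_one : ∫ s in simplex d, f s = 1

/-- `X 0, X 1, …` are i.i.d. random vectors under `μ`, and their common law has density `f` with
respect to Lebesgue measure on the simplex. -/
structure IsIIDSample {d : ℕ} {Ω : Type*} [MeasurableSpace Ω] (μ : Measure Ω)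
    (X : ℕ → Ω → (Fin d → ℝ)) (f : (Fin d → ℝ) → ℝ) : Prop where
  measurable : ∀ i, Measurable (X i)
  indep : iIndepFun X μ
  law : ∀ i, μ.map (X i) =
    (volume.restrict (simplex d)).withDensity (fun x => ENNReal.ofReal (f x))

/-- The pointwise mean absolute error `𝔼 |f̂_{n,b}(s) - f(s)|`. -/
def pointwiseMAE {d : ℕ} {Ω : Type*} [MeasurableSpace Ω] (μ : Measure Ω)
    (X : ℕ → Ω → (Fin d → ℝ)) (f : (Fin d → ℝ) → ℝ) (n : ℕ) (b : ℝ) (s : Fin d → ℝ) : ℝ :=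
  ∫ ω, |estimator X n b s ω - f s| ∂μ

/-- The mean absolute error `∫_S 𝔼 |f̂_{n,b}(s) - f(s)| ds`. -/
def MAE {d : ℕ} {Ω : Type*} [MeasurableSpace Ω] (μ : Measure Ω)
    (X : ℕ → Ω → (Fin d → ℝ)) (f : (Fin d → ℝ) → ℝ) (n : ℕ) (b : ℝ) : ℝ :=
  ∫ s in simplex d, pointwiseMAE μ X f n b s

/-- The first partial derivative `∂f/∂s_i` on the simplex (one-sided on its boundary). -/
def pderiv {d : ℕ} (i : Fin d) (f : (Fin d → ℝ) → ℝ) (s : Fin d → ℝ) : ℝ :=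
  fderivWithin ℝ f (simplex d) s (Pi.single i 1)

/-- The first-order bias coefficient
`g(s) = ∑ᵢ (1 - (d+1) sᵢ) ∂ᵢf(s) + ½ ∑ᵢⱼ sᵢ (1_{i=j} - sⱼ) ∂ᵢ∂ⱼf(s)`. -/
def biasCoeff {d : ℕ} (f : (Fin d → ℝ) → ℝ) (s : Fin d → ℝ) : ℝ :=
  ∑ i, (1 - ((d : ℝ) + 1) * s i) * pderiv i f s
    + (1 / 2) * ∑ i, ∑ j, s i * ((if i = j then 1 else 0) - s j) * pderiv i (pderiv j f) s

/-- `ψ(s) = [(4π)^d (1 - ‖s‖₁) ∏ᵢ sᵢ]^{-1/2}`. -/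
def psi {d : ℕ} (s : Fin d → ℝ) : ℝ :=
  ((4 * Real.pi) ^ d * (1 - l1norm s) * ∏ i, s i) ^ (-(1 / 2) : ℝ)

/-- `w(s) = n^{-1/2} b^{-d/4} √(ψ(s) f(s))`. -/
def weight {d : ℕ} (f : (Fin d → ℝ) → ℝ) (n : ℕ) (b : ℝ) (s : Fin d → ℝ) : ℝ :=
  (n : ℝ) ^ (-(1 / 2) : ℝ) * b ^ (-(d : ℝ) / 4) * √(psi s * f s)

/-- `w · 𝔼 |Z - v / w|` for a standard normal `Z`, read at `w = 0` as its limit `|v|`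
(equivalently `𝔼 |w Z - v|`). -/
def scaledNormalAbs (w v : ℝ) : ℝ :=
  if w = 0 then |v| else w * ∫ z, |z - v / w| ∂(gaussianReal 0 1)

/-- `∫_S √(ψ(s) f(s)) ds`. -/
def sdIntegral {d : ℕ} (f : (Fin d → ℝ) → ℝ) : ℝ :=
  ∫ s in simplex d, √(psi s * f s)

/-- `∫_S |g(s)| ds`. -/
def biasIntegral {d : ℕ} (f : (Fin d → ℝ) → ℝ) : ℝ :=
  ∫ s in simplex d, |biasCoeff f s|

/-- The leading part `n^{-1/2} b^{-d/4} √(2/π) ∫_S √(ψ f) + b ∫_S |g|` of the error bound. -/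
def leadingBound {d : ℕ} (f : (Fin d → ℝ) → ℝ) (n : ℕ) (b : ℝ) : ℝ :=
  (n : ℝ) ^ (-(1 / 2) : ℝ) * b ^ (-(d : ℝ) / 4) * √(2 / Real.pi) * sdIntegral f
    + b * biasIntegral f

/-- The bandwidth
`n^{-2/(d+4)} [(d/4) √(2/π) ∫_S √(ψ f) / ∫_S |g|]^{4/(d+4)}`. -/
def bOpt {d : ℕ} (f : (Fin d → ℝ) → ℝ) (n : ℕ) : ℝ :=
  (n : ℝ) ^ (-2 / ((d : ℝ) + 4)) *
    ((d : ℝ) / 4 * √(2 / Real.pi) * (sdIntegral f / biasIntegral f)) ^ (4 / ((d : ℝ) + 4))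

end DirichletKernel

end

open DirichletKernel

/-!
Let `K_s` be the kernel at `s` with bandwidth `b`, and write `s` also for its barycentric coordinates
`sₒ`, the last one being `1 - ‖s‖₁`.

On the simplex, `K_s(x)` is a constant multiple of `(∏ₒ xₒ ^ sₒ) ^ (1 / b)` (`kernel_eq`). This shape
has three consequences. The weighted AM-GM inequality shows that `K_s` has its peak at `s` and is
exponentially smaller at positive distance from it (`profile_le`, `kernel_le_of_dist`). Stirling's
formula gives the height of the peak, with limit `b^{-d/2} 2^{d/2} ψ(s)` and the uniform bound
`C b^{-d/2} ψ(s)` (`tendsto_kernel_self`, `exists_kernel_self_le`). And `K_s²` is a multiple of the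
kernel with bandwidth `b / 2` (`kernel_sq`), so that second moments reduce to means.

*Bias.* The first two moments of the Dirichlet distribution and Taylor's formula on the simplex show
that `𝔼 f̂(s) - f(s)` is `b g(s) + o(b)` for each interior `s` and `O(b)` uniformly, so by dominated
convergence the expansion holds in `L¹` (`tendsto_integral_abs_bias_sub`).

*Standard deviation.* `b^{d/4}` times the standard deviation of `K_s(X₁)` converges to `√(ψ f)`
pointwise, dominated by a multiple of the integrable function `√ψ`, hence in `L¹`
(`tendsto_integral_abs_kernelSD_sub`).

*Normal approximation.* Since `|x|` is a positive multiple of `∫₀^∞ (1 - cos (t x)) t⁻² dt`, the first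
absolute moment of a law is an integral of its characteristic function (`integral_abs_eq`). Comparing
characteristic functions, the first absolute moment of a shifted mean of `n` centred i.i.d. variables
bounded by `M` is within a constant times `M / n` of that of the normal variable with the same mean
and variance (`abs_integral_abs_mean_sub_le`). No lower bound on the variance enters, which matters
because `f` may vanish and `ψ` is unbounded. With `M` the peak of the kernel, at most
`C b^{-d/2} ψ(s)`, and `ψ` integrable, the integrated error is `O(n⁻¹ b^{-d/2})`
(`exists_abs_MAE_sub_le`).

As `𝔼 |w Z - v|` is Lipschitz in `w` and `v`, the `L¹` limits replace the exact standard deviation by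
`w` and the exact bias by `b g`, at the cost of `o(n^{-1/2} b^{-d/4})` and `o(b)`. The upper bounds use
`𝔼 |w Z - v| ≤ √(2/π) w + |v|`. For `b = n^{-2/(d+4)} q`, both terms of the leading bound are multiples
of `n^{-2/(d+4)}`, and minimizing over `q` is a one-variable problem
(`rpow_neg_add_mul_lt_of_critical`).
-/

noncomputable section

namespace DirichletKernel

/-! ### The Dirichlet integral -/

/-- The truncated power `x ↦ x^(a-1) 1_{x > 0}`, with values in `[0, ∞]`: a Gamma density without
its exponential factor. -/
def truncPow (a x : ℝ) : ENNReal := ENNReal.ofReal (if 0 < x then x ^ (a - 1) else 0)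

lemma measurable_truncPow (a : ℝ) : Measurable (truncPow a) :=
  ENNReal.measurable_ofReal.comp
    (Measurable.ite measurableSet_Ioi (by fun_prop) measurable_const)

lemma truncPow_of_nonpos {a x : ℝ} (hx : x ≤ 0) : truncPow a x = 0 := by
  simp [truncPow, not_lt.2 hx]

lemma truncPow_of_pos {a x : ℝ} (hx : 0 < x) : truncPow a x = ENNReal.ofReal (x ^ (a - 1)) := by
  simp [truncPow, hx]

/-- Truncated powers form a convolution semigroup up to Beta factors. -/
lemma lintegral_truncPow_mul {a b : ℝ} (ha : 0 < a) (hb : 0 < b) (t : ℝ) :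
    ∫⁻ x, truncPow a x * truncPow b (t - x) =
      ENNReal.ofReal (beta a b) * truncPow (a + b) t := by
  have hm : Measurable fun x => truncPow a x * truncPow b (t - x) :=
    (measurable_truncPow a).mul ((measurable_truncPow b).comp (by fun_prop))
  rcases le_or_gt t 0 with ht | ht
  · rw [truncPow_of_nonpos ht, mul_zero, lintegral_eq_zero_iff hm]
    refine Eventually.of_forall fun x => ?_
    rcases le_or_gt x 0 with hx | hx
    · simp [truncPow_of_nonpos hx]
    · simp [truncPow_of_nonpos (show t - x ≤ 0 by linarith)]
  -- the substitution `x = t y` produces the Beta density on `(0, 1)`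
  rw [← Real.smul_map_volume_mul_left ht.ne', lintegral_smul_measure,
    lintegral_map hm (by fun_prop)]
  have key : ∀ y, truncPow a (t * y) * truncPow b (t - t * y) =
      ENNReal.ofReal (beta a b * t ^ (a + b - 2)) * betaPDF a b y := by
    intro y
    rcases le_or_gt y 0 with hy | hy
    · rw [truncPow_of_nonpos (mul_nonpos_of_nonneg_of_nonpos ht.le hy),
        betaPDF_eq_zero_of_nonpos hy]; simp
    rcases le_or_gt 1 y with hy1 | hy1
    · rw [truncPow_of_nonpos (a := b) (show t - t * y ≤ 0 by nlinarith),
        betaPDF_eq_zero_of_one_le hy1]; simp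
    have h1 : 0 < 1 - y := by linarith
    rw [truncPow_of_pos (mul_pos ht hy), truncPow_of_pos (show 0 < t - t * y by nlinarith),
      betaPDF_of_pos_lt_one hy hy1, ← ENNReal.ofReal_mul (by positivity),
      ← ENNReal.ofReal_mul (by have := beta_pos ha hb; positivity)]
    congr 1
    rw [show t - t * y = t * (1 - y) by ring, Real.mul_rpow ht.le hy.le,
      Real.mul_rpow ht.le h1.le, show a + b - 2 = (a - 1) + (b - 1) by ring, Real.rpow_add ht]
    have := (beta_pos ha hb).ne'
    field_simp
  simp_rw [key]
  rw [lintegral_const_mul _ (by unfold betaPDF; fun_prop), lintegral_betaPDF_eq_one ha hb, mul_one,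
    truncPow_of_pos ht, smul_eq_mul, ← ENNReal.ofReal_mul (abs_nonneg t),
    ← ENNReal.ofReal_mul (beta_pos ha hb).le, abs_of_pos ht]
  congr 1
  rw [show a + b - 1 = (a + b - 2) + 1 by ring, Real.rpow_add_one ht.ne']
  ring

/-- The **Dirichlet integral** over the simplex of size `t`, as an iterated convolution. -/
lemma lintegral_prod_truncPow : ∀ {d : ℕ} (α : Fin d → ℝ) (_ : ∀ i, 0 < α i) {β : ℝ} (_ : 0 < β)
    (t : ℝ),
    ∫⁻ x : Fin d → ℝ, (∏ i, truncPow (α i) (x i)) * truncPow β (t - ∑ i, x i) =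
      ENNReal.ofReal (Real.Gamma β * ∏ i, Real.Gamma (α i)) *
        (ENNReal.ofReal (Real.Gamma (∑ i, α i + β)))⁻¹ * truncPow (∑ i, α i + β) t
  | 0, α, _, β, hβ, t => by
    have hG := Real.Gamma_pos_of_pos hβ
    rw [volume_pi, Measure.pi_of_empty, lintegral_dirac]
    simp only [Finset.univ_eq_empty, Finset.prod_empty, Finset.sum_empty, one_mul, sub_zero,
      mul_one, zero_add]
    rw [ENNReal.mul_inv_cancel (by simpa using hG) ENNReal.ofReal_ne_top, one_mul]
  | d + 1, α, hα, β, hβ, t => by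
    have hS : 0 < ∑ i : Fin d, α i.succ + β :=
      add_pos_of_nonneg_of_pos (Finset.sum_nonneg fun i _ => (hα _).le) hβ
    have hm : Measurable fun x : Fin (d + 1) → ℝ =>
        (∏ i, truncPow (α i) (x i)) * truncPow β (t - ∑ i, x i) := by
      refine Measurable.mul (Finset.measurable_prod _ fun i _ =>
        (measurable_truncPow _).comp (measurable_pi_apply i)) ((measurable_truncPow _).comp ?_)
      fun_prop
    -- split off the first coordinate `x`; the others form a Dirichlet integral of size `t - x`
    have hvp := (volume_preserving_piFinSuccAbove (fun _ : Fin (d + 1) => ℝ) 0).symm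
    have hm2 : Measurable fun p : ℝ × (Fin d → ℝ) =>
        (∏ i, truncPow (α i) ((MeasurableEquiv.piFinSuccAbove (fun _ : Fin (d + 1) => ℝ) 0).symm
          p i)) * truncPow β (t - ∑ i, (MeasurableEquiv.piFinSuccAbove
            (fun _ : Fin (d + 1) => ℝ) 0).symm p i) := hm.comp (MeasurableEquiv.measurable _)
    rw [← hvp.lintegral_comp hm, Measure.volume_eq_prod, lintegral_prod _ hm2.aemeasurable]
    have key : ∀ x : ℝ, ∫⁻ y : Fin d → ℝ,
        (∏ i, truncPow (α i) ((MeasurableEquiv.piFinSuccAbove (fun _ : Fin (d + 1) => ℝ) 0).symm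
          (x, y) i)) * truncPow β (t - ∑ i, (MeasurableEquiv.piFinSuccAbove
            (fun _ : Fin (d + 1) => ℝ) 0).symm (x, y) i) =
        ENNReal.ofReal (Real.Gamma β * ∏ i : Fin d, Real.Gamma (α i.succ)) *
        (ENNReal.ofReal (Real.Gamma (∑ i : Fin d, α i.succ + β)))⁻¹ *
          (truncPow (α 0) x * truncPow (∑ i : Fin d, α i.succ + β) (t - x)) := by
      intro x
      have hm' : Measurable fun y : Fin d → ℝ =>
          (∏ i : Fin d, truncPow (α i.succ) (y i)) * truncPow β ((t - x) - ∑ i, y i) := by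
        refine Measurable.mul (Finset.measurable_prod _ fun i _ =>
          (measurable_truncPow _).comp (measurable_pi_apply i)) ((measurable_truncPow _).comp ?_)
        fun_prop
      have := lintegral_prod_truncPow (fun i : Fin d => α i.succ) (fun i => hα _) hβ (t - x)
      simp only [MeasurableEquiv.piFinSuccAbove, MeasurableEquiv.symm_mk, Fin.insertNthEquiv,
        MeasurableEquiv.coe_mk, Equiv.symm_symm, Equiv.coe_fn_mk, Fin.insertNth_zero',
        Fin.prod_univ_succ, Fin.sum_univ_succ, Fin.cons_zero, Fin.cons_succ]
      simp_rw [mul_assoc, ← sub_sub]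
      rw [lintegral_const_mul _ hm', this]
      ring
    simp_rw [key]
    have hm3 : Measurable fun x =>
        truncPow (α 0) x * truncPow (∑ i : Fin d, α i.succ + β) (t - x) :=
      (measurable_truncPow _).mul ((measurable_truncPow _).comp (by fun_prop))
    rw [lintegral_const_mul _ hm3, lintegral_truncPow_mul (hα 0) hS, Fin.prod_univ_succ,
      Fin.sum_univ_succ]
    have h1 := Real.Gamma_pos_of_pos hS
    have h2 := Real.Gamma_pos_of_pos hβ
    have h3 := Real.Gamma_pos_of_pos (hα 0)
    have h4 : 0 < ∏ i : Fin d, Real.Gamma (α i.succ) :=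
      Finset.prod_pos fun i _ => Real.Gamma_pos_of_pos (hα _)
    have h5 := Real.Gamma_pos_of_pos (add_pos (hα 0) hS)
    rw [← mul_assoc, ← add_assoc]
    congr 1
    rw [← add_assoc] at h5
    rw [← ENNReal.ofReal_inv_of_pos h1, ← ENNReal.ofReal_inv_of_pos h5,
      ← ENNReal.ofReal_mul (by positivity), ← ENNReal.ofReal_mul (by positivity),
      ← ENNReal.ofReal_mul (by positivity)]
    congr 1
    unfold beta
    rw [← add_assoc]
    field_simp

/-! ### Geometry of the simplex -/

variable {d : ℕ}

/-- The open simplex `{s | 0 < sᵢ, ∑ sᵢ < 1}`. -/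
def openSimplex (d : ℕ) : Set (Fin d → ℝ) := {s | (∀ i, 0 < s i) ∧ ∑ i, s i < 1}

lemma l1norm_eq_sum {s : Fin d → ℝ} (hs : ∀ i, 0 ≤ s i) : l1norm s = ∑ i, s i :=
  Finset.sum_congr rfl fun i _ => abs_of_nonneg (hs i)

lemma mem_simplex_iff {s : Fin d → ℝ} : s ∈ simplex d ↔ (∀ i, 0 ≤ s i) ∧ ∑ i, s i ≤ 1 := by
  constructor
  · rintro ⟨h1, h2⟩
    exact ⟨fun i => (h1 i).1, l1norm_eq_sum (fun i => (h1 i).1) ▸ h2⟩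
  · rintro ⟨h1, h2⟩
    refine ⟨fun i => ⟨h1 i, ?_⟩, (l1norm_eq_sum h1).trans_le h2⟩
    exact (Finset.single_le_sum (fun j _ => h1 j) (Finset.mem_univ i)).trans h2

lemma openSimplex_subset : openSimplex d ⊆ simplex d := fun _ hs =>
  mem_simplex_iff.2 ⟨fun i => (hs.1 i).le, hs.2.le⟩

lemma simplex_nonneg {s : Fin d → ℝ} (hs : s ∈ simplex d) (i : Fin d) : 0 ≤ s i := (hs.1 i).1

lemma simplex_le_one {s : Fin d → ℝ} (hs : s ∈ simplex d) (i : Fin d) : s i ≤ 1 := (hs.1 i).2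

lemma l1norm_simplex {s : Fin d → ℝ} (hs : s ∈ simplex d) : l1norm s = ∑ i, s i :=
  l1norm_eq_sum (simplex_nonneg hs)

lemma sum_le_one_of_mem {s : Fin d → ℝ} (hs : s ∈ simplex d) : ∑ i, s i ≤ 1 :=
  (mem_simplex_iff.1 hs).2

lemma isOpen_openSimplex : IsOpen (openSimplex d) := by
  have : openSimplex d = (⋂ i, {s : Fin d → ℝ | 0 < s i}) ∩ {s | ∑ i, s i < 1} := by
    ext s; simp [openSimplex]
  rw [this]
  exact (isOpen_iInter_of_finite fun i => isOpen_lt continuous_const (continuous_apply i)).inter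
    (isOpen_lt (by fun_prop) continuous_const)

lemma isClosed_simplex : IsClosed (simplex d) := by
  have : simplex d = (⋂ i, {s : Fin d → ℝ | 0 ≤ s i}) ∩ {s | ∑ i, s i ≤ 1} := by
    ext s; simp [mem_simplex_iff]
  rw [this]
  exact (isClosed_iInter fun i => isClosed_le continuous_const (continuous_apply i)).inter
    (isClosed_le (by fun_prop) continuous_const)

lemma isCompact_simplex : IsCompact (simplex d) := by
  refine (isCompact_univ_pi fun _ : Fin d => isCompact_Icc (a := (0 : ℝ)) (b := 1)).of_isClosed_subset
    isClosed_simplex fun s hs i _ => hs.1 i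

lemma measurableSet_simplex : MeasurableSet (simplex d) := isClosed_simplex.measurableSet

lemma convex_simplex : Convex ℝ (simplex d) := by
  intro x hx y hy a b ha hb hab
  rw [mem_simplex_iff] at *
  refine ⟨fun i => ?_, ?_⟩
  · have := hx.1 i; have := hy.1 i
    simp only [Pi.add_apply, Pi.smul_apply, smul_eq_mul]; positivity
  · simp only [Pi.add_apply, Pi.smul_apply, smul_eq_mul, Finset.sum_add_distrib,
      ← Finset.mul_sum]
    nlinarith [hx.2, hy.2]

lemma interior_simplex (hd : 1 ≤ d) : interior (simplex d) = openSimplex d := by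
  refine Set.Subset.antisymm (fun s hs => ?_)
    (interior_maximal openSimplex_subset isOpen_openSimplex)
  obtain ⟨ε, hε, hb⟩ := Metric.mem_nhds_iff.1 (mem_interior_iff_mem_nhds.1 hs)
  have hmem : ∀ (i : Fin d) (r : ℝ), |r| < ε → s + Pi.single i r ∈ simplex d := fun i r hr =>
    hb (by rw [Metric.mem_ball, dist_eq_norm, add_sub_cancel_left, Pi.norm_single]; exact hr)
  refine ⟨fun i => ?_, ?_⟩
  · have := simplex_nonneg (hmem i (-(ε / 2)) (by rw [abs_neg, abs_of_pos] <;> linarith)) i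
    simp only [Pi.add_apply, Pi.single_eq_same] at this
    linarith
  · have := sum_le_one_of_mem (hmem ⟨0, hd⟩ (ε / 2) (by rw [abs_of_pos] <;> linarith))
    simp only [Pi.add_apply, Finset.sum_add_distrib, Finset.sum_pi_single', Finset.mem_univ,
      if_true] at this
    linarith

lemma openSimplex_nonempty (d : ℕ) : (openSimplex d).Nonempty := by
  refine ⟨fun _ => 1 / ((d : ℝ) + 1), fun i => by positivity, ?_⟩
  simp only [Finset.sum_const, Finset.card_univ, Fintype.card_fin, nsmul_eq_mul]
  rw [mul_one_div, div_lt_one (by positivity)]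
  linarith

lemma uniqueDiffOn_simplex : UniqueDiffOn ℝ (simplex d) :=
  uniqueDiffOn_convex convex_simplex ((openSimplex_nonempty d).mono
    (interior_maximal openSimplex_subset isOpen_openSimplex))

lemma ae_openSimplex (hd : 1 ≤ d) : ∀ᵐ s ∂(volume.restrict (simplex d)), s ∈ openSimplex d := by
  rw [ae_restrict_iff' measurableSet_simplex]
  have h := (convex_simplex (d := d)).addHaar_frontier volume
  filter_upwards [measure_eq_zero_iff_ae_notMem.1 h] with s hs hs'
  rw [← interior_simplex hd]
  by_contra hcon
  exact hs ⟨subset_closure hs', hcon⟩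

lemma volume_simplex_lt_top : volume (simplex d) < ⊤ := isCompact_simplex.measure_lt_top

instance : IsFiniteMeasure (volume.restrict (simplex d)) :=
  ⟨by rw [Measure.restrict_apply_univ]; exact volume_simplex_lt_top⟩

/-- Functions bounded and measurable on the simplex are integrable. -/
lemma integrableOn_of_bound {F : (Fin d → ℝ) → ℝ} {C : ℝ}
    (hm : AEStronglyMeasurable F (volume.restrict (simplex d)))
    (h : ∀ s ∈ simplex d, |F s| ≤ C) : IntegrableOn F (simplex d) :=
  Integrable.of_bound hm C ((ae_restrict_iff' measurableSet_simplex).2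
    (Eventually.of_forall fun s hs => h s hs))

lemma integrableOn_of_continuousOn {F : (Fin d → ℝ) → ℝ} (h : ContinuousOn F (simplex d)) :
    IntegrableOn F (simplex d) := h.integrableOn_compact isCompact_simplex

/-- Continuity on the open simplex is enough for measurability on the closed one. -/
lemma aestronglyMeasurable_of_continuousOn_openSimplex (hd : 1 ≤ d) {F : (Fin d → ℝ) → ℝ}
    (h : ContinuousOn F (openSimplex d)) :
    AEStronglyMeasurable F (volume.restrict (simplex d)) := by
  have h1 : volume.restrict (simplex d) = volume.restrict (openSimplex d) := by
    refine Measure.restrict_congr_set ?_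
    have := (ae_restrict_iff' measurableSet_simplex).1 (ae_openSimplex hd)
    filter_upwards [this] with s hs
    exact propext ⟨hs, fun h => openSimplex_subset h⟩
  rw [h1]
  exact h.aestronglyMeasurable isOpen_openSimplex.measurableSet

/-! ### Normalization of the Dirichlet densities -/

/-- The Dirichlet density without its normalizing constant. -/
def dirichletWeight (α : Fin d → ℝ) (β : ℝ) (x : Fin d → ℝ) : ℝ :=
  (1 - l1norm x) ^ (β - 1) * ∏ i, x i ^ (α i - 1)

lemma dirichletDensity_eq (α : Fin d → ℝ) (β : ℝ) (x : Fin d → ℝ) :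
    dirichletDensity α β x = Real.Gamma (l1norm α + β) /
      (Real.Gamma β * ∏ i, Real.Gamma (α i)) * dirichletWeight α β x := by
  rw [dirichletDensity, dirichletWeight, mul_assoc]

lemma dirichletWeight_nonneg (α : Fin d → ℝ) (β : ℝ) {x : Fin d → ℝ} (hx : x ∈ simplex d) :
    0 ≤ dirichletWeight α β x :=
  mul_nonneg (Real.rpow_nonneg (by linarith [hx.2]) _)
    (Finset.prod_nonneg fun i _ => Real.rpow_nonneg (simplex_nonneg hx i) _)

lemma measurable_l1norm : Measurable (l1norm (d := d)) := by
  unfold l1norm; fun_prop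

lemma measurable_dirichletWeight (α : Fin d → ℝ) (β : ℝ) :
    Measurable (dirichletWeight α β) := by
  have := measurable_l1norm (d := d)
  unfold dirichletWeight
  fun_prop

lemma measurable_dirichletDensity (α : Fin d → ℝ) (β : ℝ) :
    Measurable (dirichletDensity α β) := by
  simp_rw [funext (dirichletDensity_eq α β)]
  exact (measurable_dirichletWeight α β).const_mul _

lemma lintegral_dirichletWeight (hd : 1 ≤ d) {α : Fin d → ℝ} (hα : ∀ i, 0 < α i) {β : ℝ}
    (hβ : 0 < β) :
    ∫⁻ x in simplex d, ENNReal.ofReal (dirichletWeight α β x) =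
      ENNReal.ofReal (Real.Gamma β * ∏ i, Real.Gamma (α i)) *
        (ENNReal.ofReal (Real.Gamma (∑ i, α i + β)))⁻¹ := by
  have h := lintegral_prod_truncPow α hα hβ 1
  rw [truncPow_of_pos one_pos, Real.one_rpow, ENNReal.ofReal_one, mul_one] at h
  rw [← h, ← lintegral_indicator measurableSet_simplex]
  -- the boundary is a null set, and outside the simplex one of the truncated powers vanishes
  refine lintegral_congr_ae ?_
  have hae := (ae_restrict_iff' measurableSet_simplex).1 (ae_openSimplex hd)
  filter_upwards [hae] with x hx
  by_cases hxs : x ∈ simplex d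
  · have hxo := hx hxs
    rw [Set.indicator_of_mem hxs, dirichletWeight, l1norm_simplex hxs,
      truncPow_of_pos (sub_pos.2 hxo.2), mul_comm,
      ENNReal.ofReal_mul (Finset.prod_nonneg fun i _ => Real.rpow_nonneg (hxo.1 i).le _),
      ENNReal.ofReal_prod_of_nonneg fun i _ => Real.rpow_nonneg (hxo.1 i).le _]
    congr 1
    exact Finset.prod_congr rfl fun i _ => (truncPow_of_pos (hxo.1 i)).symm
  · rw [Set.indicator_of_notMem hxs]
    by_cases hp : ∀ i, 0 ≤ x i
    · have : 1 < ∑ i, x i := by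
        by_contra hcon; exact hxs (mem_simplex_iff.2 ⟨hp, not_lt.1 hcon⟩)
      rw [truncPow_of_nonpos (a := β) (by linarith), mul_zero]
    · push Not at hp
      obtain ⟨i, hi⟩ := hp
      rw [Finset.prod_eq_zero (Finset.mem_univ i) (truncPow_of_nonpos hi.le), zero_mul]

lemma integrableOn_dirichletWeight (hd : 1 ≤ d) {α : Fin d → ℝ} (hα : ∀ i, 0 < α i) {β : ℝ}
    (hβ : 0 < β) : IntegrableOn (dirichletWeight α β) (simplex d) := by
  refine ⟨(measurable_dirichletWeight α β).aestronglyMeasurable, ?_⟩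
  rw [hasFiniteIntegral_iff_ofReal ((ae_restrict_iff' measurableSet_simplex).2
    (Eventually.of_forall fun x hx => dirichletWeight_nonneg α β hx)),
    lintegral_dirichletWeight hd hα hβ]
  refine ENNReal.mul_lt_top ENNReal.ofReal_lt_top (ENNReal.inv_lt_top.2 ?_)
  exact ENNReal.ofReal_pos.2 (Real.Gamma_pos_of_pos
    (add_pos_of_nonneg_of_pos (Finset.sum_nonneg fun i _ => (hα i).le) hβ))

lemma integral_dirichletWeight (hd : 1 ≤ d) {α : Fin d → ℝ} (hα : ∀ i, 0 < α i) {β : ℝ}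
    (hβ : 0 < β) :
    ∫ x in simplex d, dirichletWeight α β x =
      Real.Gamma β * (∏ i, Real.Gamma (α i)) / Real.Gamma (∑ i, α i + β) := by
  have h1 : 0 < Real.Gamma (∑ i, α i + β) := Real.Gamma_pos_of_pos
    (add_pos_of_nonneg_of_pos (Finset.sum_nonneg fun i _ => (hα i).le) hβ)
  have h2 : 0 ≤ Real.Gamma β * ∏ i, Real.Gamma (α i) :=
    mul_nonneg (Real.Gamma_pos_of_pos hβ).le
      (Finset.prod_nonneg fun i _ => (Real.Gamma_pos_of_pos (hα i)).le)
  rw [integral_eq_lintegral_of_nonneg_ae ((ae_restrict_iff' measurableSet_simplex).2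
    (Eventually.of_forall fun x hx => dirichletWeight_nonneg α β hx))
    (measurable_dirichletWeight α β).aestronglyMeasurable, lintegral_dirichletWeight hd hα hβ,
    ← ENNReal.ofReal_inv_of_pos h1, ← ENNReal.ofReal_mul h2, ENNReal.toReal_ofReal (by positivity),
    div_eq_mul_inv]

lemma integrableOn_dirichletDensity (hd : 1 ≤ d) {α : Fin d → ℝ} (hα : ∀ i, 0 < α i) {β : ℝ}
    (hβ : 0 < β) : IntegrableOn (dirichletDensity α β) (simplex d) := by
  simp_rw [funext (dirichletDensity_eq α β)]
  exact (integrableOn_dirichletWeight hd hα hβ).const_mul _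

lemma integral_dirichletDensity (hd : 1 ≤ d) {α : Fin d → ℝ} (hα : ∀ i, 0 < α i) {β : ℝ}
    (hβ : 0 < β) : ∫ x in simplex d, dirichletDensity α β x = 1 := by
  have h1 : 0 < Real.Gamma (∑ i, α i + β) := Real.Gamma_pos_of_pos
    (add_pos_of_nonneg_of_pos (Finset.sum_nonneg fun i _ => (hα i).le) hβ)
  have h2 : 0 < Real.Gamma β * ∏ i, Real.Gamma (α i) :=
    mul_pos (Real.Gamma_pos_of_pos hβ)
      (Finset.prod_pos fun i _ => Real.Gamma_pos_of_pos (hα i))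
  simp_rw [dirichletDensity_eq]
  rw [integral_const_mul, integral_dirichletWeight hd hα hβ,
    l1norm_eq_sum fun i => (hα i).le, div_mul_div_comm, mul_comm, div_self (by positivity)]

/-- Multiplying a Dirichlet density by a coordinate raises the matching parameter by one. -/
lemma dirichletDensity_mul_coord {α : Fin d → ℝ} (hα : ∀ i, 0 < α i) {β : ℝ}
    (hβ : 0 < β) (i : Fin d) {x : Fin d → ℝ} (hx : x ∈ simplex d) :
    dirichletDensity α β x * x i =
      α i / (∑ k, α k + β) * dirichletDensity (α + Pi.single i 1) β x := by
  have hS : 0 < ∑ k, α k + β :=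
    add_pos_of_nonneg_of_pos (Finset.sum_nonneg fun i _ => (hα i).le) hβ
  have hα' : ∀ k, 0 ≤ (α + Pi.single i 1 : Fin d → ℝ) k := fun k => by
    by_cases h : k = i
    · subst h; have := hα k; simp; linarith
    · simpa [h] using (hα k).le
  have h1 : ∏ k, x k ^ ((α + Pi.single i 1 : Fin d → ℝ) k - 1) = (∏ k, x k ^ (α k - 1)) * x i := by
    have : ∀ k, x k ^ ((α + Pi.single i 1 : Fin d → ℝ) k - 1) =
        x k ^ (α k - 1) * (if k = i then x k else 1) := fun k => by
      by_cases h : k = i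
      · subst h
        simp only [Pi.add_apply, Pi.single_eq_same, if_true]
        rw [show α k + 1 - 1 = (α k - 1) + 1 by ring, Real.rpow_add_one' (simplex_nonneg hx k)
          (by linarith [hα k])]
      · simp [h]
    simp_rw [this, Finset.prod_mul_distrib, Finset.prod_ite_eq', Finset.mem_univ, if_true]
  have h2 : ∏ k, Real.Gamma ((α + Pi.single i 1 : Fin d → ℝ) k) = (∏ k, Real.Gamma (α k)) * α i := by
    have : ∀ k, Real.Gamma ((α + Pi.single i 1 : Fin d → ℝ) k) =
        Real.Gamma (α k) * (if k = i then α k else 1) := fun k => by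
      by_cases h : k = i
      · subst h
        simp only [Pi.add_apply, Pi.single_eq_same, if_true]
        rw [Real.Gamma_add_one (hα k).ne', mul_comm]
      · simp [h]
    simp_rw [this, Finset.prod_mul_distrib, Finset.prod_ite_eq', Finset.mem_univ, if_true]
  have h3 : ∑ k, (α + Pi.single i 1 : Fin d → ℝ) k = ∑ k, α k + 1 := by
    simp [Finset.sum_add_distrib]
  rw [dirichletDensity, dirichletDensity, h1, h2, l1norm_eq_sum fun i => (hα i).le,
    l1norm_eq_sum hα', h3, show ∑ k, α k + 1 + β = ∑ k, α k + β + 1 by ring,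
    Real.Gamma_add_one hS.ne']
  have := (hα i).ne'
  have := (Real.Gamma_pos_of_pos hβ).ne'
  have : (∏ k, Real.Gamma (α k)) ≠ 0 :=
    Finset.prod_ne_zero_iff.2 fun k _ => (Real.Gamma_pos_of_pos (hα k)).ne'
  field_simp

lemma integral_dirichletDensity_mul_coord (hd : 1 ≤ d) {α : Fin d → ℝ} (hα : ∀ i, 0 < α i)
    {β : ℝ} (hβ : 0 < β) (i : Fin d) :
    ∫ x in simplex d, dirichletDensity α β x * x i = α i / (∑ k, α k + β) := by
  have hα' : ∀ k, 0 < (α + Pi.single i 1 : Fin d → ℝ) k := fun k => by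
    by_cases h : k = i
    · subst h; have := hα k; simp; linarith
    · simpa [h] using hα k
  rw [setIntegral_congr_fun measurableSet_simplex
    fun x hx => dirichletDensity_mul_coord hα hβ i hx, integral_const_mul,
    integral_dirichletDensity hd hα' hβ, mul_one]

lemma integral_dirichletDensity_mul_coord_mul_coord (hd : 1 ≤ d) {α : Fin d → ℝ}
    (hα : ∀ i, 0 < α i) {β : ℝ} (hβ : 0 < β) (i j : Fin d) :
    ∫ x in simplex d, dirichletDensity α β x * (x i * x j) =
      α i * (α j + if i = j then 1 else 0) /
        ((∑ k, α k + β) * (∑ k, α k + β + 1)) := by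
  have hα' : ∀ k, 0 < (α + Pi.single i 1 : Fin d → ℝ) k := fun k => by
    by_cases h : k = i
    · subst h; have := hα k; simp; linarith
    · simpa [h] using hα k
  have h3 : ∑ k, (α + Pi.single i 1 : Fin d → ℝ) k = ∑ k, α k + 1 := by
    simp [Finset.sum_add_distrib]
  have : ∀ x ∈ simplex d, dirichletDensity α β x * (x i * x j) =
      α i / (∑ k, α k + β) * (dirichletDensity (α + Pi.single i 1) β x * x j) := fun x hx => by
    rw [← mul_assoc, dirichletDensity_mul_coord hα hβ i hx, mul_assoc]
  rw [setIntegral_congr_fun measurableSet_simplex this, integral_const_mul,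
    integral_dirichletDensity_mul_coord hd hα' hβ, h3, div_mul_div_comm,
    show ∑ k, α k + 1 + β = ∑ k, α k + β + 1 by ring]
  simp only [Pi.add_apply, Pi.single_apply, eq_comm]

/-! ### Mean and covariance of the kernel -/

lemma kernel_param_pos {b : ℝ} (hb : 0 < b) {s : Fin d → ℝ} (hs : s ∈ simplex d) (i : Fin d) :
    0 < s i / b + 1 := by
  have := simplex_nonneg hs i
  positivity

lemma kernel_last_param_pos {b : ℝ} (hb : 0 < b) {s : Fin d → ℝ} (hs : s ∈ simplex d) :
    0 < (1 - l1norm s) / b + 1 := by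
  have : 0 ≤ 1 - l1norm s := by linarith [hs.2]
  positivity

lemma sum_kernel_params {b : ℝ} (hb : 0 < b) {s : Fin d → ℝ} (hs : s ∈ simplex d) :
    ∑ i, (s i / b + 1) + ((1 - l1norm s) / b + 1) = 1 / b + d + 1 := by
  rw [l1norm_simplex hs, Finset.sum_add_distrib, ← Finset.sum_div]
  simp only [Finset.sum_const, Finset.card_univ, Fintype.card_fin, nsmul_eq_mul, mul_one]
  field_simp
  ring

lemma measurable_kernel (b : ℝ) (s : Fin d → ℝ) : Measurable (kernel b s) :=
  measurable_dirichletDensity _ _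

lemma kernel_nonneg {b : ℝ} (hb : 0 < b) {s x : Fin d → ℝ} (hs : s ∈ simplex d)
    (hx : x ∈ simplex d) : 0 ≤ kernel b s x := by
  rw [kernel, dirichletDensity_eq]
  have h1 := kernel_last_param_pos hb hs
  have h2 := kernel_param_pos hb hs
  refine mul_nonneg (div_nonneg (Real.Gamma_pos_of_pos ?_).le (mul_nonneg
    (Real.Gamma_pos_of_pos h1).le (Finset.prod_nonneg fun i _ => (Real.Gamma_pos_of_pos (h2 i)).le)))
    (dirichletWeight_nonneg _ _ hx)
  rw [l1norm_eq_sum fun i => (h2 i).le]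
  exact add_pos_of_nonneg_of_pos (Finset.sum_nonneg fun i _ => (h2 i).le) h1

lemma integrableOn_kernel (hd : 1 ≤ d) {b : ℝ} (hb : 0 < b) {s : Fin d → ℝ}
    (hs : s ∈ simplex d) : IntegrableOn (kernel b s) (simplex d) :=
  integrableOn_dirichletDensity hd (kernel_param_pos hb hs) (kernel_last_param_pos hb hs)

lemma integral_kernel (hd : 1 ≤ d) {b : ℝ} (hb : 0 < b) {s : Fin d → ℝ}
    (hs : s ∈ simplex d) : ∫ x in simplex d, kernel b s x = 1 :=
  integral_dirichletDensity hd (kernel_param_pos hb hs) (kernel_last_param_pos hb hs)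

lemma integrableOn_kernel_mul (hd : 1 ≤ d) {b : ℝ} (hb : 0 < b) {s : Fin d → ℝ}
    (hs : s ∈ simplex d) {h : (Fin d → ℝ) → ℝ} {C : ℝ}
    (hm : AEStronglyMeasurable h (volume.restrict (simplex d)))
    (hC : ∀ x ∈ simplex d, |h x| ≤ C) :
    IntegrableOn (fun x => kernel b s x * h x) (simplex d) :=
  (integrableOn_kernel hd hb hs).mul_bdd (c := C) hm
    ((ae_restrict_iff' measurableSet_simplex).2 (Eventually.of_forall fun x hx => hC x hx))

lemma integrableOn_kernel_mul_of_continuousOn (hd : 1 ≤ d) {b : ℝ} (hb : 0 < b)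
    {s : Fin d → ℝ} (hs : s ∈ simplex d) {h : (Fin d → ℝ) → ℝ}
    (hc : ContinuousOn h (simplex d)) :
    IntegrableOn (fun x => kernel b s x * h x) (simplex d) := by
  obtain ⟨C, hC⟩ := isCompact_simplex.exists_bound_of_continuousOn hc
  exact integrableOn_kernel_mul hd hb hs (hc.aestronglyMeasurable measurableSet_simplex) hC

lemma integral_kernel_mul_coord (hd : 1 ≤ d) {b : ℝ} (hb : 0 < b) {s : Fin d → ℝ}
    (hs : s ∈ simplex d) (i : Fin d) :
    ∫ x in simplex d, kernel b s x * x i = (s i + b) / (1 + (d + 1) * b) := by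
  have := integral_dirichletDensity_mul_coord hd (kernel_param_pos hb hs)
    (kernel_last_param_pos hb hs) i
  rw [sum_kernel_params hb hs] at this
  refine this.trans ?_
  field_simp
  ring

lemma integral_kernel_mul_coord_mul_coord (hd : 1 ≤ d) {b : ℝ} (hb : 0 < b) {s : Fin d → ℝ}
    (hs : s ∈ simplex d) (i j : Fin d) :
    ∫ x in simplex d, kernel b s x * (x i * x j) =
      (s i + b) * (s j + b + if i = j then b else 0) /
        ((1 + (d + 1) * b) * (1 + (d + 2) * b)) := by
  have := integral_dirichletDensity_mul_coord_mul_coord hd (kernel_param_pos hb hs)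
    (kernel_last_param_pos hb hs) i j
  rw [sum_kernel_params hb hs] at this
  refine this.trans ?_
  split_ifs
  · field_simp; ring
  · field_simp; ring

/-- The first moments of the kernel about `s`: to order `b`, the coefficient of `∂ᵢ f` in `g`. -/
lemma integral_kernel_mul_sub (hd : 1 ≤ d) {b : ℝ} (hb : 0 < b) {s : Fin d → ℝ}
    (hs : s ∈ simplex d) (i : Fin d) :
    ∫ x in simplex d, kernel b s x * (x i - s i) =
      b * ((1 - (d + 1) * s i) / (1 + (d + 1) * b)) := by
  have h : ∀ x : Fin d → ℝ, kernel b s x * (x i - s i) =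
    kernel b s x * x i - kernel b s x * s i := fun x => by ring
  simp_rw [h]
  rw [integral_sub (integrableOn_kernel_mul_of_continuousOn hd hb hs
    (continuous_apply i).continuousOn) ((integrableOn_kernel hd hb hs).mul_const _),
    integral_mul_const, integral_kernel hd hb hs, integral_kernel_mul_coord hd hb hs]
  field_simp
  ring

/-- The second moments of the kernel about `s`: to order `b`, twice the coefficient of `∂ᵢ ∂ⱼ f` in
`g`. -/
lemma integral_kernel_mul_sub_mul_sub (hd : 1 ≤ d) {b : ℝ} (hb : 0 < b) {s : Fin d → ℝ}
    (hs : s ∈ simplex d) (i j : Fin d) :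
    ∫ x in simplex d, kernel b s x * ((x i - s i) * (x j - s j)) =
      b * ((s i * ((if i = j then 1 else 0) - s j) + b * (1 + (if i = j then 1 else 0)
          - (d + 2) * (s i + s j) + (d + 1) * (d + 2) * (s i * s j))) /
        ((1 + (d + 1) * b) * (1 + (d + 2) * b))) := by
  have h : ∀ x : Fin d → ℝ, kernel b s x * ((x i - s i) * (x j - s j)) =
    kernel b s x * (x i * x j) - kernel b s x * (s i * x j) - kernel b s x * (s j * (x i - s i)) :=
    fun x => by ring
  have e : ∀ x : Fin d → ℝ, kernel b s x * (s i * x j) = s i * (kernel b s x * x j) :=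
    fun x => by ring
  have e' : ∀ x : Fin d → ℝ, kernel b s x * (s j * (x i - s i)) =
    s j * (kernel b s x * (x i - s i)) := fun x => by ring
  have i1 : IntegrableOn (fun x => kernel b s x * (x i * x j)) (simplex d) :=
    integrableOn_kernel_mul_of_continuousOn hd hb hs (by fun_prop)
  have i2 : IntegrableOn (fun x => kernel b s x * (s i * x j)) (simplex d) :=
    integrableOn_kernel_mul_of_continuousOn hd hb hs (by fun_prop)
  have i3 : IntegrableOn (fun x => kernel b s x * (s j * (x i - s i))) (simplex d) :=
    integrableOn_kernel_mul_of_continuousOn hd hb hs (by fun_prop)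
  have i4 : IntegrableOn (fun x => kernel b s x * (x i * x j) - kernel b s x * (s i * x j))
    (simplex d) := i1.sub i2
  simp_rw [h]
  rw [integral_sub i4 i3, integral_sub i1 i2]
  simp_rw [e, e']
  rw [integral_const_mul, integral_const_mul, integral_kernel_mul_sub hd hb hs,
    integral_kernel_mul_coord hd hb hs, integral_kernel_mul_coord_mul_coord hd hb hs]
  split_ifs
  · field_simp; ring
  · field_simp; ring

/-! ### Taylor expansion on the closed simplex -/

/-- The second derivative of `f` within the simplex. -/
def hessian (f : (Fin d → ℝ) → ℝ) (s : Fin d → ℝ) :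
    (Fin d → ℝ) →L[ℝ] (Fin d → ℝ) →L[ℝ] ℝ :=
  fderivWithin ℝ (fderivWithin ℝ f (simplex d)) (simplex d) s

section Taylor

variable {f : (Fin d → ℝ) → ℝ} (hf : ContDiffOn ℝ 2 f (simplex d))

include hf

lemma contDiffOn_fderivWithin_simplex :
    ContDiffOn ℝ 1 (fderivWithin ℝ f (simplex d)) (simplex d) :=
  hf.fderivWithin uniqueDiffOn_simplex (by norm_num)

lemma continuousOn_hessian : ContinuousOn (hessian f) (simplex d) :=
  (contDiffOn_fderivWithin_simplex hf).continuousOn_fderivWithin uniqueDiffOn_simplex le_rfl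

lemma hasFDerivWithinAt_simplex {s : Fin d → ℝ} (hs : s ∈ simplex d) :
    HasFDerivWithinAt f (fderivWithin ℝ f (simplex d) s) (simplex d) s :=
  (hf.differentiableOn (by norm_num) s hs).hasFDerivWithinAt

lemma hasFDerivWithinAt_fderivWithin_simplex {s : Fin d → ℝ} (hs : s ∈ simplex d) :
    HasFDerivWithinAt (fderivWithin ℝ f (simplex d)) (hessian f s) (simplex d) s :=
  ((contDiffOn_fderivWithin_simplex hf).differentiableOn (by norm_num) s hs).hasFDerivWithinAt

lemma pderiv_pderiv_eq_hessian {s : Fin d → ℝ} (hs : s ∈ simplex d) (i j : Fin d) :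
    pderiv i (pderiv j f) s = hessian f s (Pi.single i 1) (Pi.single j 1) := by
  have h1 := (hasFDerivWithinAt_fderivWithin_simplex hf hs).clm_apply
    (hasFDerivWithinAt_const (Pi.single j (1 : ℝ) : Fin d → ℝ) s (simplex d))
  have h2 : pderiv i (pderiv j f) s =
    fderivWithin ℝ (fun y => fderivWithin ℝ f (simplex d) y (Pi.single j 1)) (simplex d) s
      (Pi.single i 1) := rfl
  rw [h2, h1.fderivWithin (uniqueDiffOn_simplex s hs)]
  simp

lemma exists_norm_hessian_le : ∃ L, 0 ≤ L ∧ ∀ s ∈ simplex d, ‖hessian f s‖ ≤ L := by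
  obtain ⟨L, hL⟩ := isCompact_simplex.exists_bound_of_continuousOn
    (E := (Fin d → ℝ) →L[ℝ] (Fin d → ℝ) →L[ℝ] ℝ) (continuousOn_hessian hf)
  exact ⟨max L 0, le_max_right _ _, fun s hs => (hL s hs).trans (le_max_left _ _)⟩

/-- Taylor's formula of order one, by the mean value inequality on segments of the simplex, applied
to the gradient and then to `f`; no extension of `f` beyond the simplex is needed. -/
lemma exists_taylor_one_bound : ∃ L, 0 ≤ L ∧ ∀ s ∈ simplex d, ∀ x ∈ simplex d,
    |f x - f s - fderivWithin ℝ f (simplex d) s (x - s)| ≤ L * ‖x - s‖ ^ 2 := by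
  obtain ⟨L, hL0, hL⟩ := exists_norm_hessian_le hf
  refine ⟨L, hL0, fun s hs x hx => ?_⟩
  have hsub : segment ℝ s x ⊆ simplex d := convex_simplex.segment_subset hs hx
  have key := (convex_segment s x).norm_image_sub_le_of_norm_hasFDerivWithin_le'
    (f := f) (f' := fderivWithin ℝ f (simplex d)) (φ := fderivWithin ℝ f (simplex d) s)
    (C := L * ‖x - s‖) (fun z hz => (hasFDerivWithinAt_simplex hf (hsub hz)).mono hsub)
    (fun z hz => ?_) (left_mem_segment ℝ s x) (right_mem_segment ℝ s x)
  · rw [Real.norm_eq_abs] at key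
    exact key.trans (by rw [sq, mul_assoc])
  · have h1 := convex_simplex.norm_image_sub_le_of_norm_hasFDerivWithin_le
      (fun z hz => hasFDerivWithinAt_fderivWithin_simplex hf hz) hL hs (hsub hz)
    refine h1.trans (mul_le_mul_of_nonneg_left ?_ hL0)
    obtain ⟨t, ht, rfl⟩ := (segment_eq_image' ℝ s x) ▸ hz
    simp only [add_sub_cancel_left, norm_smul, Real.norm_eq_abs, abs_of_nonneg ht.1]
    exact mul_le_of_le_one_left (norm_nonneg _) ht.2

/-- Taylor's formula of order two with Peano remainder, uniformly on the simplex. -/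
lemma exists_taylor_two_bound {ε : ℝ} (hε : 0 < ε) : ∃ δ > 0, ∀ s ∈ simplex d, ∀ x ∈ simplex d,
    ‖x - s‖ < δ → |f x - f s - fderivWithin ℝ f (simplex d) s (x - s)
      - 1 / 2 * hessian f s (x - s) (x - s)| ≤ ε * ‖x - s‖ ^ 2 := by
  have huc := isCompact_simplex.uniformContinuousOn_of_continuous
    (β := (Fin d → ℝ) →L[ℝ] (Fin d → ℝ) →L[ℝ] ℝ) (continuousOn_hessian hf)
  obtain ⟨δ, hδ, H⟩ := (Metric.uniformContinuousOn_iff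
    (β := (Fin d → ℝ) →L[ℝ] (Fin d → ℝ) →L[ℝ] ℝ)).1 huc ε hε
  refine ⟨δ, hδ, fun s hs x hx hxs => ?_⟩
  set v := x - s with hv
  have hmem : ∀ t ∈ Set.Icc (0 : ℝ) 1, s + t • v ∈ simplex d := fun t ht =>
    convex_simplex.add_smul_sub_mem hs hx ht
  have hnorm : ∀ t ∈ Set.Icc (0 : ℝ) 1, ‖t • v‖ ≤ ‖v‖ := fun t ht => by
    rw [norm_smul, Real.norm_eq_abs, abs_of_nonneg ht.1]
    exact mul_le_of_le_one_left (norm_nonneg _) ht.2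
  -- the gradient along the segment is within `ε ‖v‖` of its linearization at `s`
  have h1 : ∀ t ∈ Set.Icc (0 : ℝ) 1,
      ‖fderivWithin ℝ f (simplex d) (s + t • v) - fderivWithin ℝ f (simplex d) s
        - hessian f s (t • v)‖ ≤ ε * ‖v‖ := fun t ht => by
    have hsub : segment ℝ s (s + t • v) ⊆ simplex d :=
      convex_simplex.segment_subset hs (hmem t ht)
    have := (convex_segment s (s + t • v)).norm_image_sub_le_of_norm_hasFDerivWithin_le'
      (f := fderivWithin ℝ f (simplex d)) (f' := hessian f) (φ := hessian f s)
      (C := ε) (fun z hz => (hasFDerivWithinAt_fderivWithin_simplex hf (hsub hz)).mono hsub)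
      (fun z hz => ?_) (left_mem_segment ℝ _ _) (right_mem_segment ℝ _ _)
    · rw [add_sub_cancel_left] at this
      exact this.trans (mul_le_mul_of_nonneg_left (hnorm t ht) hε.le)
    · rw [← dist_eq_norm]
      refine (H z (hsub hz) s hs ?_).le
      obtain ⟨r, hr, rfl⟩ := (segment_eq_image' ℝ s (s + t • v)) ▸ hz
      simp only [dist_eq_norm, add_sub_cancel_left]
      rw [norm_smul, Real.norm_eq_abs, abs_of_nonneg hr.1]
      exact ((mul_le_of_le_one_left (norm_nonneg _) hr.2).trans (hnorm t ht)).trans_lt hxs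
  -- so the Taylor remainder along the segment has a derivative of size at most `ε ‖v‖²`
  have key := norm_image_sub_le_of_norm_deriv_le_segment_01'
    (f := fun t : ℝ => f (s + t • v) - t * fderivWithin ℝ f (simplex d) s v
      - t ^ 2 / 2 * hessian f s v v)
    (f' := fun t : ℝ => fderivWithin ℝ f (simplex d) (s + t • v) v
      - fderivWithin ℝ f (simplex d) s v - t * hessian f s v v)
    (C := ε * ‖v‖ ^ 2) (fun t ht => ?_) (fun t ht => ?_)
  · simp only [one_smul, zero_smul, add_zero, Real.norm_eq_abs] at key
    refine le_trans (le_of_eq ?_) key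
    congr 1
    rw [hv, add_sub_cancel]; ring
  · have e1 : HasDerivWithinAt (fun t : ℝ => s + t • v) v (Set.Icc 0 1) t := by
      simpa using ((hasDerivAt_id t).smul_const v).const_add s |>.hasDerivWithinAt
    have e2 : HasDerivWithinAt (fun t : ℝ => f (s + t • v))
        (fderivWithin ℝ f (simplex d) (s + t • v) v) (Set.Icc 0 1) t :=
      (hasFDerivWithinAt_simplex hf (hmem t ht)).comp_hasDerivWithinAt t e1 hmem
    have e3 : HasDerivWithinAt (fun t : ℝ => t * fderivWithin ℝ f (simplex d) s v)
        (fderivWithin ℝ f (simplex d) s v) (Set.Icc 0 1) t := by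
      simpa using ((hasDerivAt_id t).mul_const (fderivWithin ℝ f (simplex d) s v)).hasDerivWithinAt
    have e4 : HasDerivWithinAt (fun t : ℝ => t ^ 2 / 2 * hessian f s v v)
        (t * hessian f s v v) (Set.Icc 0 1) t := by
      have := (((hasDerivAt_id t).pow 2).div_const 2).mul_const (hessian f s v v)
      refine (this.hasDerivWithinAt).congr_deriv ?_
      simp
    exact (e2.sub e3).sub e4
  · have := (ContinuousLinearMap.le_opNorm _ v).trans
      (mul_le_mul_of_nonneg_right (h1 t ⟨ht.1, ht.2.le⟩) (norm_nonneg v))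
    simp only [sub_apply, map_smul, smul_apply,
      smul_eq_mul] at this
    exact this.trans (by rw [sq, mul_assoc])

lemma continuousOn_pderiv (i : Fin d) : ContinuousOn (pderiv i f) (simplex d) :=
  (contDiffOn_fderivWithin_simplex hf).continuousOn.clm_apply continuousOn_const

lemma continuousOn_biasCoeff : ContinuousOn (biasCoeff f) (simplex d) := by
  have h2 : ∀ i j, ContinuousOn (pderiv i (pderiv j f)) (simplex d) := fun i j =>
    (((continuousOn_hessian hf).clm_apply continuousOn_const).clm_apply
      continuousOn_const).congr fun s hs => pderiv_pderiv_eq_hessian hf hs i j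
  have h1 := continuousOn_pderiv hf
  unfold biasCoeff
  refine ContinuousOn.add (continuousOn_finsetSum _ fun i _ => ?_)
    (continuousOn_const.mul (continuousOn_finsetSum _ fun i _ =>
      continuousOn_finsetSum _ fun j _ => ?_))
  · exact ContinuousOn.mul (by fun_prop) (h1 i)
  · exact ContinuousOn.mul (by fun_prop) (h2 i j)

end Taylor

lemma clm_apply_eq_sum (L : (Fin d → ℝ) →L[ℝ] ℝ) (v : Fin d → ℝ) :
    L v = ∑ i, L (Pi.single i 1) * v i := by
  conv_lhs => rw [← Finset.univ_sum_single v]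
  rw [map_sum]
  refine Finset.sum_congr rfl fun i _ => ?_
  have : Pi.single i (v i) = v i • (Pi.single i 1 : Fin d → ℝ) := by
    rw [← Pi.single_smul]; simp
  rw [this, map_smul, smul_eq_mul, mul_comm]

lemma bilin_apply_eq_sum (L : (Fin d → ℝ) →L[ℝ] (Fin d → ℝ) →L[ℝ] ℝ) (v : Fin d → ℝ) :
    L v v = ∑ i, ∑ j, L (Pi.single i 1) (Pi.single j 1) * (v i * v j) := by
  have h : L v v = (L.flip v) v := rfl
  rw [h, clm_apply_eq_sum]
  refine Finset.sum_congr rfl fun i _ => ?_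
  rw [ContinuousLinearMap.flip_apply, clm_apply_eq_sum (L (Pi.single i 1)) v, Finset.sum_mul]
  exact Finset.sum_congr rfl fun j _ => by ring

/-- The norm on `Fin d → ℝ` is the supremum norm. -/
lemma norm_sq_le_sum_sq (v : Fin d → ℝ) : ‖v‖ ^ 2 ≤ ∑ i, v i ^ 2 := by
  have h0 : 0 ≤ ∑ i, v i ^ 2 := Finset.sum_nonneg fun i _ => sq_nonneg _
  rw [← Real.sqrt_le_sqrt_iff h0, Real.sqrt_sq (norm_nonneg _),
    pi_norm_le_iff_of_nonneg (Real.sqrt_nonneg _)]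
  intro i
  rw [Real.norm_eq_abs]
  exact Real.abs_le_sqrt (Finset.single_le_sum (f := fun i => v i ^ 2)
    (fun j _ => sq_nonneg _) (Finset.mem_univ i))

/-! ### Stirling's formula for the Gamma function on the reals -/

/-- `log Γ(x+1)` minus the main terms of Stirling's formula. -/
def stirlingRemainder (x : ℝ) : ℝ :=
  Real.log (Real.Gamma (x + 1)) - ((x + 1 / 2) * Real.log x - x)

lemma tendsto_stirlingRemainder_nat :
    Tendsto (fun n : ℕ => stirlingRemainder n) atTop (𝓝 (Real.log (2 * Real.pi) / 2)) := by
  have h := (Stirling.tendsto_stirlingSeq_sqrt_pi.log (by positivity)).add_const (Real.log 2 / 2)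
  have e : Real.log √Real.pi + Real.log 2 / 2 = Real.log (2 * Real.pi) / 2 := by
    rw [Real.log_sqrt Real.pi_pos.le, Real.log_mul two_ne_zero Real.pi_ne_zero]; ring
  rw [e] at h
  refine h.congr' ?_
  filter_upwards [eventually_gt_atTop 0] with n hn
  have hn' : (0 : ℝ) < n := by exact_mod_cast hn
  rw [Stirling.log_stirlingSeq_formula, stirlingRemainder, Real.Gamma_nat_eq_factorial,
    Real.log_mul two_ne_zero hn'.ne', Real.log_div hn'.ne' (Real.exp_ne_zero _), Real.log_exp]
  ring

/-- Log-convexity of `Γ` transfers Stirling's formula from integers to reals. -/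
lemma abs_stirlingRemainder_sub_le {n : ℕ} (hn : 0 < n) {t : ℝ} (ht0 : 0 ≤ t) (ht1 : t < 1) :
    |stirlingRemainder (n + t) - stirlingRemainder n| ≤ 2 / n := by
  have hn' : (0 : ℝ) < n := by exact_mod_cast hn
  have hn1 : (1 : ℝ) ≤ n := by exact_mod_cast hn
  have hfeq : ∀ {y : ℝ}, 0 < y → (Real.log ∘ Real.Gamma) (y + 1) =
      (Real.log ∘ Real.Gamma) y + Real.log y := fun {y} hy => by
    simp only [Function.comp_apply]
    rw [Real.Gamma_add_one hy.ne', Real.log_mul hy.ne' (Real.Gamma_pos_of_pos hy).ne', add_comm]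
  rcases ht0.eq_or_lt with rfl | ht
  · simp; positivity
  -- `Γ(n+1) n^t ≤ Γ(n+1+t) ≤ Γ(n+1) (n+1)^t`
  have h1 := Real.BohrMollerup.f_add_nat_le Real.convexOn_log_Gamma hfeq (n := n + 1)
    (Nat.succ_ne_zero _) ht ht1.le
  have h2 := Real.BohrMollerup.f_add_nat_ge Real.convexOn_log_Gamma hfeq (n := n + 1)
    (by omega) ht
  push_cast at h1 h2
  simp only [Function.comp_apply, add_sub_cancel_right] at h1 h2
  have hlog1 : Real.log (n + t) = Real.log n + Real.log (1 + t / n) := by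
    rw [← Real.log_mul hn'.ne' (by positivity)]; congr 1; field_simp
  have hlog2 : Real.log (n + 1) = Real.log n + Real.log (1 + 1 / n) := by
    rw [← Real.log_mul hn'.ne' (by positivity)]; congr 1; field_simp
  have a1 : Real.log (1 + t / n) ≤ t / n := by
    have := Real.log_le_sub_one_of_pos (show 0 < 1 + t / n by positivity); linarith
  have a2 : Real.log (1 + 1 / n) ≤ 1 / n := by
    have := Real.log_le_sub_one_of_pos (show (0 : ℝ) < 1 + 1 / n by positivity); linarith
  have a3 : t / (n + t) ≤ Real.log (1 + t / n) := by
    have := Real.one_sub_inv_le_log_of_pos (show 0 < 1 + t / n by positivity)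
    refine le_trans (le_of_eq ?_) this
    field_simp
    ring
  have b1 : (n + t + 1 / 2) * Real.log (1 + t / n) - t ≤ 2 / n := by
    have : (n + t + 1 / 2) * Real.log (1 + t / n) ≤ (n + t + 1 / 2) * (t / n) :=
      mul_le_mul_of_nonneg_left a1 (by positivity)
    have e : (n + t + 1 / 2) * (t / n) - t = (t + 1 / 2) * t / n := by field_simp; ring
    have : (t + 1 / 2) * t / n ≤ 2 / n := by gcongr; nlinarith
    linarith
  have b2 : 0 ≤ (n + t + 1 / 2) * Real.log (1 + t / n) - t := by
    have : (n + t + 1 / 2) * (t / (n + t)) ≤ (n + t + 1 / 2) * Real.log (1 + t / n) :=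
      mul_le_mul_of_nonneg_left a3 (by positivity)
    have e : (n + t + 1 / 2) * (t / (n + t)) - t = 1 / 2 * (t / (n + t)) := by field_simp; ring
    have : 0 ≤ 1 / 2 * (t / (n + t)) := by positivity
    linarith
  have c1 : t * Real.log (1 + 1 / n) ≤ 2 / n := by
    have : t * Real.log (1 + 1 / n) ≤ 1 * (1 / n) :=
      mul_le_mul ht1.le a2 (Real.log_nonneg (by simp)) one_pos.le
    have : (1 : ℝ) / n ≤ 2 / n := by gcongr; norm_num
    linarith
  rw [show (n : ℝ) + 1 + t = n + t + 1 by ring] at h1 h2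
  rw [abs_le]
  simp only [stirlingRemainder, hlog1]
  rw [hlog2] at h1
  constructor <;> nlinarith

lemma tendsto_stirlingRemainder :
    Tendsto stirlingRemainder atTop (𝓝 (Real.log (2 * Real.pi) / 2)) := by
  have hfl : Tendsto (fun x : ℝ => ⌊x⌋₊) atTop atTop := tendsto_nat_floor_atTop
  have h1 := tendsto_stirlingRemainder_nat.comp hfl
  have h2 : Tendsto (fun x : ℝ => stirlingRemainder x - stirlingRemainder ⌊x⌋₊) atTop (𝓝 0) := by
    have hb : Tendsto (fun x : ℝ => 2 / (⌊x⌋₊ : ℝ)) atTop (𝓝 0) :=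
      (tendsto_const_div_atTop_nhds_zero_nat 2).comp hfl
    refine squeeze_zero_norm' ?_ hb
    filter_upwards [eventually_ge_atTop 1] with x hx
    have hx0 : 0 ≤ x := by linarith
    have := abs_stirlingRemainder_sub_le (n := ⌊x⌋₊) (Nat.floor_pos.2 hx)
      (t := x - ⌊x⌋₊) (by linarith [Nat.floor_le hx0]) (by linarith [Nat.lt_floor_add_one x])
    rwa [add_sub_cancel] at this
  simpa using h2.add h1

lemma gamma_add_one_eq {x : ℝ} (hx : 0 < x) :
    Real.Gamma (x + 1) = √x * x ^ x * Real.exp (-x) * Real.exp (stirlingRemainder x) := by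
  have hG : 0 < Real.Gamma (x + 1) := Real.Gamma_pos_of_pos (by linarith)
  rw [stirlingRemainder, Real.sqrt_eq_rpow, Real.rpow_def_of_pos hx, Real.rpow_def_of_pos hx,
    ← Real.exp_add, ← Real.exp_add, ← Real.exp_add]
  rw [← Real.exp_log hG]
  congr 1
  rw [Real.exp_log hG]
  ring

lemma continuousOn_gamma : ContinuousOn Real.Gamma (Set.Ioi 0) := fun x hx =>
  (Real.differentiableAt_Gamma fun m h => by
    have : (0 : ℝ) ≤ m := m.cast_nonneg
    have : (0 : ℝ) < x := hx
    linarith).continuousAt.continuousWithinAt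

lemma exists_gamma_lower_bound : ∃ c > 0, ∀ x : ℝ, 1 ≤ x → c ≤ Real.Gamma x := by
  obtain ⟨x0, hx0, hmin⟩ := Real.exists_isMinOn_Gamma_Ioi
  refine ⟨Real.Gamma x0, Real.Gamma_pos_of_pos (by linarith [hx0.1]), fun x hx => ?_⟩
  exact hmin (show (0 : ℝ) < x by linarith)

lemma exists_stirling_bound : ∃ M, ∀ x : ℝ, 1 ≤ x → |stirlingRemainder x| ≤ M := by
  have h1 := tendsto_stirlingRemainder.abs
  have hb := h1.eventually (eventually_le_nhds (lt_add_one _))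
  obtain ⟨R, hR⟩ := eventually_atTop.1 hb
  have hc : ContinuousOn stirlingRemainder (Set.Icc 1 (max R 1)) := by
    unfold stirlingRemainder
    refine ContinuousOn.sub (ContinuousOn.log (continuousOn_gamma.comp (by fun_prop)
      fun x hx => ?_) fun x hx => ?_) (ContinuousOn.sub (ContinuousOn.mul (by fun_prop)
        (ContinuousOn.log continuousOn_id fun x hx => ?_)) (by fun_prop))
    · show (0 : ℝ) < x + 1
      linarith [hx.1]
    · exact (Real.Gamma_pos_of_pos (by linarith [hx.1])).ne'
    · have := hx.1
      linarith
  obtain ⟨C, hC⟩ := isCompact_Icc.exists_bound_of_continuousOn hc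
  refine ⟨max C (|Real.log (2 * Real.pi) / 2| + 1), fun x hx => ?_⟩
  rcases le_total x (max R 1) with h | h
  · exact (hC x ⟨hx, h⟩).trans (le_max_left _ _)
  · exact (hR x ((le_max_left _ _).trans h)).trans (le_max_right _ _)

/-- The Stirling remainder is bounded below on the whole half line (it tends to `∞` at `0`). -/
lemma exists_stirlingRemainder_ge : ∃ m, ∀ x : ℝ, 0 < x → -m ≤ stirlingRemainder x := by
  obtain ⟨M, hM⟩ := exists_stirling_bound
  obtain ⟨c, hc, hcG⟩ := exists_gamma_lower_bound
  refine ⟨max M (-Real.log c), fun x hx => ?_⟩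
  rcases le_total x 1 with h | h
  · have h1 : Real.log c ≤ Real.log (Real.Gamma (x + 1)) :=
      Real.log_le_log hc (hcG _ (by linarith))
    have h2 : (x + 1 / 2) * Real.log x ≤ 0 :=
      mul_nonpos_of_nonneg_of_nonpos (by linarith) (Real.log_nonpos hx.le h)
    rw [stirlingRemainder]
    linarith [le_max_right M (-Real.log c)]
  · linarith [(abs_le.1 (hM x h)).1, le_max_left M (-Real.log c)]

/-! ### The kernel near and away from its peak -/

/-- Barycentric coordinates: the coordinates of `s` together with `1 - ‖s‖₁` (at `none`). -/
def bary (s : Fin d → ℝ) : Option (Fin d) → ℝ := fun o => o.elim (1 - l1norm s) s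

lemma bary_nonneg {s : Fin d → ℝ} (hs : s ∈ simplex d) (o : Option (Fin d)) : 0 ≤ bary s o := by
  cases o with
  | none => simpa [bary] using hs.2
  | some i => exact simplex_nonneg hs i

lemma bary_pos {s : Fin d → ℝ} (hs : s ∈ openSimplex d) (o : Option (Fin d)) : 0 < bary s o := by
  cases o with
  | none => simpa [bary, l1norm_simplex (openSimplex_subset hs)] using hs.2
  | some i => exact hs.1 i

lemma sum_bary {s : Fin d → ℝ} (hs : s ∈ simplex d) : ∑ o, bary s o = 1 := by
  rw [Fintype.sum_option]
  simp [bary, l1norm_simplex hs]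

lemma bary_le_one {s : Fin d → ℝ} (hs : s ∈ simplex d) (o : Option (Fin d)) : bary s o ≤ 1 :=
  (Finset.single_le_sum (fun o _ => bary_nonneg hs o) (Finset.mem_univ o)).trans (sum_bary hs).le

lemma psi_eq {s : Fin d → ℝ} (hs : s ∈ simplex d) :
    psi s = (4 * Real.pi) ^ (-(d : ℝ) / 2) * (∏ o, bary s o) ^ (-(1 / 2) : ℝ) := by
  have h : (4 * Real.pi) ^ d * (1 - l1norm s) * ∏ i, s i =
      (4 * Real.pi) ^ d * ∏ o, bary s o := by
    rw [Fintype.prod_option, mul_assoc]; rfl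
  rw [psi, h, Real.mul_rpow (by positivity) (Finset.prod_nonneg fun o _ => bary_nonneg hs o),
    ← Real.rpow_natCast, ← Real.rpow_mul (by positivity)]
  congr 2
  ring

lemma psi_nonneg {s : Fin d → ℝ} (hs : s ∈ simplex d) : 0 ≤ psi s := by
  rw [psi_eq hs]
  have : 0 ≤ ∏ o, bary s o := Finset.prod_nonneg fun o _ => bary_nonneg hs o
  positivity

lemma psi_pos {s : Fin d → ℝ} (hs : s ∈ openSimplex d) : 0 < psi s := by
  rw [psi_eq (openSimplex_subset hs)]
  have : 0 < ∏ o, bary s o := Finset.prod_pos fun o _ => bary_pos hs o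
  positivity

lemma continuous_bary (o : Option (Fin d)) : Continuous fun s : Fin d → ℝ => bary s o := by
  cases o with
  | none =>
    have : Continuous (l1norm (d := d)) := by unfold l1norm; fun_prop
    exact continuous_const.sub this
  | some i => exact continuous_apply i

lemma continuousOn_psi : ContinuousOn (psi (d := d)) (openSimplex d) := by
  have : ContinuousOn (fun s : Fin d → ℝ => (4 * Real.pi) ^ (-(d : ℝ) / 2) *
      (∏ o, bary s o) ^ (-(1 / 2) : ℝ)) (openSimplex d) := by
    refine continuousOn_const.mul (ContinuousOn.rpow_const ?_ fun s hs => Or.inl ?_)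
    · exact (continuous_finsetProd _ fun o _ => continuous_bary o).continuousOn
    · exact (Finset.prod_pos fun o _ => bary_pos hs o).ne'
  exact this.congr fun s hs => psi_eq (openSimplex_subset hs)

/-- `ψ` is a multiple of the Dirichlet weight with all parameters equal to `1/2`. -/
lemma integrableOn_psi (hd : 1 ≤ d) : IntegrableOn (psi (d := d)) (simplex d) := by
  have h := (integrableOn_dirichletWeight hd (α := fun _ : Fin d => 1 / 2)
    (fun _ => by norm_num) (β := 1 / 2) (by norm_num)).const_mul ((4 * Real.pi) ^ (-(d : ℝ) / 2))
  refine IntegrableOn.congr_fun h (fun s hs => ?_) measurableSet_simplex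
  rw [psi_eq hs, Fintype.prod_option, Real.mul_rpow (bary_nonneg hs none)
    (Finset.prod_nonneg fun i _ => bary_nonneg hs (some i)), dirichletWeight]
  rw [← Real.finsetProd_rpow _ _ fun i _ => bary_nonneg hs (some i)]
  norm_num [bary]

/-- The shape of the kernel: `∏ₒ xₒ ^ sₒ` in barycentric coordinates, whose logarithm is minus the
cross-entropy of `x` relative to `s`. -/
def profile (s x : Fin d → ℝ) : ℝ := ∏ o, bary x o ^ bary s o

lemma profile_nonneg (s : Fin d → ℝ) {x : Fin d → ℝ} (hx : x ∈ simplex d) : 0 ≤ profile s x :=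
  Finset.prod_nonneg fun o _ => Real.rpow_nonneg (bary_nonneg hx o) _

lemma profile_pos (s : Fin d → ℝ) {x : Fin d → ℝ} (hx : x ∈ openSimplex d) : 0 < profile s x :=
  Finset.prod_pos fun o _ => Real.rpow_pos_of_pos (bary_pos hx o) _

lemma profile_le_one {s x : Fin d → ℝ} (hs : s ∈ simplex d) (hx : x ∈ simplex d) :
    profile s x ≤ 1 :=
  Finset.prod_le_one (fun o _ => Real.rpow_nonneg (bary_nonneg hx o) _)
    fun o _ => Real.rpow_le_one (bary_nonneg hx o) (bary_le_one hx o) (bary_nonneg hs o)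

/-- The normalizing constant of the kernel. -/
def kernelConst (b : ℝ) (s : Fin d → ℝ) : ℝ :=
  Real.Gamma (1 / b + d + 1) / ∏ o, Real.Gamma (bary s o / b + 1)

lemma gamma_bary_pos {b : ℝ} (hb : 0 < b) {s : Fin d → ℝ} (hs : s ∈ simplex d)
    (o : Option (Fin d)) : 0 < Real.Gamma (bary s o / b + 1) := by
  have := bary_nonneg hs o
  exact Real.Gamma_pos_of_pos (by positivity)

lemma kernelConst_pos {b : ℝ} (hb : 0 < b) {s : Fin d → ℝ} (hs : s ∈ simplex d) :
    0 < kernelConst b s :=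
  div_pos (Real.Gamma_pos_of_pos (by positivity))
    (Finset.prod_pos fun o _ => gamma_bary_pos hb hs o)

/-- The kernel is the `1/b`-th power of a fixed profile, normalized. -/
lemma kernel_eq {b : ℝ} (hb : 0 < b) {s x : Fin d → ℝ} (hs : s ∈ simplex d)
    (hx : x ∈ simplex d) : kernel b s x = kernelConst b s * profile s x ^ (1 / b) := by
  rw [kernel, dirichletDensity, l1norm_eq_sum fun i => (kernel_param_pos hb hs i).le,
    sum_kernel_params hb hs, mul_assoc, kernelConst, profile,
    ← Real.finsetProd_rpow _ _ fun o _ => Real.rpow_nonneg (bary_nonneg hx o) _,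
    Fintype.prod_option, Fintype.prod_option]
  have h : ∀ o, (bary x o ^ bary s o) ^ (1 / b) = bary x o ^ (bary s o / b) := fun o => by
    rw [← Real.rpow_mul (bary_nonneg hx o), mul_one_div]
  simp_rw [h, add_sub_cancel_right]
  rfl

lemma kernel_le_const {b : ℝ} (hb : 0 < b) : ∃ C, ∀ s ∈ simplex d, ∀ x ∈ simplex d,
    kernel b s x ≤ C := by
  obtain ⟨c, hc, hcG⟩ := exists_gamma_lower_bound
  refine ⟨Real.Gamma (1 / b + d + 1) / ∏ _o : Option (Fin d), c, fun s hs x hx => ?_⟩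
  have h1 : profile s x ^ (1 / b) ≤ 1 :=
    Real.rpow_le_one (profile_nonneg s hx) (profile_le_one hs hx) (by positivity)
  have hG : 0 ≤ Real.Gamma (1 / b + d + 1) := (Real.Gamma_pos_of_pos (by positivity)).le
  rw [kernel_eq hb hs hx]
  refine (mul_le_of_le_one_right (kernelConst_pos hb hs).le h1).trans ?_
  refine div_le_div_of_nonneg_left hG (Finset.prod_pos fun _ _ => hc) ?_
  refine Finset.prod_le_prod (fun _ _ => hc.le) fun o _ => hcG _ ?_
  have := bary_nonneg hs o
  have : 0 ≤ bary s o / b := by positivity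
  linarith

lemma kernel_self_pos {b : ℝ} (hb : 0 < b) {s : Fin d → ℝ} (hs : s ∈ openSimplex d) :
    0 < kernel b s s := by
  rw [kernel_eq hb (openSimplex_subset hs) (openSimplex_subset hs)]
  exact mul_pos (kernelConst_pos hb (openSimplex_subset hs))
    (Real.rpow_pos_of_pos (profile_pos s hs) _)

/-- Squaring the kernel halves the bandwidth. -/
lemma kernel_sq {b : ℝ} (hb : 0 < b) {s x : Fin d → ℝ} (hs : s ∈ openSimplex d)
    (hx : x ∈ simplex d) :
    kernel b s x ^ 2 = kernel b s s ^ 2 / kernel (b / 2) s s * kernel (b / 2) s x := by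
  have hs' := openSimplex_subset hs
  have h2 : ∀ y ∈ simplex d, profile s y ^ (1 / (b / 2)) = (profile s y ^ (1 / b)) ^ 2 :=
    fun y hy => by
      rw [← Real.rpow_natCast, ← Real.rpow_mul (profile_nonneg s hy)]
      congr 1
      push_cast
      field_simp
  rw [kernel_eq hb hs' hx, kernel_eq hb hs' hs', kernel_eq (half_pos hb) hs' hs',
    kernel_eq (half_pos hb) hs' hx, h2 s hs', h2 x hx]
  have h3 : profile s s ^ (1 / b) ≠ 0 := (Real.rpow_pos_of_pos (profile_pos s hs) _).ne'
  have h4 := (kernelConst_pos (half_pos hb) hs').ne'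
  field_simp

/-- Weighted AM-GM, applied to `√(xₒ / sₒ)`, compares the profile with its peak value; this is the
bound of the Kullback-Leibler divergence by the Hellinger distance. -/
lemma profile_le {s x : Fin d → ℝ} (hs : s ∈ openSimplex d) (hx : x ∈ simplex d) :
    profile s x ≤ profile s s * (1 - (∑ o, (√(bary x o) - √(bary s o)) ^ 2) / 2) ^ 2 ∧
      0 ≤ 1 - (∑ o, (√(bary x o) - √(bary s o)) ^ 2) / 2 := by
  have hs' := openSimplex_subset hs
  -- expanding the squares leaves the Bhattacharyya coefficient `∑ₒ √(xₒ sₒ)`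
  have e : 1 - (∑ o, (√(bary x o) - √(bary s o)) ^ 2) / 2 =
      ∑ o, bary s o * √(bary x o / bary s o) := by
    have : ∀ o, (√(bary x o) - √(bary s o)) ^ 2 =
        bary x o + bary s o - 2 * (bary s o * √(bary x o / bary s o)) := fun o => by
      have h1 := bary_nonneg hx o
      have h2 := bary_pos hs o
      have h3 : bary s o * √(bary x o / bary s o) = √(bary x o) * √(bary s o) := by
        rw [Real.sqrt_div h1]
        nth_rewrite 1 [← Real.mul_self_sqrt h2.le]
        have := (Real.sqrt_pos.2 h2).ne'
        field_simp
      rw [h3, sub_sq, Real.sq_sqrt h1, Real.sq_sqrt h2.le]; ring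
    simp_rw [this, Finset.sum_sub_distrib, Finset.sum_add_distrib, ← Finset.mul_sum, sum_bary hx,
      sum_bary hs']
    ring
  have hgm := Real.geom_mean_le_arith_mean_weighted Finset.univ (bary s)
    (fun o => √(bary x o / bary s o)) (fun o _ => bary_nonneg hs' o) (sum_bary hs')
    (fun o _ => Real.sqrt_nonneg _)
  have h0 : 0 ≤ ∏ o, √(bary x o / bary s o) ^ bary s o :=
    Finset.prod_nonneg fun o _ => Real.rpow_nonneg (Real.sqrt_nonneg _) _
  rw [e]
  refine ⟨?_, h0.trans hgm⟩
  have h2 : profile s x = profile s s * (∏ o, √(bary x o / bary s o) ^ bary s o) ^ 2 := by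
    rw [profile, profile, ← Finset.prod_pow, ← Finset.prod_mul_distrib]
    refine Finset.prod_congr rfl fun o _ => ?_
    have hq : 0 ≤ bary x o / bary s o := div_nonneg (bary_nonneg hx o) (bary_nonneg hs' o)
    rw [← Real.rpow_natCast, ← Real.rpow_mul (Real.sqrt_nonneg _), mul_comm (bary s o),
      Real.rpow_mul (Real.sqrt_nonneg _), Real.rpow_natCast, Real.sq_sqrt hq,
      ← Real.mul_rpow (bary_nonneg hs' o) hq, mul_div_cancel₀ _ (bary_pos hs o).ne']
  rw [h2]
  exact mul_le_mul_of_nonneg_left (pow_le_pow_left₀ h0 hgm 2) (profile_nonneg s hs')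

lemma profile_le_self {s x : Fin d → ℝ} (hs : s ∈ openSimplex d) (hx : x ∈ simplex d) :
    profile s x ≤ profile s s := by
  obtain ⟨h1, h2⟩ := profile_le hs hx
  have h3 : 0 ≤ ∑ o, (√(bary x o) - √(bary s o)) ^ 2 := Finset.sum_nonneg fun o _ => sq_nonneg _
  refine h1.trans (mul_le_of_le_one_right (profile_nonneg s (openSimplex_subset hs)) ?_)
  exact pow_le_one₀ h2 (by linarith)

/-- Decay away from the peak, since `|xᵢ - sᵢ| ≤ 2 |√xᵢ - √sᵢ|` on the simplex. -/
lemma profile_le_of_dist {s x : Fin d → ℝ} (hs : s ∈ openSimplex d) (hx : x ∈ simplex d)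
    {δ : ℝ} (hδ : 0 ≤ δ) (hxs : δ ≤ ‖x - s‖) :
    profile s x ≤ profile s s * Real.exp (-(δ ^ 2 / 4)) := by
  obtain ⟨h1, h2⟩ := profile_le hs hx
  refine h1.trans (mul_le_mul_of_nonneg_left ?_ (profile_nonneg s (openSimplex_subset hs)))
  have hH : δ ^ 2 / 4 ≤ ∑ o, (√(bary x o) - √(bary s o)) ^ 2 := by
    have hn : ‖x - s‖ ≤ 2 * √(∑ o, (√(bary x o) - √(bary s o)) ^ 2) := by
      rw [pi_norm_le_iff_of_nonneg (by positivity)]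
      intro i
      have hx0 := simplex_nonneg hx i
      have hs0 := (hs.1 i).le
      have hi : (√(x i) - √(s i)) ^ 2 ≤ ∑ o, (√(bary x o) - √(bary s o)) ^ 2 :=
        Finset.single_le_sum (f := fun o => (√(bary x o) - √(bary s o)) ^ 2)
          (fun o _ => sq_nonneg _) (Finset.mem_univ (some i))
      have e : x i - s i = (√(x i) - √(s i)) * (√(x i) + √(s i)) := by
        nlinarith [Real.mul_self_sqrt hx0, Real.mul_self_sqrt hs0]
      have a1 : √(x i) ≤ 1 := Real.sqrt_le_one.2 (simplex_le_one hx i)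
      have a2 : √(s i) ≤ 1 := Real.sqrt_le_one.2 (simplex_le_one (openSimplex_subset hs) i)
      rw [Pi.sub_apply, e, norm_mul, mul_comm, Real.norm_eq_abs, Real.norm_eq_abs]
      refine mul_le_mul ?_ (Real.abs_le_sqrt hi) (abs_nonneg _) zero_le_two
      rw [abs_of_nonneg (by positivity)]
      linarith
    have h0 : 0 ≤ ∑ o, (√(bary x o) - √(bary s o)) ^ 2 := Finset.sum_nonneg fun o _ => sq_nonneg _
    have := pow_le_pow_left₀ hδ (hxs.trans hn) 2
    rw [mul_pow, Real.sq_sqrt h0] at this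
    linarith
  have h3 : 1 - (∑ o, (√(bary x o) - √(bary s o)) ^ 2) / 2 ≤ Real.exp (-(δ ^ 2 / 8)) := by
    have := Real.add_one_le_exp (-(δ ^ 2 / 8))
    linarith
  refine (pow_le_pow_left₀ h2 h3 2).trans (le_of_eq ?_)
  rw [← Real.exp_nat_mul]
  congr 1
  push_cast
  ring

lemma kernel_le_self {b : ℝ} (hb : 0 < b) {s x : Fin d → ℝ} (hs : s ∈ openSimplex d)
    (hx : x ∈ simplex d) : kernel b s x ≤ kernel b s s := by
  have hs' := openSimplex_subset hs
  rw [kernel_eq hb hs' hx, kernel_eq hb hs' hs']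
  exact mul_le_mul_of_nonneg_left (Real.rpow_le_rpow (profile_nonneg s hx)
    (profile_le_self hs hx) (by positivity)) (kernelConst_pos hb hs').le

lemma kernel_le_of_dist {b : ℝ} (hb : 0 < b) {s x : Fin d → ℝ} (hs : s ∈ openSimplex d)
    (hx : x ∈ simplex d) {δ : ℝ} (hδ : 0 ≤ δ) (hxs : δ ≤ ‖x - s‖) :
    kernel b s x ≤ kernel b s s * Real.exp (-(δ ^ 2 / 4) * (1 / b)) := by
  have hs' := openSimplex_subset hs
  rw [kernel_eq hb hs' hx, kernel_eq hb hs' hs', mul_assoc, Real.exp_mul,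
    ← Real.mul_rpow (profile_nonneg s hs') (Real.exp_pos _).le]
  exact mul_le_mul_of_nonneg_left (Real.rpow_le_rpow (profile_nonneg s hx)
    (profile_le_of_dist hs hx hδ hxs) (by positivity)) (kernelConst_pos hb hs').le

/-! ### Height of the peak -/

lemma gamma_add_natCast_add_one {y : ℝ} (hy : 0 < y) (n : ℕ) :
    Real.Gamma (y + n + 1) = (∏ k ∈ Finset.range n, (y + (k + 1))) * Real.Gamma (y + 1) := by
  induction n with
  | zero => simp
  | succ n ih =>
    rw [Real.Gamma_add_one (by positivity), Finset.prod_range_succ, mul_right_comm, ← ih]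
    push_cast
    rw [← add_assoc, mul_comm]

/-- The correction factor in the height of the peak; it tends to `1` as `b → 0`. -/
def peakFactor (d : ℕ) (b : ℝ) : ℝ := ∏ k ∈ Finset.range d, (1 + (k + 1) * b)

/-- Stirling's formula for the height of the peak: the powers `sₒ ^ (sₒ / b)` cancel against the
profile and leave `b^{-d/2} (∏ₒ sₒ)^{-1/2}`. The powers of `2π` are part of the remainders. -/
lemma kernel_self_eq {b : ℝ} (hb : 0 < b) {s : Fin d → ℝ} (hs : s ∈ openSimplex d) :
    kernel b s s = b ^ (-(d : ℝ) / 2) * (∏ o, bary s o) ^ (-(1 / 2) : ℝ) * peakFactor d b *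
      Real.exp (stirlingRemainder (1 / b) - ∑ o, stirlingRemainder (bary s o / b)) := by
  have hs' := openSimplex_subset hs
  have hp : ∀ o, 0 < bary s o := bary_pos hs
  have hP : 0 < ∏ o, bary s o := Finset.prod_pos fun o _ => hp o
  have hb1 : 0 < 1 / b := by positivity
  have hfac : ∏ k ∈ Finset.range d, (1 / b + ((k : ℝ) + 1)) = peakFactor d b * (1 / b) ^ d := by
    have : (1 / b) ^ d = ∏ _k ∈ Finset.range d, (1 / b) := by simp
    rw [peakFactor, this, ← Finset.prod_mul_distrib]
    refine Finset.prod_congr rfl fun k _ => ?_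
    field_simp
  have hden : ∏ o, Real.Gamma (bary s o / b + 1) =
      √(∏ o, bary s o) * √(1 / b) ^ (d + 1) * (profile s s ^ (1 / b) * (1 / b) ^ (1 / b)) *
        Real.exp (-(1 / b)) * Real.exp (∑ o, stirlingRemainder (bary s o / b)) := by
    simp_rw [fun o => gamma_add_one_eq (div_pos (hp o) hb), Finset.prod_mul_distrib,
      ← Real.exp_sum, Finset.sum_neg_distrib, ← Finset.sum_div, sum_bary hs']
    congr 3
    · have : ∀ o, √(bary s o / b) = √(bary s o) * √(1 / b) := fun o => by
        rw [← Real.sqrt_mul (hp o).le, mul_one_div]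
      simp_rw [this, Finset.prod_mul_distrib, Finset.prod_const, Finset.card_univ,
        Fintype.card_option, Fintype.card_fin]
      congr 1
      simp_rw [Real.sqrt_eq_rpow]
      exact Real.finsetProd_rpow _ _ (fun o _ => (hp o).le) _
    · have : ∀ o, (bary s o / b) ^ (bary s o / b) =
          (bary s o ^ bary s o) ^ (1 / b) * (1 / b) ^ (bary s o / b) := fun o => by
        rw [← Real.rpow_mul (hp o).le, mul_one_div, ← Real.mul_rpow (hp o).le hb1.le, mul_one_div]
      simp_rw [this, Finset.prod_mul_distrib, profile]
      rw [Real.finsetProd_rpow _ _ fun o _ => Real.rpow_nonneg (hp o).le _,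
        ← Real.rpow_sum_of_pos hb1, ← Finset.sum_div, sum_bary hs']
  have hsq : √(1 / b) ≠ 0 := (Real.sqrt_pos.2 hb1).ne'
  have hprof : profile s s ^ (1 / b) ≠ 0 := (Real.rpow_pos_of_pos (profile_pos s hs) _).ne'
  have hbb : (1 / b) ^ (1 / b) ≠ 0 := (Real.rpow_pos_of_pos hb1 _).ne'
  have hd2 : b ^ (-(d : ℝ) / 2) = √(1 / b) ^ d := by
    rw [one_div, Real.sqrt_inv, Real.sqrt_eq_rpow, ← Real.rpow_neg hb.le, ← Real.rpow_natCast,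
      ← Real.rpow_mul hb.le]
    congr 1; ring
  have hP2 : (∏ o, bary s o) ^ (-(1 / 2) : ℝ) = (√(∏ o, bary s o))⁻¹ := by
    rw [Real.rpow_neg hP.le, Real.sqrt_eq_rpow]
  have hd3 : (1 / b) ^ d = √(1 / b) ^ d * √(1 / b) ^ d := by
    rw [← mul_pow, Real.mul_self_sqrt hb1.le]
  rw [kernel_eq hb hs' hs', kernelConst, gamma_add_natCast_add_one hb1, hfac, hden,
    gamma_add_one_eq hb1, hd2, hP2, Real.exp_sub, hd3, pow_succ]
  have hPs : √(∏ o, bary s o) ≠ 0 := (Real.sqrt_pos.2 hP).ne'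
  field_simp

lemma tendsto_peakFactor (d : ℕ) : Tendsto (peakFactor d) (𝓝[>] 0) (𝓝 1) := by
  have : Continuous (peakFactor d) := by unfold peakFactor; fun_prop
  have h := this.tendsto 0
  have e : peakFactor d 0 = 1 := by simp [peakFactor]
  rw [e] at h
  exact h.mono_left nhdsWithin_le_nhds

/-- Asymptotic height of the peak. -/
lemma tendsto_kernel_self {s : Fin d → ℝ} (hs : s ∈ openSimplex d) :
    Tendsto (fun b : ℝ => b ^ ((d : ℝ) / 2) * kernel b s s) (𝓝[>] 0)
      (𝓝 (2 ^ ((d : ℝ) / 2) * psi s)) := by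
  have h1 : Tendsto (fun b : ℝ => 1 / b) (𝓝[>] 0) atTop := by
    simpa using tendsto_inv_nhdsGT_zero (𝕜 := ℝ)
  have h2 : ∀ o, Tendsto (fun b : ℝ => bary s o / b) (𝓝[>] 0) atTop := fun o => by
    simpa [div_eq_mul_inv] using (tendsto_inv_nhdsGT_zero (𝕜 := ℝ)).const_mul_atTop (bary_pos hs o)
  have h3 := (tendsto_stirlingRemainder.comp h1).sub
    (tendsto_finsetSum Finset.univ fun o _ => tendsto_stirlingRemainder.comp (h2 o))
  have h4 := ((tendsto_peakFactor d).const_mul ((∏ o, bary s o) ^ (-(1 / 2) : ℝ))).mul h3.rexp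
  have hlim : (∏ o, bary s o) ^ (-(1 / 2) : ℝ) * 1 * Real.exp (Real.log (2 * Real.pi) / 2 -
      ∑ _o : Option (Fin d), Real.log (2 * Real.pi) / 2) = 2 ^ ((d : ℝ) / 2) * psi s := by
    rw [psi_eq (openSimplex_subset hs)]
    simp only [Finset.sum_const, Finset.card_univ, Fintype.card_option, Fintype.card_fin,
      nsmul_eq_mul, Nat.cast_add, Nat.cast_one, mul_one]
    rw [show Real.log (2 * Real.pi) / 2 - (d + 1) * (Real.log (2 * Real.pi) / 2) =
      Real.log (2 * Real.pi) * (-(d : ℝ) / 2) by ring, ← Real.rpow_def_of_pos (by positivity)]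
    have h5 : (4 * Real.pi) ^ (-(d : ℝ) / 2) =
        2 ^ (-(d : ℝ) / 2) * (2 * Real.pi) ^ (-(d : ℝ) / 2) := by
      rw [← Real.mul_rpow zero_le_two (by positivity), ← mul_assoc]; norm_num
    have h6 : (2 : ℝ) ^ ((d : ℝ) / 2) * 2 ^ (-(d : ℝ) / 2) = 1 := by
      rw [← Real.rpow_add two_pos, show (d : ℝ) / 2 + -(d : ℝ) / 2 = 0 by ring, Real.rpow_zero]
    rw [h5]
    linear_combination (-((2 * Real.pi) ^ (-(d : ℝ) / 2) * (∏ o, bary s o) ^ (-(1 / 2) : ℝ))) * h6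
  rw [← hlim]
  refine h4.congr' ?_
  filter_upwards [self_mem_nhdsWithin] with b hb
  have hb : 0 < b := hb
  rw [kernel_self_eq hb hs, ← mul_assoc, ← mul_assoc, ← mul_assoc, ← Real.rpow_add hb]
  simp only [Function.comp_apply]
  rw [show (d : ℝ) / 2 + -(d : ℝ) / 2 = 0 by ring, Real.rpow_zero, one_mul]

/-- Uniform bound on the height of the peak. The arguments `sₒ / b` of the Gamma functions in the
denominator may be arbitrarily small, so that only the lower bound on the Stirling remainder is
available for them; it is the one needed. -/
lemma exists_kernel_self_le (d : ℕ) : ∃ C > 0, ∀ b : ℝ, 0 < b → b ≤ 1 → ∀ s ∈ openSimplex d,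
    kernel b s s ≤ C * b ^ (-(d : ℝ) / 2) * psi s := by
  obtain ⟨M, hM⟩ := exists_stirling_bound
  obtain ⟨m, hm⟩ := exists_stirlingRemainder_ge
  refine ⟨(4 * Real.pi) ^ ((d : ℝ) / 2) * peakFactor d 1 * Real.exp (M + (d + 1) * m),
    ?_, fun b hb hb1 s hs => ?_⟩
  · have : 0 < peakFactor d 1 := Finset.prod_pos fun k _ => by positivity
    positivity
  · have hP : 0 < ∏ o, bary s o := Finset.prod_pos fun o _ => bary_pos hs o
    have e1 : peakFactor d b ≤ peakFactor d 1 :=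
      Finset.prod_le_prod (fun k _ => by positivity) fun k _ => by gcongr
    have e0 : 0 ≤ peakFactor d b := Finset.prod_nonneg fun k _ => by positivity
    have e2 : stirlingRemainder (1 / b) - ∑ o, stirlingRemainder (bary s o / b) ≤
        M + (d + 1) * m := by
      have a1 := (abs_le.1 (hM (1 / b) (by rw [le_div_iff₀ hb]; linarith))).2
      have a2 : ∑ _o : Option (Fin d), (-m) ≤ ∑ o, stirlingRemainder (bary s o / b) :=
        Finset.sum_le_sum fun o _ => hm _ (div_pos (bary_pos hs o) hb)
      simp only [Finset.sum_const, Finset.card_univ, Fintype.card_option, Fintype.card_fin,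
        nsmul_eq_mul, Nat.cast_add, Nat.cast_one] at a2
      linarith
    have e3 : (4 * Real.pi) ^ ((d : ℝ) / 2) * psi s = (∏ o, bary s o) ^ (-(1 / 2) : ℝ) := by
      rw [psi_eq (openSimplex_subset hs), ← mul_assoc, ← Real.rpow_add (by positivity),
        show (d : ℝ) / 2 + -(d : ℝ) / 2 = 0 by ring, Real.rpow_zero, one_mul]
    rw [kernel_self_eq hb hs, ← e3]
    have hpsi := psi_pos hs
    have e4 := e0.trans e1
    calc _ ≤ b ^ (-(d : ℝ) / 2) * ((4 * Real.pi) ^ ((d : ℝ) / 2) * psi s) * peakFactor d 1 *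
        Real.exp (M + (d + 1) * m) := by gcongr
      _ = _ := by ring

/-! ### Bias of the estimator -/

/-- The mean of the kernel `K_s(X)`, that is, of the estimator at `s`. -/
def kernelMean (f : (Fin d → ℝ) → ℝ) (b : ℝ) (s : Fin d → ℝ) : ℝ :=
  ∫ x in simplex d, kernel b s x * f x

/-- The second moment of `K_s(X)`. -/
def kernelSecondMoment (f : (Fin d → ℝ) → ℝ) (b : ℝ) (s : Fin d → ℝ) : ℝ :=
  ∫ x in simplex d, kernel b s x ^ 2 * f x

/-- The standard deviation of `K_s(X)`. -/
def kernelSD (f : (Fin d → ℝ) → ℝ) (b : ℝ) (s : Fin d → ℝ) : ℝ :=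
  √(kernelSecondMoment f b s - kernelMean f b s ^ 2)

lemma continuousOn_kernel {b : ℝ} (hb : 0 < b) {x : Fin d → ℝ} (hx : x ∈ openSimplex d) :
    ContinuousOn (fun s => kernel b s x) (openSimplex d) := by
  have hc : ContinuousOn (fun s => kernelConst b s * profile s x ^ (1 / b)) (openSimplex d) := by
    refine ContinuousOn.mul ?_ (ContinuousOn.rpow_const ?_ fun s hs => Or.inr (by positivity))
    · refine ContinuousOn.div continuousOn_const (continuousOn_finsetProd _ fun o _ => ?_)
        fun s hs => (Finset.prod_pos fun o _ => gamma_bary_pos hb (openSimplex_subset hs) o).ne'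
      refine continuousOn_gamma.comp
        (((continuous_bary o).div_const b).add continuous_const).continuousOn fun s hs => ?_
      have := bary_pos hs o
      show 0 < bary s o / b + 1
      positivity
    · refine continuousOn_finsetProd _ fun o _ => ContinuousOn.rpow continuousOn_const
        (continuous_bary o).continuousOn fun s hs => Or.inl (bary_pos hx o).ne'
  exact hc.congr fun s hs => kernel_eq hb (openSimplex_subset hs) (openSimplex_subset hx)

lemma abs_kernel_le {b C : ℝ} (hb : 0 < b)
    (hC : ∀ s ∈ simplex d, ∀ x ∈ simplex d, kernel b s x ≤ C) {s x : Fin d → ℝ}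
    (hs : s ∈ simplex d) (hx : x ∈ simplex d) : |kernel b s x| ≤ C := by
  rw [abs_of_nonneg (kernel_nonneg hb hs hx)]; exact hC s hs x hx

lemma continuousOn_integral_kernel_pow (hd : 1 ≤ d) {f : (Fin d → ℝ) → ℝ}
    (hf : ContinuousOn f (simplex d)) {b : ℝ} (hb : 0 < b) (k : ℕ) :
    ContinuousOn (fun s => ∫ x in simplex d, kernel b s x ^ k * f x) (openSimplex d) := by
  obtain ⟨C, hC⟩ := kernel_le_const (d := d) hb
  refine continuousOn_of_dominated (bound := fun x => C ^ k * |f x|) (fun s hs => ?_)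
    (fun s hs => ?_) ?_ ?_
  · exact ((measurable_kernel b s).pow_const k).aestronglyMeasurable.mul
      (hf.aestronglyMeasurable measurableSet_simplex)
  · refine (ae_restrict_iff' measurableSet_simplex).2 (Eventually.of_forall fun x hx => ?_)
    rw [norm_mul, norm_pow]
    exact mul_le_mul_of_nonneg_right (pow_le_pow_left₀ (norm_nonneg _)
      (abs_kernel_le hb hC (openSimplex_subset hs) hx) k) (norm_nonneg _)
  · exact (integrableOn_of_continuousOn hf.abs).const_mul _
  · filter_upwards [ae_openSimplex hd] with x hx
    exact ((continuousOn_kernel hb hx).pow k).mul continuousOn_const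

lemma continuousOn_kernelMean (hd : 1 ≤ d) {f : (Fin d → ℝ) → ℝ}
    (hf : ContinuousOn f (simplex d)) {b : ℝ} (hb : 0 < b) :
    ContinuousOn (kernelMean f b) (openSimplex d) := by
  have := continuousOn_integral_kernel_pow hd hf hb 1
  simp only [pow_one] at this
  exact this

lemma continuousOn_kernelSD (hd : 1 ≤ d) {f : (Fin d → ℝ) → ℝ}
    (hf : ContinuousOn f (simplex d)) {b : ℝ} (hb : 0 < b) :
    ContinuousOn (kernelSD f b) (openSimplex d) :=
  ((continuousOn_integral_kernel_pow hd hf hb 2).sub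
    ((continuousOn_kernelMean hd hf hb).pow 2)).sqrt

lemma abs_integral_kernel_mul_le (hd : 1 ≤ d) {b : ℝ} (hb : 0 < b) {s : Fin d → ℝ}
    (hs : s ∈ simplex d) {h h' : (Fin d → ℝ) → ℝ}
    (hc' : ContinuousOn h' (simplex d)) (hle : ∀ x ∈ simplex d, |h x| ≤ h' x) :
    |∫ x in simplex d, kernel b s x * h x| ≤ ∫ x in simplex d, kernel b s x * h' x := by
  rw [← Real.norm_eq_abs]
  refine norm_integral_le_of_norm_le
    (integrableOn_kernel_mul_of_continuousOn hd hb hs hc')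
    ((ae_restrict_iff' measurableSet_simplex).2 (Eventually.of_forall fun x hx => ?_))
  rw [norm_mul, Real.norm_eq_abs, Real.norm_eq_abs, abs_of_nonneg (kernel_nonneg hb hs hx)]
  exact mul_le_mul_of_nonneg_left (hle x hx) (kernel_nonneg hb hs hx)

/-- The mean squared distance of a kernel-distributed point from `s` is of order `b`. -/
lemma exists_integral_kernel_mul_norm_sq_le (hd : 1 ≤ d) : ∃ C, 0 ≤ C ∧ ∀ b : ℝ, 0 < b → b ≤ 1 →
    ∀ s ∈ simplex d, ∫ x in simplex d, kernel b s x * ‖x - s‖ ^ 2 ≤ C * b := by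
  refine ⟨d * (3 + (d + 1) * (d + 2)), by positivity, fun b hb hb1 s hs => ?_⟩
  have h1 : ∫ x in simplex d, kernel b s x * ‖x - s‖ ^ 2 ≤
      ∫ x in simplex d, ∑ i, kernel b s x * ((x i - s i) * (x i - s i)) := by
    refine setIntegral_mono_on (integrableOn_kernel_mul_of_continuousOn hd hb hs (by fun_prop))
      (integrable_finsetSum _ fun i _ =>
        integrableOn_kernel_mul_of_continuousOn hd hb hs (by fun_prop))
      measurableSet_simplex fun x hx => ?_
    rw [← Finset.mul_sum]
    refine mul_le_mul_of_nonneg_left ((norm_sq_le_sum_sq _).trans (le_of_eq ?_))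
      (kernel_nonneg hb hs hx)
    simp only [Pi.sub_apply, sq]
  refine h1.trans ?_
  rw [integral_finsetSum _ fun i _ =>
    integrableOn_kernel_mul_of_continuousOn hd hb hs (by fun_prop)]
  have h2 : ∀ i ∈ Finset.univ, ∫ x in simplex d, kernel b s x * ((x i - s i) * (x i - s i)) ≤
      (3 + (d + 1) * (d + 2)) * b := fun i _ => by
    rw [integral_kernel_mul_sub_mul_sub hd hb hs, if_pos rfl, mul_comm]
    refine mul_le_mul_of_nonneg_right ?_ hb.le
    have hs0 := simplex_nonneg hs i
    have hs1 := simplex_le_one hs i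
    have hss : s i * s i ≤ 1 := mul_le_one₀ hs1 hs0 hs1
    have hd0 : (0 : ℝ) ≤ d := d.cast_nonneg
    have hden : (1 : ℝ) ≤ (1 + (d + 1) * b) * (1 + (d + 2) * b) :=
      one_le_mul_of_one_le_of_one_le (by nlinarith) (by nlinarith)
    rw [div_le_iff₀ (by linarith)]
    have a1 : s i * (1 - s i) ≤ 1 := by nlinarith
    have a2 : b * (1 + 1 - (d + 2) * (s i + s i) + (d + 1) * (d + 2) * (s i * s i)) ≤
        2 + (d + 1) * (d + 2) := by
      have : 1 + 1 - (d + 2) * (s i + s i) + (d + 1) * (d + 2) * (s i * s i) ≤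
          2 + ((d : ℝ) + 1) * (d + 2) := by
        have : ((d : ℝ) + 1) * (d + 2) * (s i * s i) ≤ (d + 1) * (d + 2) * 1 :=
          mul_le_mul_of_nonneg_left hss (by positivity)
        have : 0 ≤ ((d : ℝ) + 2) * (s i + s i) := by positivity
        linarith
      calc _ ≤ b * (2 + ((d : ℝ) + 1) * (d + 2)) := mul_le_mul_of_nonneg_left this hb.le
        _ ≤ 1 * (2 + ((d : ℝ) + 1) * (d + 2)) := mul_le_mul_of_nonneg_right hb1 (by positivity)
        _ = _ := one_mul _
    have a3 : (3 + ((d : ℝ) + 1) * (d + 2)) * 1 ≤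
        (3 + ((d : ℝ) + 1) * (d + 2)) * ((1 + (d + 1) * b) * (1 + (d + 2) * b)) :=
      mul_le_mul_of_nonneg_left hden (by positivity)
    linarith
  refine (Finset.sum_le_sum h2).trans (le_of_eq ?_)
  simp only [Finset.sum_const, Finset.card_univ, Fintype.card_fin, nsmul_eq_mul]
  ring

section Bias

variable {f : (Fin d → ℝ) → ℝ}

lemma kernelMean_sub_eq (hd : 1 ≤ d) (hf : ContinuousOn f (simplex d)) {b : ℝ} (hb : 0 < b)
    {s : Fin d → ℝ} (hs : s ∈ simplex d) :
    kernelMean f b s - f s = ∫ x in simplex d, kernel b s x * (f x - f s) := by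
  simp_rw [mul_sub]
  rw [integral_sub (integrableOn_kernel_mul_of_continuousOn hd hb hs hf)
    ((integrableOn_kernel hd hb hs).mul_const _), integral_mul_const, integral_kernel hd hb hs,
    one_mul, kernelMean]

lemma integral_kernel_mul_linear (hd : 1 ≤ d) {b : ℝ} (hb : 0 < b) {s : Fin d → ℝ}
    (hs : s ∈ simplex d) (L : (Fin d → ℝ) →L[ℝ] ℝ) :
    ∫ x in simplex d, kernel b s x * L (x - s) =
      b * ∑ i, (1 - (d + 1) * s i) / (1 + (d + 1) * b) * L (Pi.single i 1) := by
  have : ∀ x : Fin d → ℝ, kernel b s x * L (x - s) =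
      ∑ i, L (Pi.single i 1) * (kernel b s x * (x i - s i)) := fun x => by
    rw [clm_apply_eq_sum L, Finset.mul_sum]
    exact Finset.sum_congr rfl fun i _ => by simp only [Pi.sub_apply]; ring
  simp_rw [this]
  rw [integral_finsetSum _ fun i _ =>
    (integrableOn_kernel_mul_of_continuousOn hd hb hs (by fun_prop)).const_mul _, Finset.mul_sum]
  refine Finset.sum_congr rfl fun i _ => ?_
  rw [integral_const_mul, integral_kernel_mul_sub hd hb hs]
  ring

lemma integral_kernel_mul_bilinear (hd : 1 ≤ d) {b : ℝ} (hb : 0 < b) {s : Fin d → ℝ}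
    (hs : s ∈ simplex d) (L : (Fin d → ℝ) →L[ℝ] (Fin d → ℝ) →L[ℝ] ℝ) :
    ∫ x in simplex d, kernel b s x * L (x - s) (x - s) =
      b * ∑ i, ∑ j, (s i * ((if i = j then 1 else 0) - s j) + b * (1 + (if i = j then 1 else 0)
          - (d + 2) * (s i + s j) + (d + 1) * (d + 2) * (s i * s j))) /
        ((1 + (d + 1) * b) * (1 + (d + 2) * b)) * L (Pi.single i 1) (Pi.single j 1) := by
  have : ∀ x : Fin d → ℝ, kernel b s x * L (x - s) (x - s) =
      ∑ i, ∑ j, L (Pi.single i 1) (Pi.single j 1) *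
        (kernel b s x * ((x i - s i) * (x j - s j))) := fun x => by
    rw [bilin_apply_eq_sum L, Finset.mul_sum]
    refine Finset.sum_congr rfl fun i _ => ?_
    rw [Finset.mul_sum]
    exact Finset.sum_congr rfl fun j _ => by simp only [Pi.sub_apply]; ring
  simp_rw [this]
  have hint : ∀ i j : Fin d, IntegrableOn (fun x => L (Pi.single i 1) (Pi.single j 1) *
        (kernel b s x * ((x i - s i) * (x j - s j)))) (simplex d) := fun i j =>
    (integrableOn_kernel_mul_of_continuousOn hd hb hs (by fun_prop)).const_mul _
  rw [integral_finsetSum _ fun i _ => integrable_finsetSum _ fun j _ => hint i j, Finset.mul_sum]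
  refine Finset.sum_congr rfl fun i _ => ?_
  rw [integral_finsetSum _ fun j _ => hint i j, Finset.mul_sum]
  refine Finset.sum_congr rfl fun j _ => ?_
  rw [integral_const_mul, integral_kernel_mul_sub_mul_sub hd hb hs]
  ring

variable (hf : ContDiffOn ℝ 2 f (simplex d))

include hf

/-- The bias is `O(b)`, uniformly on the simplex: the linear Taylor term has integral `O(b)` because
the mean of the kernel is within `O(b)` of `s`, and the rest is bounded by the second moment. -/
lemma exists_abs_bias_le (hd : 1 ≤ d) : ∃ C, 0 ≤ C ∧ ∀ b : ℝ, 0 < b → b ≤ 1 →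
    ∀ s ∈ simplex d, |kernelMean f b s - f s| ≤ C * b := by
  obtain ⟨C2, hC2, h2⟩ := exists_integral_kernel_mul_norm_sq_le hd
  obtain ⟨L, hL, hT⟩ := exists_taylor_one_bound hf
  obtain ⟨D, hD⟩ := isCompact_simplex.exists_bound_of_continuousOn
    (E := (Fin d → ℝ) →L[ℝ] ℝ) (contDiffOn_fderivWithin_simplex hf).continuousOn
  have hD0 : 0 ≤ D := by
    obtain ⟨s, hs⟩ := openSimplex_nonempty d
    exact (norm_nonneg _).trans (hD s (openSimplex_subset hs))
  refine ⟨d * ((d + 1) * D) + L * C2, by positivity, fun b hb hb1 s hs => ?_⟩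
  set D1 := fderivWithin ℝ f (simplex d) s with hD1
  have hsplit : kernelMean f b s - f s = (∫ x in simplex d, kernel b s x * D1 (x - s)) +
      ∫ x in simplex d, kernel b s x * (f x - f s - D1 (x - s)) := by
    have hfc := hf.continuousOn
    rw [kernelMean_sub_eq hd hfc hb hs, ← integral_add
      (integrableOn_kernel_mul_of_continuousOn hd hb hs (by fun_prop))
      (integrableOn_kernel_mul_of_continuousOn hd hb hs (by fun_prop))]
    congr 1; ext x; ring
  have e1 : |∫ x in simplex d, kernel b s x * D1 (x - s)| ≤ d * ((d + 1) * D) * b := by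
    rw [integral_kernel_mul_linear hd hb hs, abs_mul, abs_of_pos hb, mul_comm]
    refine mul_le_mul_of_nonneg_right ((Finset.abs_sum_le_sum_abs _ _).trans ?_) hb.le
    have : ∀ i ∈ Finset.univ, |(1 - ((d : ℝ) + 1) * s i) / (1 + (d + 1) * b) * D1 (Pi.single i 1)| ≤
        (d + 1) * D := fun i _ => by
      rw [abs_mul]
      have hs0 := simplex_nonneg hs i
      have hs1 := simplex_le_one hs i
      have hd0 : (0 : ℝ) ≤ d := d.cast_nonneg
      refine mul_le_mul ?_ ?_ (abs_nonneg _) (by positivity)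
      · rw [abs_div, abs_of_pos (show 0 < 1 + ((d : ℝ) + 1) * b by positivity)]
        refine div_le_of_le_mul₀ (by positivity) (by positivity) ?_
        have a1 : |1 - ((d : ℝ) + 1) * s i| ≤ d + 1 := abs_le.2 ⟨by nlinarith, by nlinarith⟩
        have a2 : 0 ≤ ((d : ℝ) + 1) * ((d + 1) * b) := by positivity
        linarith
      · have := (D1.le_opNorm (Pi.single i 1)).trans
          (mul_le_mul_of_nonneg_right (hD s hs) (norm_nonneg _))
        rwa [Pi.norm_single, norm_one, mul_one] at this
    refine (Finset.sum_le_sum this).trans (le_of_eq ?_)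
    simp
  have e2 : |∫ x in simplex d, kernel b s x * (f x - f s - D1 (x - s))| ≤ L * C2 * b := by
    refine (abs_integral_kernel_mul_le hd hb hs (h' := fun x => L * ‖x - s‖ ^ 2)
      (by fun_prop) fun x hx => hT s hs x hx).trans ?_
    have : ∀ x, kernel b s x * (L * ‖x - s‖ ^ 2) = L * (kernel b s x * ‖x - s‖ ^ 2) :=
      fun x => by ring
    simp_rw [this]
    rw [integral_const_mul, mul_assoc]
    exact mul_le_mul_of_nonneg_left (h2 b hb hb1 s hs) hL
  rw [hsplit, add_mul]
  exact (abs_add_le _ _).trans (add_le_add e1 e2)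

omit hf in
/-- Mass at a fixed positive distance from `s` is exponentially small. -/
lemma tendsto_kernel_self_mul_exp_div {s : Fin d → ℝ} (hs : s ∈ openSimplex d) {c : ℝ}
    (hc : 0 < c) :
    Tendsto (fun b : ℝ => kernel b s s * Real.exp (-c * (1 / b)) / b) (𝓝[>] 0) (𝓝 0) := by
  have h1 := tendsto_kernel_self hs
  have h2 : Tendsto (fun b : ℝ => 1 / b) (𝓝[>] 0) atTop := by
    simpa using tendsto_inv_nhdsGT_zero (𝕜 := ℝ)
  have h3 := (tendsto_rpow_mul_exp_neg_mul_atTop_nhds_zero ((d : ℝ) / 2 + 1) c hc).comp h2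
  have h4 := h1.mul h3
  rw [mul_zero] at h4
  refine h4.congr' ?_
  filter_upwards [self_mem_nhdsWithin] with b hb
  have hb : 0 < b := hb
  simp only [Function.comp_apply]
  rw [one_div, Real.rpow_add (inv_pos.2 hb), Real.inv_rpow hb.le, Real.rpow_one]
  have := (Real.rpow_pos_of_pos hb ((d : ℝ) / 2)).ne'
  field_simp

/-- Pointwise first-order expansion of the bias. The linear and quadratic Taylor terms are given by
the moments of the kernel; the remainder is at most `ε ‖x - s‖²` near `s`, and the mass of the kernel
elsewhere is exponentially small. -/
lemma tendsto_bias_div (hd : 1 ≤ d) {s : Fin d → ℝ} (hs : s ∈ openSimplex d) :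
    Tendsto (fun b : ℝ => (kernelMean f b s - f s) / b) (𝓝[>] 0) (𝓝 (biasCoeff f s)) := by
  have hs' := openSimplex_subset hs
  have hfc := hf.continuousOn
  obtain ⟨C2, hC2, h2⟩ := exists_integral_kernel_mul_norm_sq_le hd
  set D1 := fderivWithin ℝ f (simplex d) s with hD1
  set D2 := hessian f s with hD2
  set R : (Fin d → ℝ) → ℝ := fun x => f x - f s - D1 (x - s) - 1 / 2 * D2 (x - s) (x - s) with hR
  have hRc : ContinuousOn R (simplex d) := by
    have : Continuous fun x : Fin d → ℝ => D2 (x - s) (x - s) := by fun_prop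
    fun_prop
  have hsplit : ∀ b : ℝ, 0 < b → (kernelMean f b s - f s) / b =
      (∑ i, (1 - (d + 1) * s i) / (1 + (d + 1) * b) * D1 (Pi.single i 1)) +
      1 / 2 * (∑ i, ∑ j, (s i * ((if i = j then 1 else 0) - s j) +
          b * (1 + (if i = j then 1 else 0)
          - (d + 2) * (s i + s j) + (d + 1) * (d + 2) * (s i * s j))) /
        ((1 + (d + 1) * b) * (1 + (d + 2) * b)) * D2 (Pi.single i 1) (Pi.single j 1)) +
      (∫ x in simplex d, kernel b s x * R x) / b := fun b hb => by
    have hi1 : IntegrableOn (fun x => kernel b s x * D1 (x - s)) (simplex d) :=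
      integrableOn_kernel_mul_of_continuousOn hd hb hs' (by fun_prop)
    have hi2 : IntegrableOn (fun x => 1 / 2 * (kernel b s x * D2 (x - s) (x - s))) (simplex d) :=
      (integrableOn_kernel_mul_of_continuousOn hd hb hs' (by fun_prop)).const_mul _
    have hi3 : IntegrableOn (fun x => kernel b s x * R x) (simplex d) :=
      integrableOn_kernel_mul_of_continuousOn hd hb hs' hRc
    have hi12 : IntegrableOn (fun x => kernel b s x * D1 (x - s) +
      1 / 2 * (kernel b s x * D2 (x - s) (x - s))) (simplex d) := hi1.add hi2
    have : kernelMean f b s - f s = (∫ x in simplex d, kernel b s x * D1 (x - s)) +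
        1 / 2 * (∫ x in simplex d, kernel b s x * D2 (x - s) (x - s)) +
        ∫ x in simplex d, kernel b s x * R x := by
      rw [kernelMean_sub_eq hd hfc hb hs', ← integral_const_mul, ← integral_add hi1 hi2,
        ← integral_add hi12 hi3]
      congr 1; ext x; simp only [hR]; ring
    rw [this, integral_kernel_mul_linear hd hb hs', integral_kernel_mul_bilinear hd hb hs']
    have aux : ∀ u v w : ℝ, (b * u + 1 / 2 * (b * v) + w) / b = u + 1 / 2 * v + w / b :=
      fun u v w => by field_simp
    exact aux _ _ _
  have hd0 : (0 : ℝ) ≤ d := d.cast_nonneg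
  have t1 : Tendsto (fun b : ℝ =>
      ∑ i, (1 - ((d : ℝ) + 1) * s i) / (1 + (d + 1) * b) * D1 (Pi.single i 1)) (𝓝[>] 0)
      (𝓝 (∑ i, (1 - ((d : ℝ) + 1) * s i) * D1 (Pi.single i 1))) := by
    have hca : ContinuousAt (fun b : ℝ =>
      ∑ i, (1 - ((d : ℝ) + 1) * s i) / (1 + (d + 1) * b) * D1 (Pi.single i 1)) 0 := by
      refine tendsto_finsetSum _ fun i _ => ContinuousAt.mul (ContinuousAt.div (by fun_prop)
        (by fun_prop) (by simp)) (by fun_prop)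
    have := hca.tendsto
    simp only [mul_zero, add_zero, div_one] at this
    exact this.mono_left nhdsWithin_le_nhds
  have t2 : Tendsto (fun b : ℝ =>
      ∑ i, ∑ j, (s i * ((if i = j then 1 else 0) - s j) +
          b * (1 + (if i = j then 1 else 0)
          - (d + 2) * (s i + s j) + (d + 1) * (d + 2) * (s i * s j))) /
        ((1 + (d + 1) * b) * (1 + (d + 2) * b)) * D2 (Pi.single i 1) (Pi.single j 1)) (𝓝[>] 0)
      (𝓝 (∑ i, ∑ j, (s i * ((if i = j then 1 else 0) - s j)) *
        D2 (Pi.single i 1) (Pi.single j 1))) := by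
    have hca : ContinuousAt (fun b : ℝ =>
      ∑ i, ∑ j, (s i * ((if i = j then 1 else 0) - s j) +
          b * (1 + (if i = j then 1 else 0)
          - (d + 2) * (s i + s j) + (d + 1) * (d + 2) * (s i * s j))) /
        ((1 + (d + 1) * b) * (1 + (d + 2) * b)) * D2 (Pi.single i 1) (Pi.single j 1)) 0 := by
      refine tendsto_finsetSum _ fun i _ => tendsto_finsetSum _ fun j _ =>
        ContinuousAt.mul (ContinuousAt.div (by fun_prop) (by fun_prop) (by simp)) (by fun_prop)
    have := hca.tendsto
    simp only [mul_zero, zero_mul, add_zero, mul_one, div_one] at this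
    exact this.mono_left nhdsWithin_le_nhds
  have t3 : Tendsto (fun b : ℝ => (∫ x in simplex d, kernel b s x * R x) / b) (𝓝[>] 0)
      (𝓝 0) := by
    obtain ⟨CR, hCR⟩ := isCompact_simplex.exists_bound_of_continuousOn hRc
    have hCR0 : 0 ≤ CR := (norm_nonneg _).trans (hCR s hs')
    rw [Metric.tendsto_nhds]
    intro ε hε
    have hε' : 0 < ε / (2 * (C2 + 1)) := by positivity
    obtain ⟨δ, hδ, hT⟩ := exists_taylor_two_bound hf hε'
    have hexp := (tendsto_kernel_self_mul_exp_div hs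
      (show 0 < δ ^ 2 / 4 by positivity)).const_mul (CR * volume.real (simplex d))
    rw [mul_zero] at hexp
    filter_upwards [self_mem_nhdsWithin, hexp.eventually (gt_mem_nhds (half_pos hε)),
      Ioc_mem_nhdsGT (show (0 : ℝ) < 1 by norm_num)] with b hb hsmall hb1
    have hb : 0 < b := hb
    have hbound : ∀ x ∈ simplex d, ‖kernel b s x * R x‖ ≤ ε / (2 * (C2 + 1)) *
        (kernel b s x * ‖x - s‖ ^ 2) + CR * (kernel b s s * Real.exp (-(δ ^ 2 / 4) * (1 / b))) := by
      intro x hx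
      have hK := kernel_nonneg hb hs' hx
      have hKs := (kernel_self_pos hb hs).le
      rw [norm_mul, Real.norm_eq_abs, abs_of_nonneg hK]
      rcases lt_or_ge ‖x - s‖ δ with h | h
      · have := mul_le_mul_of_nonneg_left (hT s hs' x hx h) hK
        have h0 : 0 ≤ CR * (kernel b s s * Real.exp (-(δ ^ 2 / 4) * (1 / b))) := by positivity
        rw [Real.norm_eq_abs]
        linarith
      · have h1 := mul_le_mul (kernel_le_of_dist hb hs hx hδ.le h) (hCR x hx) (norm_nonneg _)
          (mul_nonneg hKs (Real.exp_pos _).le)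
        have h0 : 0 ≤ ε / (2 * (C2 + 1)) * (kernel b s x * ‖x - s‖ ^ 2) := by positivity
        linarith
    have hi1 : IntegrableOn (fun x => ε / (2 * (C2 + 1)) * (kernel b s x * ‖x - s‖ ^ 2))
        (simplex d) :=
      (integrableOn_kernel_mul_of_continuousOn hd hb hs' (by fun_prop)).const_mul _
    have hi2 : IntegrableOn (fun _ : Fin d → ℝ =>
        CR * (kernel b s s * Real.exp (-(δ ^ 2 / 4) * (1 / b)))) (simplex d) :=
      integrable_const _
    have h3 : ‖∫ x in simplex d, kernel b s x * R x‖ ≤ ε / (2 * (C2 + 1)) * (C2 * b) +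
        CR * volume.real (simplex d) * (kernel b s s * Real.exp (-(δ ^ 2 / 4) * (1 / b))) := by
      refine (norm_integral_le_of_norm_le (hi1.add hi2)
        ((ae_restrict_iff' measurableSet_simplex).2 (Eventually.of_forall hbound))).trans ?_
      simp only [Pi.add_apply]
      rw [integral_add hi1 hi2, integral_const_mul, setIntegral_const, smul_eq_mul]
      refine add_le_add (mul_le_mul_of_nonneg_left (h2 b hb hb1.2 s hs') hε'.le)
        (le_of_eq (by ring))
    rw [dist_zero_right, norm_div, Real.norm_eq_abs b, abs_of_pos hb, div_lt_iff₀ hb]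
    have h4 : ε / (2 * (C2 + 1)) * (C2 * b) ≤ ε / 2 * b := by
      rw [← mul_assoc]
      refine mul_le_mul_of_nonneg_right ?_ hb.le
      rw [div_mul_eq_mul_div, div_le_div_iff₀ (by positivity) two_pos]
      nlinarith
    rw [← mul_div_assoc, div_lt_iff₀ hb] at hsmall
    linarith
  have hg : biasCoeff f s = ∑ i, (1 - ((d : ℝ) + 1) * s i) * D1 (Pi.single i 1) +
      1 / 2 * ∑ i, ∑ j, (s i * ((if i = j then 1 else 0) - s j)) *
        D2 (Pi.single i 1) (Pi.single j 1) + 0 := by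
    rw [add_zero, biasCoeff]
    simp_rw [pderiv_pderiv_eq_hessian hf hs']
    rfl
  rw [hg]
  refine ((t1.add (t2.const_mul (1 / 2))).add t3).congr' ?_
  filter_upwards [self_mem_nhdsWithin] with b hb
  exact (hsplit b hb).symm

/-- The bias is `b g(s) + o(b)` in `L¹`. -/
lemma tendsto_integral_abs_bias_sub (hd : 1 ≤ d) :
    Tendsto (fun b : ℝ => ∫ s in simplex d, |(kernelMean f b s - f s) / b - biasCoeff f s|)
      (𝓝[>] 0) (𝓝 0) := by
  obtain ⟨C, hC0, hC⟩ := exists_abs_bias_le hf hd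
  obtain ⟨G, hG⟩ := isCompact_simplex.exists_bound_of_continuousOn (continuousOn_biasCoeff hf)
  have h := tendsto_integral_filter_of_dominated_convergence
    (μ := volume.restrict (simplex d)) (l := 𝓝[>] (0 : ℝ))
    (F := fun b s => |(kernelMean f b s - f s) / b - biasCoeff f s|) (f := fun _ => 0)
    (fun _ => C + G) ?_ ?_ (integrable_const _) ?_
  · simpa using h
  · filter_upwards [self_mem_nhdsWithin] with b hb
    refine aestronglyMeasurable_of_continuousOn_openSimplex hd (ContinuousOn.abs
      (((ContinuousOn.sub (continuousOn_kernelMean hd hf.continuousOn hb)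
        (hf.continuousOn.mono openSimplex_subset)).div_const b).sub
        ((continuousOn_biasCoeff hf).mono openSimplex_subset)))
  · filter_upwards [self_mem_nhdsWithin, Ioc_mem_nhdsGT (show (0 : ℝ) < 1 by norm_num)]
      with b hb hb1
    have hb : 0 < b := hb
    refine (ae_restrict_iff' measurableSet_simplex).2 (Eventually.of_forall fun s hs => ?_)
    rw [Real.norm_eq_abs, abs_abs]
    refine (abs_sub _ _).trans (add_le_add ?_ (hG s hs))
    rw [abs_div, abs_of_pos hb, div_le_iff₀ hb]
    exact hC b hb hb1.2 s hs
  · filter_upwards [ae_openSimplex hd] with s hs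
    have := ((tendsto_bias_div hf hd hs).sub_const (biasCoeff f s)).abs
    simpa using this

end Bias

/-! ### Standard deviation of the estimator -/

section Variance

variable {f : (Fin d → ℝ) → ℝ}

/-- The second moment is a mean at half the bandwidth, times a ratio of peak heights. -/
lemma kernelSecondMoment_eq {b : ℝ} (hb : 0 < b) {s : Fin d → ℝ} (hs : s ∈ openSimplex d) :
    kernelSecondMoment f b s = kernel b s s ^ 2 / kernel (b / 2) s s * kernelMean f (b / 2) s := by
  rw [kernelSecondMoment, kernelMean, ← integral_const_mul]
  refine setIntegral_congr_fun measurableSet_simplex fun x hx => ?_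
  simp only [kernel_sq hb hs hx]
  ring

lemma tendsto_half_nhdsGT : Tendsto (fun b : ℝ => b / 2) (𝓝[>] 0) (𝓝[>] 0) := by
  refine tendsto_nhdsWithin_iff.2 ⟨?_, ?_⟩
  · have : Tendsto (fun b : ℝ => b / 2) (𝓝 0) (𝓝 (0 / 2)) := tendsto_id.div_const 2
    rw [zero_div] at this
    exact this.mono_left nhdsWithin_le_nhds
  · filter_upwards [self_mem_nhdsWithin] with b hb
    have hb : 0 < b := hb
    exact half_pos hb

lemma tendsto_kernelMean (hf : ContDiffOn ℝ 2 f (simplex d)) (hd : 1 ≤ d) {s : Fin d → ℝ}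
    (hs : s ∈ simplex d) : Tendsto (fun b : ℝ => kernelMean f b s) (𝓝[>] 0) (𝓝 (f s)) := by
  obtain ⟨C, hC0, hC⟩ := exists_abs_bias_le hf hd
  have h1 : Tendsto (fun b : ℝ => kernelMean f b s - f s) (𝓝[>] 0) (𝓝 0) := by
    have h0 : Tendsto (fun b : ℝ => C * b) (𝓝[>] 0) (𝓝 0) := by
      have : Tendsto (fun b : ℝ => C * b) (𝓝 0) (𝓝 (C * 0)) := tendsto_id.const_mul C
      rw [mul_zero] at this
      exact this.mono_left nhdsWithin_le_nhds
    refine squeeze_zero_norm' ?_ h0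
    filter_upwards [Ioc_mem_nhdsGT (show (0 : ℝ) < 1 by norm_num)] with b hb
    exact hC b hb.1 hb.2 s hs
  simpa using h1.add_const (f s)

/-- Asymptotic second moment of the kernel: the factor `2^{d/2}` in the asymptotic height of the peak
cancels against the halving of the bandwidth. -/
lemma tendsto_kernelSecondMoment (hf : ContDiffOn ℝ 2 f (simplex d)) (hd : 1 ≤ d)
    {s : Fin d → ℝ} (hs : s ∈ openSimplex d) :
    Tendsto (fun b : ℝ => b ^ ((d : ℝ) / 2) * kernelSecondMoment f b s) (𝓝[>] 0)
      (𝓝 (psi s * f s)) := by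
  have h1 := tendsto_kernel_self hs
  have h2 := h1.comp tendsto_half_nhdsGT
  have h3 := (tendsto_kernelMean hf hd (openSimplex_subset hs)).comp tendsto_half_nhdsGT
  have hpsi := psi_pos hs
  have h2d : (0 : ℝ) < 2 ^ ((d : ℝ) / 2) := by positivity
  have h4 := (((h1.pow 2).div h2 (by positivity)).mul h3).const_mul ((2 : ℝ) ^ ((d : ℝ) / 2))⁻¹
  have hlim : ((2 : ℝ) ^ ((d : ℝ) / 2))⁻¹ * ((2 ^ ((d : ℝ) / 2) * psi s) ^ 2 /
      (2 ^ ((d : ℝ) / 2) * psi s) * f s) = psi s * f s := by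
    field_simp
  rw [hlim] at h4
  refine h4.congr' ?_
  filter_upwards [self_mem_nhdsWithin] with b hb
  have hb : 0 < b := hb
  simp only [Function.comp_apply, Pi.div_apply]
  rw [kernelSecondMoment_eq hb hs, Real.div_rpow hb.le zero_le_two]
  have := (kernel_self_pos (half_pos hb) hs).ne'
  have := (Real.rpow_pos_of_pos hb ((d : ℝ) / 2)).ne'
  field_simp

/-- The squared mean is bounded, so it does not contribute to the variance in the limit. -/
lemma tendsto_kernelSD (hf : ContDiffOn ℝ 2 f (simplex d)) (hd : 1 ≤ d)
    {s : Fin d → ℝ} (hs : s ∈ openSimplex d) :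
    Tendsto (fun b : ℝ => b ^ ((d : ℝ) / 4) * kernelSD f b s) (𝓝[>] 0)
      (𝓝 (√(psi s * f s))) := by
  have hd0 : (0 : ℝ) < d := by exact_mod_cast hd
  have h1 : Tendsto (fun b : ℝ => b ^ ((d : ℝ) / 2)) (𝓝[>] 0) (𝓝 0) := by
    have : Tendsto (fun b : ℝ => b ^ ((d : ℝ) / 2)) (𝓝 0) (𝓝 (0 ^ ((d : ℝ) / 2))) :=
      (Real.continuousAt_rpow_const 0 _ (Or.inr (by positivity))).tendsto
    rw [Real.zero_rpow (by positivity)] at this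
    exact this.mono_left nhdsWithin_le_nhds
  have h2 := h1.mul ((tendsto_kernelMean hf hd (openSimplex_subset hs)).pow 2)
  have h3 := ((tendsto_kernelSecondMoment hf hd hs).sub h2).sqrt
  rw [zero_mul, sub_zero] at h3
  refine h3.congr' ?_
  filter_upwards [self_mem_nhdsWithin] with b hb
  have hb : 0 < b := hb
  rw [← mul_sub, Real.sqrt_mul (by positivity), kernelSD, Real.sqrt_eq_rpow,
    ← Real.rpow_mul hb.le]
  congr 2
  ring

lemma kernelMean_le (hd : 1 ≤ d) {F : ℝ} (hf : ContinuousOn f (simplex d))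
    (hF : ∀ x ∈ simplex d, f x ≤ F) {b : ℝ} (hb : 0 < b) {s : Fin d → ℝ} (hs : s ∈ simplex d) :
    kernelMean f b s ≤ F := by
  have h : kernelMean f b s ≤ ∫ x in simplex d, kernel b s x * F :=
    setIntegral_mono_on (integrableOn_kernel_mul_of_continuousOn hd hb hs hf)
      ((integrableOn_kernel hd hb hs).mul_const F) measurableSet_simplex
      fun x hx => mul_le_mul_of_nonneg_left (hF x hx) (kernel_nonneg hb hs hx)
  rwa [integral_mul_const, integral_kernel hd hb hs, one_mul] at h

lemma integrableOn_kernel_sq_mul (hd : 1 ≤ d) (hf : ContinuousOn f (simplex d)) {b : ℝ}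
    (hb : 0 < b) {s : Fin d → ℝ} (hs : s ∈ simplex d) :
    IntegrableOn (fun x => kernel b s x ^ 2 * f x) (simplex d) := by
  obtain ⟨C, hC⟩ := kernel_le_const (d := d) hb
  have := (integrableOn_kernel_mul_of_continuousOn hd hb hs hf).bdd_mul (c := C)
    (measurable_kernel b s).aestronglyMeasurable ((ae_restrict_iff' measurableSet_simplex).2
      (Eventually.of_forall fun x hx => abs_kernel_le hb hC hs hx))
  refine this.congr (Eventually.of_forall fun x => ?_)
  simp only []
  ring

lemma kernelSecondMoment_le (hd : 1 ≤ d) {F : ℝ} (hf : ContinuousOn f (simplex d))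
    (hf0 : ∀ x ∈ simplex d, 0 ≤ f x) (hF : ∀ x ∈ simplex d, f x ≤ F) {b : ℝ} (hb : 0 < b)
    {s : Fin d → ℝ} (hs : s ∈ openSimplex d) :
    kernelSecondMoment f b s ≤ kernel b s s * F := by
  have hs' := openSimplex_subset hs
  have h : kernelSecondMoment f b s ≤ ∫ x in simplex d, kernel b s s * (kernel b s x * f x) := by
    refine setIntegral_mono_on (integrableOn_kernel_sq_mul hd hf hb hs')
      ((integrableOn_kernel_mul_of_continuousOn hd hb hs' hf).const_mul _) measurableSet_simplex
      fun x hx => ?_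
    rw [sq, mul_assoc]
    exact mul_le_mul_of_nonneg_right (kernel_le_self hb hs hx)
      (mul_nonneg (kernel_nonneg hb hs' hx) (hf0 x hx))
  rw [integral_const_mul] at h
  exact h.trans (mul_le_mul_of_nonneg_left (kernelMean_le hd hf hF hb hs')
    (kernel_self_pos hb hs).le)

/-- A domination of the rescaled standard deviation by a multiple of `√ψ`. -/
lemma exists_kernelSD_le (hd : 1 ≤ d) (hf : ContinuousOn f (simplex d))
    (hf0 : ∀ x ∈ simplex d, 0 ≤ f x) : ∃ C, 0 ≤ C ∧ ∀ b : ℝ, 0 < b → b ≤ 1 →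
    ∀ s ∈ openSimplex d, b ^ ((d : ℝ) / 4) * kernelSD f b s ≤ C * √(psi s) := by
  obtain ⟨F, hF⟩ := isCompact_simplex.exists_bound_of_continuousOn hf
  obtain ⟨C, hC, hK⟩ := exists_kernel_self_le d
  have hF0 : 0 ≤ F := by
    obtain ⟨s, hs⟩ := openSimplex_nonempty d
    exact (norm_nonneg _).trans (hF s (openSimplex_subset hs))
  refine ⟨√(C * F), Real.sqrt_nonneg _, fun b hb hb1 s hs => ?_⟩
  have hpsi := psi_pos hs
  have h1 : kernelSecondMoment f b s - kernelMean f b s ^ 2 ≤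
      C * b ^ (-(d : ℝ) / 2) * psi s * F := by
    have h2 := kernelSecondMoment_le hd hf hf0 (fun x hx => (le_abs_self _).trans (hF x hx)) hb hs
    have h3 := mul_le_mul_of_nonneg_right (hK b hb hb1 s hs) hF0
    have := sq_nonneg (kernelMean f b s)
    linarith
  have h4 : b ^ ((d : ℝ) / 4) = √(b ^ ((d : ℝ) / 2)) := by
    rw [Real.sqrt_eq_rpow, ← Real.rpow_mul hb.le]; congr 1; ring
  rw [h4, kernelSD, ← Real.sqrt_mul (by positivity), ← Real.sqrt_mul (by positivity)]
  refine Real.sqrt_le_sqrt ((mul_le_mul_of_nonneg_left h1 (by positivity)).trans (le_of_eq ?_))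
  have h5 : b ^ ((d : ℝ) / 2) * b ^ (-(d : ℝ) / 2) = 1 := by
    rw [← Real.rpow_add hb, show (d : ℝ) / 2 + -(d : ℝ) / 2 = 0 by ring, Real.rpow_zero]
  linear_combination (C * psi s * F) * h5

lemma integrableOn_sqrt_psi (hd : 1 ≤ d) :
    IntegrableOn (fun s : Fin d → ℝ => √(psi s)) (simplex d) := by
  refine Integrable.mono' ((integrable_const (1 : ℝ)).add (integrableOn_psi hd))
    (aestronglyMeasurable_of_continuousOn_openSimplex hd continuousOn_psi.sqrt)
    ((ae_restrict_iff' measurableSet_simplex).2 (Eventually.of_forall fun s hs => ?_))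
  have h := psi_nonneg hs
  rw [Real.norm_eq_abs, abs_of_nonneg (Real.sqrt_nonneg _)]
  simp only [Pi.add_apply]
  nlinarith [Real.sq_sqrt h, Real.sqrt_nonneg (psi s), sq_nonneg (√(psi s) - 1)]

lemma integrableOn_sqrt_psi_mul (hd : 1 ≤ d) (hf : ContinuousOn f (simplex d)) :
    IntegrableOn (fun s => √(psi s * f s)) (simplex d) := by
  obtain ⟨F, hF⟩ := isCompact_simplex.exists_bound_of_continuousOn hf
  refine Integrable.mono' ((integrableOn_sqrt_psi hd).const_mul (√F))
    (aestronglyMeasurable_of_continuousOn_openSimplex hd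
      (continuousOn_psi.mul (hf.mono openSimplex_subset)).sqrt)
    ((ae_restrict_iff' measurableSet_simplex).2 (Eventually.of_forall fun s hs => ?_))
  rw [Real.norm_eq_abs, abs_of_nonneg (Real.sqrt_nonneg _), Real.sqrt_mul (psi_nonneg hs),
    mul_comm]
  exact mul_le_mul_of_nonneg_right (Real.sqrt_le_sqrt ((le_abs_self _).trans (hF s hs)))
    (Real.sqrt_nonneg _)

/-- `L¹` convergence of the rescaled standard deviation. -/
lemma tendsto_integral_abs_kernelSD_sub (hf : ContDiffOn ℝ 2 f (simplex d))
    (hf0 : ∀ x ∈ simplex d, 0 ≤ f x) (hd : 1 ≤ d) :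
    Tendsto (fun b : ℝ => ∫ s in simplex d,
      |b ^ ((d : ℝ) / 4) * kernelSD f b s - √(psi s * f s)|) (𝓝[>] 0) (𝓝 0) := by
  have hfc := hf.continuousOn
  obtain ⟨C, hC0, hC⟩ := exists_kernelSD_le hd hfc hf0
  have h := tendsto_integral_filter_of_dominated_convergence
    (μ := volume.restrict (simplex d)) (l := 𝓝[>] (0 : ℝ))
    (F := fun b s => |b ^ ((d : ℝ) / 4) * kernelSD f b s - √(psi s * f s)|) (f := fun _ => 0)
    (fun s => C * √(psi s) + √(psi s * f s)) ?_ ?_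
    (((integrableOn_sqrt_psi hd).const_mul C).add (integrableOn_sqrt_psi_mul hd hfc)) ?_
  · simpa using h
  · filter_upwards [self_mem_nhdsWithin] with b hb
    exact aestronglyMeasurable_of_continuousOn_openSimplex hd (ContinuousOn.abs
      ((continuousOn_const.mul (continuousOn_kernelSD hd hfc hb)).sub
        (continuousOn_psi.mul (hfc.mono openSimplex_subset)).sqrt))
  · filter_upwards [self_mem_nhdsWithin, Ioc_mem_nhdsGT (show (0 : ℝ) < 1 by norm_num)]
      with b hb hb1
    have hb : 0 < b := hb
    filter_upwards [ae_openSimplex hd] with s hs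
    rw [Real.norm_eq_abs, abs_abs]
    refine (abs_sub _ _).trans (add_le_add ?_ ?_)
    · have h0 : 0 ≤ kernelSD f b s := Real.sqrt_nonneg _
      rw [abs_of_nonneg (by positivity)]
      exact hC b hb hb1.2 s hs
    · rw [abs_of_nonneg (Real.sqrt_nonneg _)]
  · filter_upwards [ae_openSimplex hd] with s hs
    have := ((tendsto_kernelSD hf hd hs).sub_const (√(psi s * f s))).abs
    simpa using this

end Variance

/-! ### The first absolute moment in terms of the characteristic function -/

/-- The integral `∫₀^∞ (1 - cos t) / t² dt`. -/
def cosIntegral : ℝ := ∫ t in Set.Ioi (0 : ℝ), (1 - Real.cos t) / t ^ 2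

lemma integrableOn_two_div_sq {T : ℝ} (hT : 0 < T) :
    IntegrableOn (fun t : ℝ => 2 / t ^ 2) (Set.Ioi T) := by
  have h : IntegrableOn (fun t : ℝ => 2 * t ^ (-2 : ℝ)) (Set.Ioi T) :=
    (integrableOn_Ioi_rpow_of_lt (show (-2 : ℝ) < -1 by norm_num) hT).const_mul 2
  refine IntegrableOn.congr_fun h (fun t ht => ?_) measurableSet_Ioi
  have ht : 0 < t := hT.trans ht
  simp only [div_eq_mul_inv]
  rw [Real.rpow_neg ht.le]
  norm_num

lemma integral_two_div_sq {T : ℝ} (hT : 0 < T) :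
    ∫ t in Set.Ioi T, 2 / t ^ 2 = 2 / T := by
  have h := integral_Ioi_rpow_of_lt (show (-2 : ℝ) < -1 by norm_num) hT
  have h2 : ∫ t in Set.Ioi T, 2 / t ^ 2 = ∫ t in Set.Ioi T, 2 * t ^ (-2 : ℝ) := by
    refine setIntegral_congr_fun measurableSet_Ioi fun t ht => ?_
    have ht : 0 < t := hT.trans ht
    simp only [div_eq_mul_inv]
    rw [Real.rpow_neg ht.le]
    norm_num
  rw [h2, integral_const_mul, h]
  rw [show (-2 : ℝ) + 1 = -1 by norm_num, Real.rpow_neg_one]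
  field_simp

lemma one_sub_cos_div_sq_nonneg (t x : ℝ) : 0 ≤ (1 - Real.cos (t * x)) / t ^ 2 :=
  div_nonneg (by linarith [Real.cos_le_one (t * x)]) (sq_nonneg t)

lemma integrableOn_one_sub_cos_div_sq :
    IntegrableOn (fun t : ℝ => (1 - Real.cos t) / t ^ 2) (Set.Ioi 0) := by
  have hm : Measurable fun t : ℝ => (1 - Real.cos t) / t ^ 2 := by fun_prop
  have h0 : ∀ t : ℝ, 0 ≤ (1 - Real.cos t) / t ^ 2 := fun t => by
    simpa using div_nonneg (by linarith [Real.cos_le_one t]) (sq_nonneg t)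
  rw [← Set.Ioc_union_Ioi_eq_Ioi zero_le_one]
  refine IntegrableOn.union ?_ ?_
  · refine Measure.integrableOn_of_bounded (M := 1 / 2) (by simp) hm.aestronglyMeasurable ?_
    refine Eventually.of_forall fun t => ?_
    rw [Real.norm_eq_abs, abs_of_nonneg (h0 t)]
    refine div_le_of_le_mul₀ (sq_nonneg t) (by norm_num) ?_
    linarith [Real.one_sub_sq_div_two_le_cos (x := t)]
  · refine Integrable.mono' (integrableOn_two_div_sq one_pos) hm.aestronglyMeasurable ?_
    refine Eventually.of_forall fun t => ?_
    rw [Real.norm_eq_abs, abs_of_nonneg (h0 t)]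
    exact div_le_div_of_nonneg_right (by linarith [Real.neg_one_le_cos t]) (sq_nonneg t)

lemma cosIntegral_pos : 0 < cosIntegral := by
  have h0 : 0 ≤ᵐ[volume.restrict (Set.Ioi (0 : ℝ))] fun t : ℝ => (1 - Real.cos t) / t ^ 2 :=
    Eventually.of_forall fun t => by
      simpa using div_nonneg (by linarith [Real.cos_le_one t]) (sq_nonneg t)
  rw [cosIntegral, setIntegral_pos_iff_support_of_nonneg_ae h0 integrableOn_one_sub_cos_div_sq]
  refine lt_of_lt_of_le (show (0 : ENNReal) < volume (Set.Ioo (0 : ℝ) 1) by simp)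
    (measure_mono fun t ht => ⟨?_, ht.1⟩)
  have : Real.cos t < Real.cos 0 :=
    Real.cos_lt_cos_of_nonneg_of_le_pi le_rfl (by linarith [ht.2, Real.pi_gt_three]) ht.1
  rw [Real.cos_zero] at this
  have ht0 := ht.1
  exact (div_pos (by linarith) (by positivity)).ne'

lemma one_sub_cos_mul_div_sq (x t : ℝ) (hx : 0 < |x|) :
    (1 - Real.cos (t * x)) / t ^ 2 = x ^ 2 * ((1 - Real.cos (|x| * t)) / (|x| * t) ^ 2) := by
  have h : Real.cos (|x| * t) = Real.cos (t * x) := by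
    rw [mul_comm, ← Real.cos_abs (t * x), abs_mul, ← Real.cos_abs (t * |x|), abs_mul, abs_abs]
  rw [h, mul_pow, sq_abs]
  have := (abs_pos.1 hx)
  field_simp

lemma integrableOn_one_sub_cos_mul_div_sq (x : ℝ) :
    IntegrableOn (fun t : ℝ => (1 - Real.cos (t * x)) / t ^ 2) (Set.Ioi 0) := by
  rcases eq_or_ne x 0 with rfl | hx
  · simp
  have hx' := abs_pos.2 hx
  have h0 := (integrableOn_Ioi_comp_mul_left_iff
    (fun t : ℝ => (1 - Real.cos t) / t ^ 2) 0 hx').2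
      (by rw [mul_zero]; exact integrableOn_one_sub_cos_div_sq)
  have h := Integrable.const_mul h0 (x ^ 2)
  exact IntegrableOn.congr_fun h (fun t _ => (one_sub_cos_mul_div_sq x t hx').symm)
    measurableSet_Ioi

/-- The absolute value as a superposition of cosines. -/
lemma integral_one_sub_cos_mul_div_sq (x : ℝ) :
    ∫ t in Set.Ioi (0 : ℝ), (1 - Real.cos (t * x)) / t ^ 2 = cosIntegral * |x| := by
  rcases eq_or_ne x 0 with rfl | hx
  · simp
  have hx' := abs_pos.2 hx
  rw [setIntegral_congr_fun measurableSet_Ioi fun t _ => one_sub_cos_mul_div_sq x t hx',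
    integral_const_mul, integral_comp_mul_left_Ioi (fun t : ℝ => (1 - Real.cos t) / t ^ 2) 0 hx',
    mul_zero, smul_eq_mul, cosIntegral, ← sq_abs x]
  field_simp

lemma re_charFun_eq (P : Measure ℝ) [IsProbabilityMeasure P] (t : ℝ) :
    (charFun P t).re = ∫ x, Real.cos (t * x) ∂P := by
  have hm : Measurable fun x : ℝ => Complex.exp (t * x * Complex.I) := by fun_prop
  have hi : Integrable (fun x : ℝ => Complex.exp (t * x * Complex.I)) P := by
    refine Integrable.of_bound hm.aestronglyMeasurable 1 (Eventually.of_forall fun x => ?_)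
    rw [← Complex.ofReal_mul, Complex.norm_exp_ofReal_mul_I]
  rw [charFun_apply_real]
  have := integral_re hi
  simp only [RCLike.re_to_complex] at this
  rw [← this]
  congr 1; ext x
  rw [← Complex.ofReal_mul, Complex.exp_ofReal_mul_I_re]

lemma integrable_one_sub_cos_prod {P : Measure ℝ} [IsProbabilityMeasure P]
    (hP : Integrable (fun x : ℝ => |x|) P) :
    Integrable (Function.uncurry fun (x t : ℝ) => (1 - Real.cos (t * x)) / t ^ 2)
      (P.prod (volume.restrict (Set.Ioi 0))) := by
  have hm : Measurable (Function.uncurry fun (x t : ℝ) => (1 - Real.cos (t * x)) / t ^ 2) := by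
    unfold Function.uncurry; fun_prop
  rw [integrable_prod_iff hm.aestronglyMeasurable]
  refine ⟨Eventually.of_forall fun x => integrableOn_one_sub_cos_mul_div_sq x, ?_⟩
  refine (hP.const_mul cosIntegral).congr (Eventually.of_forall fun x => ?_)
  simp only [Function.uncurry]
  rw [← integral_one_sub_cos_mul_div_sq]
  congr 1; ext t
  rw [Real.norm_eq_abs, abs_of_nonneg (one_sub_cos_div_sq_nonneg t x)]

lemma integral_cos_eq {P : Measure ℝ} [IsProbabilityMeasure P] (t : ℝ) :
    ∫ x, (1 - Real.cos (t * x)) / t ^ 2 ∂P = (1 - (charFun P t).re) / t ^ 2 := by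
  have hi : Integrable (fun x : ℝ => Real.cos (t * x)) P := by
    refine Integrable.of_bound (by fun_prop) 1 (Eventually.of_forall fun x => ?_)
    exact Real.abs_cos_le_one _
  rw [integral_div, integral_sub (integrable_const _) hi, re_charFun_eq]
  simp

/-- The first absolute moment is an integral of the characteristic function. -/
lemma integral_abs_eq {P : Measure ℝ} [IsProbabilityMeasure P]
    (hP : Integrable (fun x : ℝ => |x|) P) :
    cosIntegral * ∫ x, |x| ∂P =
      ∫ t in Set.Ioi (0 : ℝ), (1 - (charFun P t).re) / t ^ 2 := by
  rw [← integral_const_mul]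
  simp_rw [← integral_one_sub_cos_mul_div_sq]
  rw [integral_integral_swap (integrable_one_sub_cos_prod hP)]
  simp_rw [integral_cos_eq]

lemma integrableOn_one_sub_charFun {P : Measure ℝ} [IsProbabilityMeasure P]
    (hP : Integrable (fun x : ℝ => |x|) P) :
    IntegrableOn (fun t => (1 - (charFun P t).re) / t ^ 2) (Set.Ioi (0 : ℝ)) := by
  have := (integrable_one_sub_cos_prod hP).integral_prod_right
  simp only [Function.uncurry] at this
  simp_rw [integral_cos_eq] at this
  exact this

/-- Two laws whose characteristic functions are close have close first absolute moments. -/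
lemma abs_integral_abs_sub_le {P Q : Measure ℝ} [IsProbabilityMeasure P] [IsProbabilityMeasure Q]
    (hP : Integrable (fun x : ℝ => |x|) P) (hQ : Integrable (fun x : ℝ => |x|) Q)
    {h : ℝ → ℝ} (hi : IntegrableOn h (Set.Ioi 0))
    (hle : ∀ t, 0 < t → ‖charFun P t - charFun Q t‖ / t ^ 2 ≤ h t) :
    |∫ x, |x| ∂P - ∫ x, |x| ∂Q| ≤ cosIntegral⁻¹ * ∫ t in Set.Ioi (0 : ℝ), h t := by
  rw [inv_mul_eq_div, le_div_iff₀ cosIntegral_pos]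
  have e : |∫ x, |x| ∂P - ∫ x, |x| ∂Q| * cosIntegral =
      ‖∫ t in Set.Ioi (0 : ℝ), ((1 - (charFun P t).re) / t ^ 2 -
        (1 - (charFun Q t).re) / t ^ 2)‖ := by
    rw [integral_sub (integrableOn_one_sub_charFun hP) (integrableOn_one_sub_charFun hQ),
      ← integral_abs_eq hP, ← integral_abs_eq hQ, ← mul_sub, norm_mul, Real.norm_eq_abs,
      Real.norm_eq_abs, abs_of_pos cosIntegral_pos, mul_comm]
  rw [e]
  refine norm_integral_le_of_norm_le hi ((ae_restrict_iff' measurableSet_Ioi).2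
    (Eventually.of_forall fun t ht => ?_))
  refine le_trans ?_ (hle t ht)
  rw [← sub_div, norm_div, norm_pow, Real.norm_eq_abs t, sq_abs]
  refine div_le_div_of_nonneg_right ?_ (sq_nonneg t)
  have := Complex.abs_re_le_norm (charFun P t - charFun Q t)
  rw [Complex.sub_re] at this
  have e3 : 1 - (charFun P t).re - (1 - (charFun Q t).re) =
      -((charFun P t).re - (charFun Q t).re) := by ring
  rw [e3, norm_neg]
  exact this

/-! ### Normal approximation of the first absolute moment of a sum -/

/-- Taylor expansion of the characteristic function of a bounded centred law. The third absolute
moment is bounded by `M v`, so the error carries the variance `v` as a factor. -/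
lemma norm_charFun_sub_le {ν : Measure ℝ} [IsProbabilityMeasure ν] {M v u : ℝ}
    (hM : ∀ᵐ y ∂ν, |y| ≤ M) (h1 : ∫ y, y ∂ν = 0) (h2 : ∫ y, y ^ 2 ∂ν = v) (hu : |u| * M ≤ 1) :
    ‖charFun ν u - ((1 - v * u ^ 2 / 2 : ℝ) : ℂ)‖ ≤ 2 / 9 * M * v * |u| ^ 3 := by
  have i0 : Integrable (fun y : ℝ => Complex.exp (u * y * Complex.I)) ν := by
    refine Integrable.of_bound (by fun_prop) 1 (Eventually.of_forall fun x => ?_)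
    rw [← Complex.ofReal_mul, Complex.norm_exp_ofReal_mul_I]
  have i1 : Integrable (fun y : ℝ => y) ν :=
    Integrable.of_bound (by fun_prop) M (by simpa using hM)
  have i2 : Integrable (fun y : ℝ => y ^ 2) ν := by
    refine Integrable.of_bound (by fun_prop) (M ^ 2) ?_
    filter_upwards [hM] with y hy
    rw [norm_pow]
    exact pow_le_pow_left₀ (norm_nonneg _) hy 2
  have i3 : Integrable (fun y : ℝ => (1 : ℂ) + u * y * Complex.I - u ^ 2 / 2 * (y ^ 2 : ℝ)) ν :=
    ((integrable_const _).add ((i1.ofReal.const_mul (u : ℂ)).mul_const _)).sub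
      (i2.ofReal.const_mul _)
  have e : ((1 - v * u ^ 2 / 2 : ℝ) : ℂ) =
      ∫ y, ((1 : ℂ) + u * y * Complex.I - u ^ 2 / 2 * (y ^ 2 : ℝ)) ∂ν := by
    rw [integral_sub (by exact ((integrable_const _).add
      ((i1.ofReal.const_mul (u : ℂ)).mul_const _))) (by exact i2.ofReal.const_mul _),
      integral_add (integrable_const _) (by exact (i1.ofReal.const_mul (u : ℂ)).mul_const _),
      integral_const_mul, integral_mul_const, integral_const_mul, integral_complex_ofReal,
      integral_complex_ofReal, h1, h2]
    simp
    ring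
  rw [charFun_apply_real, e, ← integral_sub i0 i3]
  have h3 : 2 / 9 * M * v * |u| ^ 3 = ∫ y, 2 / 9 * M * |u| ^ 3 * y ^ 2 ∂ν := by
    rw [integral_const_mul, h2]; ring
  rw [h3]
  refine norm_integral_le_of_norm_le (i2.const_mul _) ?_
  filter_upwards [hM] with y hy
  have huy : ‖(u * y * Complex.I : ℂ)‖ = |u| * |y| := by simp
  have hle : |u| * |y| ≤ 1 := (mul_le_mul_of_nonneg_left hy (abs_nonneg u)).trans hu
  have hb := Complex.exp_bound (x := u * y * Complex.I) (by rw [huy]; exact hle) (n := 3)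
    (by norm_num)
  rw [huy] at hb
  simp only [Finset.sum_range_succ, Finset.sum_range_zero, Nat.factorial] at hb
  have e2 : Complex.exp (u * y * Complex.I) -
      (1 + u * y * Complex.I - u ^ 2 / 2 * (y ^ 2 : ℝ)) =
    Complex.exp (u * y * Complex.I) - (0 + (u * y * Complex.I) ^ 0 / ((1 : ℕ) : ℂ) +
      (u * y * Complex.I) ^ 1 / (((0 + 1) * 1 : ℕ) : ℂ) +
      (u * y * Complex.I) ^ 2 / (((1 + 1) * ((0 + 1) * 1) : ℕ) : ℂ)) := by
    have hsq : (u * y * Complex.I : ℂ) ^ 2 = -(u ^ 2 * y ^ 2) := by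
      rw [mul_pow, Complex.I_sq]; ring
    push_cast
    rw [hsq]
    ring
  rw [e2]
  refine hb.trans ?_
  have h4 : |y| ^ 3 ≤ M * y ^ 2 := by
    rw [pow_succ, sq_abs, mul_comm]
    exact mul_le_mul_of_nonneg_right hy (sq_nonneg y)
  have h5 : 0 ≤ |u| ^ 3 := by positivity
  rw [mul_pow]
  norm_num
  nlinarith [mul_le_mul_of_nonneg_left h4 h5]

lemma norm_pow_succ_sub_pow_succ_le {z w : ℂ} {q D : ℝ} (hz : ‖z‖ ≤ q) (hw : ‖w‖ ≤ q)
    (hD : ‖z - w‖ ≤ D) (n : ℕ) : ‖z ^ (n + 1) - w ^ (n + 1)‖ ≤ (n + 1) * q ^ n * D := by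
  have hq : 0 ≤ q := (norm_nonneg z).trans hz
  have hD0 : 0 ≤ D := (norm_nonneg _).trans hD
  induction n with
  | zero => simpa using hD
  | succ n ih =>
    have e : z ^ (n + 1 + 1) - w ^ (n + 1 + 1) =
        z * (z ^ (n + 1) - w ^ (n + 1)) + (z - w) * w ^ (n + 1) := by ring
    rw [e]
    refine (norm_add_le _ _).trans ?_
    rw [norm_mul, norm_mul, norm_pow]
    have h1 := mul_le_mul hz ih (norm_nonneg _) hq
    have h2 := mul_le_mul hD (pow_le_pow_left₀ (norm_nonneg _) hw (n + 1)) (by positivity) hD0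
    refine (add_le_add h1 h2).trans (le_of_eq ?_)
    push_cast
    ring

/-- Comparison of the characteristic functions of a sum and of its normal approximation, in the range
`|u| M ≤ 1` where both factors are at most `exp (-v u² / 4)`. -/
lemma norm_charFun_pow_sub_le {ν : Measure ℝ} [IsProbabilityMeasure ν] {M v u : ℝ} (hM0 : 0 < M)
    (hM : ∀ᵐ y ∂ν, |y| ≤ M) (h1 : ∫ y, y ∂ν = 0) (h2 : ∫ y, y ^ 2 ∂ν = v) (hu : |u| * M ≤ 1)
    (n : ℕ) :
    ‖charFun ν u ^ (n + 1) - ((Real.exp (-(v * u ^ 2 / 2)) : ℝ) : ℂ) ^ (n + 1)‖ ≤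
      (n + 1) * Real.exp (-(v * u ^ 2 / 4)) ^ n * (M * v * |u| ^ 3 / 2) := by
  have hv0 : 0 ≤ v := h2 ▸ integral_nonneg fun y => sq_nonneg y
  have i2 : Integrable (fun y : ℝ => y ^ 2) ν := by
    refine Integrable.of_bound (by fun_prop) (M ^ 2) ?_
    filter_upwards [hM] with y hy
    rw [norm_pow]
    exact pow_le_pow_left₀ (norm_nonneg _) hy 2
  have hvM : v ≤ M ^ 2 := by
    have : ∫ y, y ^ 2 ∂ν ≤ ∫ _, M ^ 2 ∂ν := by
      refine integral_mono_ae i2 (integrable_const _) ?_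
      filter_upwards [hM] with y hy
      rw [← sq_abs y]
      exact pow_le_pow_left₀ (abs_nonneg _) hy 2
    simpa [h2] using this
  have hu0 := abs_nonneg u
  have hu2 : u ^ 2 = |u| ^ 2 := (sq_abs u).symm
  -- `a = v u² / 2` is at most `1/2`, and `a²` is dominated by the cubic error term
  have ha0 : 0 ≤ v * u ^ 2 / 2 := by positivity
  have huM2 : |u| ^ 2 * M ^ 2 ≤ 1 := by
    rw [← mul_pow]; exact pow_le_one₀ (by positivity) hu
  have ha1 : v * u ^ 2 / 2 ≤ 1 / 2 := by
    rw [hu2]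
    have := mul_le_mul_of_nonneg_right hvM (sq_nonneg |u|)
    nlinarith
  have hcub : |u| ^ 3 * M ≤ |u| ^ 2 := by
    have := mul_le_mul_of_nonneg_left hu (sq_nonneg |u|)
    nlinarith
  have hc := norm_charFun_sub_le hM h1 h2 hu
  have hMv : M * v * |u| ^ 3 ≤ v * |u| ^ 2 := by
    have := mul_le_mul_of_nonneg_left hcub hv0
    linarith
  refine norm_pow_succ_sub_pow_succ_le ?_ ?_ ?_ n
  · have h3 : ‖charFun ν u‖ ≤ ‖((1 - v * u ^ 2 / 2 : ℝ) : ℂ)‖ + 2 / 9 * M * v * |u| ^ 3 := by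
      have := norm_add_le (charFun ν u - ((1 - v * u ^ 2 / 2 : ℝ) : ℂ))
        ((1 - v * u ^ 2 / 2 : ℝ) : ℂ)
      rw [sub_add_cancel] at this
      linarith
    rw [Complex.norm_real, Real.norm_eq_abs, abs_of_nonneg (by linarith)] at h3
    have h4 := Real.add_one_le_exp (-(v * u ^ 2 / 4))
    rw [hu2] at *
    have : 0 ≤ v * |u| ^ 2 := by positivity
    linarith
  · rw [Complex.norm_real, Real.norm_eq_abs, abs_of_pos (Real.exp_pos _)]
    exact Real.exp_le_exp.2 (by linarith)
  · have h3 : ‖((1 - v * u ^ 2 / 2 : ℝ) : ℂ) - ((Real.exp (-(v * u ^ 2 / 2)) : ℝ) : ℂ)‖ ≤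
        (v * u ^ 2 / 2) ^ 2 := by
      rw [← Complex.ofReal_sub, Complex.norm_real, Real.norm_eq_abs, abs_sub_comm]
      have := Real.abs_exp_sub_one_sub_id_le (x := -(v * u ^ 2 / 2))
        (by rw [abs_neg, abs_of_nonneg ha0]; linarith)
      rw [neg_sq] at this
      convert this using 2
      ring
    have h4 : (v * u ^ 2 / 2) ^ 2 ≤ M * v * |u| ^ 3 / 4 := by
      have a1 : v * |u| ≤ M := by
        have := mul_le_mul_of_nonneg_right hvM hu0
        nlinarith
      have a2 := mul_le_mul_of_nonneg_left a1 (show 0 ≤ v * |u| ^ 3 by positivity)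
      rw [hu2]
      nlinarith
    have h5 := norm_add_le (charFun ν u - ((1 - v * u ^ 2 / 2 : ℝ) : ℂ))
      (((1 - v * u ^ 2 / 2 : ℝ) : ℂ) - ((Real.exp (-(v * u ^ 2 / 2)) : ℝ) : ℂ))
    rw [sub_add_sub_cancel] at h5
    have : 0 ≤ M * v * |u| ^ 3 := by positivity
    linarith

lemma integral_mul_exp_neg_mul_sq_Ioi {c : ℝ} (hc : 0 < c) :
    ∫ t in Set.Ioi (0 : ℝ), t * Real.exp (-c * t ^ 2) = 1 / (2 * c) := by
  have h := integral_rpow_mul_exp_neg_mul_rpow (p := 2) (q := 1) two_pos (by norm_num) hc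
  have e : ∀ t : ℝ, t ^ (1 : ℝ) * Real.exp (-c * t ^ (2 : ℝ)) = t * Real.exp (-c * t ^ 2) :=
    fun t => by rw [Real.rpow_one, Real.rpow_two]
  simp_rw [e] at h
  rw [h]
  norm_num
  rw [Real.rpow_neg_one]

lemma integrable_abs_gaussianReal (m : ℝ) (v : NNReal) :
    Integrable (fun x : ℝ => |x|) (gaussianReal m v) := by
  have h := (memLp_id_gaussianReal (μ := m) (v := v) 1).integrable (by norm_num)
  exact h.abs

/-- A bound of order `M / n`, with an absolute constant, for the normal approximation of
`𝔼 |Ȳₙ + c|` when the centred summands are bounded by `M`. Low frequencies contribute `2 M / n`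
through the cubic Taylor remainder of the characteristic function, and frequencies above `n / M`
contribute `2 M / n` trivially; the variance need not be bounded below. -/
lemma abs_integral_abs_mean_sub_le {Ω : Type*} [MeasurableSpace Ω] {μ : Measure Ω}
    [IsProbabilityMeasure μ] {Y : ℕ → Ω → ℝ} (hY : ∀ i, Measurable (Y i)) (hind : iIndepFun Y μ)
    {ν : Measure ℝ} [IsProbabilityMeasure ν] (hlaw : ∀ i, μ.map (Y i) = ν) {M v : ℝ}
    (hM0 : 0 < M) (hM : ∀ᵐ y ∂ν, |y| ≤ M) (h1 : ∫ y, y ∂ν = 0) (h2 : ∫ y, y ^ 2 ∂ν = v)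
    {n : ℕ} (hn : 2 ≤ n) (c : ℝ) :
    |∫ ω, |1 / (n : ℝ) * ∑ i ∈ Finset.range n, Y i ω + c| ∂μ -
      ∫ x, |x| ∂(gaussianReal c (v / n).toNNReal)| ≤ cosIntegral⁻¹ * (4 * (M / n)) := by
  have hn0 : (0 : ℝ) < n := by exact_mod_cast (by omega : 0 < n)
  have hn2 : (2 : ℝ) ≤ n := by exact_mod_cast hn
  have hv0 : 0 ≤ v := h2 ▸ integral_nonneg fun y => sq_nonneg y
  obtain ⟨m, rfl⟩ : ∃ m, n = m + 1 := ⟨n - 1, by omega⟩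
  set n := m + 1 with hndef
  set S : Ω → ℝ := fun ω => ∑ i ∈ Finset.range n, Y i ω with hS
  have hSm : Measurable S := Finset.measurable_sum _ fun i _ => hY i
  set P := μ.map (fun ω => c + 1 / (n : ℝ) * S ω) with hP
  have hPm : Measurable fun ω => c + 1 / (n : ℝ) * S ω := (hSm.const_mul _).const_add _
  have : IsProbabilityMeasure P := Measure.isProbabilityMeasure_map hPm.aemeasurable
  have hYb : ∀ i, ∀ᵐ ω ∂μ, |Y i ω| ≤ M := fun i => by
    rw [← hlaw i] at hM
    exact ae_of_ae_map (hY i).aemeasurable hM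
  have hSb : ∀ᵐ ω ∂μ, |S ω| ≤ n * M := by
    filter_upwards [ae_all_iff.2 hYb] with ω hω
    refine (Finset.abs_sum_le_sum_abs _ _).trans ((Finset.sum_le_sum fun i _ => hω i).trans ?_)
    simp
  have hPi : Integrable (fun x : ℝ => |x|) P := by
    rw [hP, integrable_map_measure (by fun_prop) hPm.aemeasurable]
    refine Integrable.of_bound (by fun_prop) (|c| + 1 / n * (n * M)) ?_
    filter_upwards [hSb] with ω hω
    simp only [Function.comp_apply, Real.norm_eq_abs, abs_abs]
    refine (abs_add_le _ _).trans (add_le_add le_rfl ?_)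
    rw [abs_mul, abs_of_pos (show 0 < 1 / (n : ℝ) by positivity)]
    exact mul_le_mul_of_nonneg_left hω (by positivity)
  have hPint : ∫ x, |x| ∂P = ∫ ω, |1 / (n : ℝ) * S ω + c| ∂μ := by
    rw [hP, integral_map hPm.aemeasurable (by fun_prop)]
    simp_rw [add_comm c]
  rw [← hPint]
  have hcP : ∀ t : ℝ, charFun P t =
      Complex.exp (c * t * Complex.I) * charFun ν (1 / n * t) ^ n := fun t => by
    have e1 : P = ((μ.map S).map (fun x => 1 / (n : ℝ) * x)).map (fun x => c + x) := by
      rw [Measure.map_map (by fun_prop) (by fun_prop), Measure.map_map (by fun_prop) hSm]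
      rfl
    have hres : iIndepFun ((Finset.range n).restrict Y) μ :=
      hind.precomp (g := fun i : Finset.range n => (i : ℕ)) Subtype.val_injective
    rw [e1, charFun_map_const_add, charFun_map_mul, hS,
      iIndepFun.charFun_map_fun_finsetSum_eq_prod (fun i _ => (hY i).aemeasurable) hres]
    simp only [hlaw, Finset.prod_const, Finset.card_range]
    rw [mul_comm]
    congr 2
    simp [mul_comm]
  have hcQ : ∀ t : ℝ, charFun (gaussianReal c (v / n).toNNReal) t =
      Complex.exp (c * t * Complex.I) *
        ((Real.exp (-(v * (1 / n * t) ^ 2 / 2)) : ℝ) : ℂ) ^ n := fun t => by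
    rw [charFun_gaussianReal, Real.coe_toNNReal _ (by positivity), Complex.ofReal_exp,
      ← Complex.exp_nat_mul, ← Complex.exp_add]
    congr 1
    have : (n : ℂ) ≠ 0 := by exact_mod_cast hn0.ne'
    push_cast
    field_simp
    ring
  have hdiff : ∀ t : ℝ, ‖charFun P t - charFun (gaussianReal c (v / n).toNNReal) t‖ =
      ‖charFun ν (1 / n * t) ^ n -
        ((Real.exp (-(v * (1 / n * t) ^ 2 / 2)) : ℝ) : ℂ) ^ n‖ := fun t => by
    rw [hcP, hcQ, ← mul_sub, norm_mul, ← Complex.ofReal_mul, Complex.norm_exp_ofReal_mul_I,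
      one_mul]
  -- For `t ≤ n / M` the bound is integrable with `∫ t exp (-k t²) = 1 / (2 k)`, where `1 / k` cancels
  -- the factor `v`; for `t > n / M` the two characteristic functions differ by at most `2`.
  set T : ℝ := n / M with hT
  have hT0 : 0 < T := by positivity
  set k : ℝ := v / (8 * n) with hk
  have hk0 : 0 ≤ k := by positivity
  set h1' : ℝ → ℝ := fun t => M * v / (2 * n ^ 2) * (t * Real.exp (-k * t ^ 2)) with hh1
  set h2' : ℝ → ℝ := (Set.Ioi T).indicator fun t => 2 / t ^ 2 with hh2
  have hi1 : IntegrableOn h1' (Set.Ioi 0) ∧ ∫ t in Set.Ioi 0, h1' t ≤ 2 * (M / n) := by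
    rcases hv0.eq_or_lt with hv | hv
    · have : h1' = fun _ => 0 := by ext t; simp [hh1, ← hv]
      rw [this]
      exact ⟨integrable_zero _ _ _, by simp; positivity⟩
    · have hkp : 0 < k := by positivity
      refine ⟨((integrable_mul_exp_neg_mul_sq hkp).const_mul _).integrableOn, ?_⟩
      rw [hh1, integral_const_mul, integral_mul_exp_neg_mul_sq_Ioi hkp, hk]
      refine le_of_eq ?_
      field_simp
      norm_num
  have hi2 : IntegrableOn h2' (Set.Ioi 0) :=
    ((integrable_indicator_iff measurableSet_Ioi).2 (integrableOn_two_div_sq hT0)).integrableOn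
  have hi2' : ∫ t in Set.Ioi 0, h2' t = 2 * (M / n) := by
    rw [hh2, setIntegral_indicator measurableSet_Ioi,
      Set.inter_eq_right.2 (Set.Ioi_subset_Ioi hT0.le), integral_two_div_sq hT0, hT]
    field_simp
  have hle : ∀ t, 0 < t → ‖charFun P t - charFun (gaussianReal c (v / n).toNNReal) t‖ / t ^ 2 ≤
      h1' t + h2' t := fun t ht => by
    have hpos1 : 0 ≤ h1' t := by simp only [hh1]; positivity
    rcases lt_or_ge T t with hTt | hTt
    · have e2 : h2' t = 2 / t ^ 2 := Set.indicator_of_mem (show t ∈ Set.Ioi T from hTt) _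
      have : ‖charFun P t - charFun (gaussianReal c (v / n).toNNReal) t‖ ≤ 2 := by
        refine (norm_sub_le _ _).trans ?_
        have a := norm_charFun_le_one (μ := P) t
        have b := norm_charFun_le_one (μ := gaussianReal c (v / n).toNNReal) t
        linarith
      rw [e2]
      have := div_le_div_of_nonneg_right this (sq_nonneg t)
      linarith
    · have e2 : h2' t = 0 := Set.indicator_of_notMem (by simpa using hTt) _
      rw [e2, add_zero, hdiff, div_le_iff₀ (by positivity)]
      have hu : |1 / n * t| * M ≤ 1 := by
        rw [abs_of_pos (by positivity)]
        rw [hT, le_div_iff₀ hM0] at hTt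
        rw [mul_assoc, one_div, inv_mul_le_iff₀ hn0, mul_one]
        exact hTt
      refine (norm_charFun_pow_sub_le hM0 hM h1 h2 hu m).trans ?_
      have habs : |1 / (n : ℝ) * t| = t / n := by
        rw [abs_of_pos (by positivity)]; ring
      have hmn : (n : ℝ) = m + 1 := by rw [hndef]; push_cast; ring
      have hexp : Real.exp (-(v * (1 / n * t) ^ 2 / 4)) ^ m ≤ Real.exp (-k * t ^ 2) := by
        rw [← Real.exp_nat_mul]
        refine Real.exp_le_exp.2 ?_
        rw [hk]
        have hm : (n : ℝ) / 2 ≤ m := by linarith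
        have hq : 0 ≤ v * (1 / n * t) ^ 2 / 4 := by positivity
        have e3 : -(v / (8 * n)) * t ^ 2 = (n : ℝ) / 2 * -(v * (1 / n * t) ^ 2 / 4) := by
          field_simp; ring
        rw [e3]
        nlinarith
      rw [habs, ← hmn]
      have h3 : (n : ℝ) * Real.exp (-(v * (1 / n * t) ^ 2 / 4)) ^ m * (M * v * (t / n) ^ 3 / 2) ≤
          n * Real.exp (-k * t ^ 2) * (M * v * (t / n) ^ 3 / 2) := by gcongr
      refine h3.trans (le_of_eq ?_)
      simp only [hh1]
      field_simp
  refine (abs_integral_abs_sub_le hPi (integrable_abs_gaussianReal _ _) (hi1.1.add hi2) hle).trans ?_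
  refine mul_le_mul_of_nonneg_left ?_ (inv_pos.2 cosIntegral_pos).le
  simp only [Pi.add_apply]
  rw [integral_add hi1.1 hi2, hi2']
  linarith [hi1.2]

/-! ### The absolute moment of a normal variable -/

/-- `𝔼 |w Z - v|` for a standard normal `Z`, which agrees with `scaledNormalAbs` for `w ≥ 0` and needs
no separate convention at `w = 0`. -/
def normalAbs (w v : ℝ) : ℝ := ∫ z, |w * z - v| ∂(gaussianReal 0 1)

lemma integrable_normalAbs (w v : ℝ) :
    Integrable (fun z : ℝ => |w * z - v|) (gaussianReal 0 1) := by
  have h := (memLp_id_gaussianReal (μ := 0) (v := 1) 1).integrable (by norm_num)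
  exact ((h.const_mul w).sub (integrable_const v)).abs

lemma scaledNormalAbs_eq {w : ℝ} (hw : 0 ≤ w) (v : ℝ) :
    scaledNormalAbs w v = normalAbs w v := by
  rw [scaledNormalAbs, normalAbs]
  split_ifs with h
  · simp [h]
  · rw [← integral_const_mul]
    congr 1; ext z
    nth_rewrite 1 [← abs_of_nonneg hw]
    rw [← abs_mul]
    congr 1
    field_simp

lemma normalAbs_eq_integral_gaussianReal (w v : ℝ) :
    normalAbs w v = ∫ x, |x| ∂(gaussianReal v (w ^ 2).toNNReal) := by
  have h1 : (gaussianReal 0 1).map (fun z => v + -w * z) = gaussianReal v (w ^ 2).toNNReal := by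
    have : (fun z : ℝ => v + -w * z) = (fun z => v + z) ∘ fun z => -w * z := rfl
    rw [this, ← Measure.map_map (by fun_prop) (by fun_prop), gaussianReal_map_const_mul,
      gaussianReal_map_const_add]
    congr 1
    · simp
    · ext
      simp [Real.coe_toNNReal _ (sq_nonneg w)]
  rw [← h1, integral_map (by fun_prop) (by fun_prop), normalAbs]
  congr 1; ext z
  rw [abs_sub_comm]
  congr 1
  ring

lemma integral_abs_gaussianReal : ∫ z, |z| ∂(gaussianReal 0 1) = √(2 / Real.pi) := by
  rw [integral_gaussianReal_eq_integral_smul one_ne_zero]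
  have h : ∀ z : ℝ, gaussianPDFReal 0 1 z • |z| =
      (√(2 * Real.pi))⁻¹ * (|z| * Real.exp (-(1 / 2) * |z| ^ 2)) := fun z => by
    rw [gaussianPDFReal, sq_abs, smul_eq_mul]
    simp only [NNReal.coe_one, mul_one, sub_zero]
    rw [show -z ^ 2 / 2 = -(1 / 2) * z ^ 2 by ring]
    ring
  simp_rw [h]
  rw [integral_const_mul, integral_comp_abs (f := fun z => z * Real.exp (-(1 / 2) * z ^ 2)),
    integral_mul_exp_neg_mul_sq_Ioi (by norm_num)]
  have h2 : √(2 * Real.pi) = √2 * √Real.pi := Real.sqrt_mul zero_le_two _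
  rw [h2, Real.sqrt_div zero_le_two]
  have h3 : √2 * √2 = 2 := Real.mul_self_sqrt zero_le_two
  have : √2 ≠ 0 := by positivity
  have : √Real.pi ≠ 0 := by positivity
  field_simp
  linarith

/-- `𝔼 |w Z - v|` is Lipschitz in `w` and `v`, with constants `𝔼 |Z|` and `1`. -/
lemma abs_normalAbs_sub_le (w v w' v' : ℝ) :
    |normalAbs w v - normalAbs w' v'| ≤ √(2 / Real.pi) * |w - w'| + |v - v'| := by
  rw [normalAbs, normalAbs, ← integral_sub (integrable_normalAbs w v) (integrable_normalAbs w' v'),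
    ← Real.norm_eq_abs]
  have hz : Integrable (fun z : ℝ => |z| * |w - w'|) (gaussianReal 0 1) :=
    (integrable_abs_gaussianReal 0 1).mul_const _
  have hi : Integrable (fun z : ℝ => |z| * |w - w'| + |v - v'|) (gaussianReal 0 1) :=
    hz.add (integrable_const _)
  refine (norm_integral_le_of_norm_le hi (Eventually.of_forall fun z => ?_)).trans (le_of_eq ?_)
  · rw [Real.norm_eq_abs]
    refine (abs_abs_sub_abs_le _ _).trans ?_
    rw [← abs_mul, show w * z - v - (w' * z - v') = z * (w - w') - (v - v') by ring]
    exact abs_sub _ _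
  · rw [integral_add hz (integrable_const _), integral_mul_const, integral_abs_gaussianReal]
    simp

lemma normalAbs_zero_zero : normalAbs 0 0 = 0 := by simp [normalAbs]

lemma normalAbs_nonneg (w v : ℝ) : 0 ≤ normalAbs w v := integral_nonneg fun _ => abs_nonneg _

lemma normalAbs_le (w v : ℝ) : normalAbs w v ≤ √(2 / Real.pi) * |w| + |v| := by
  have := abs_normalAbs_sub_le w v 0 0
  rw [normalAbs_zero_zero, sub_zero, sub_zero, sub_zero] at this
  exact (le_abs_self _).trans this

lemma continuous_normalAbs : Continuous fun p : ℝ × ℝ => normalAbs p.1 p.2 := by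
  refine continuous_iff_continuousAt.2 fun p => tendsto_iff_norm_sub_tendsto_zero.2 ?_
  have hc : Continuous fun q : ℝ × ℝ =>
      √(2 / Real.pi) * |q.1 - p.1| + |q.2 - p.2| := by fun_prop
  have h0 := hc.tendsto p
  simp only [sub_self, abs_zero, mul_zero, add_zero] at h0
  exact squeeze_zero_norm' (Eventually.of_forall fun q => by
    rw [norm_norm]; exact abs_normalAbs_sub_le _ _ _ _) h0

/-! ### The estimator built from a sample -/

section Sample

variable {f : (Fin d → ℝ) → ℝ} {Ω : Type*} [MeasurableSpace Ω] {μ : Measure Ω}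
  {X : ℕ → Ω → (Fin d → ℝ)}

/-- The common law of the observations. -/
def sampleLaw (f : (Fin d → ℝ) → ℝ) : Measure (Fin d → ℝ) :=
  (volume.restrict (simplex d)).withDensity fun x => ENNReal.ofReal (f x)

lemma integral_sampleLaw (hf0 : ∀ x ∈ simplex d, 0 ≤ f x) (hfc : ContinuousOn f (simplex d))
    (G : (Fin d → ℝ) → ℝ) : ∫ x, G x ∂(sampleLaw f) = ∫ x in simplex d, G x * f x := by
  rw [sampleLaw, integral_withDensity_eq_integral_toReal_smul₀
    (hfc.aemeasurable measurableSet_simplex).ennreal_ofReal (by simp)]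
  refine setIntegral_congr_fun measurableSet_simplex fun x hx => ?_
  simp only [ENNReal.toReal_ofReal (hf0 x hx), smul_eq_mul, mul_comm]

lemma ae_sampleLaw_of_ae {p : (Fin d → ℝ) → Prop}
    (h : ∀ᵐ x ∂(volume.restrict (simplex d)), p x) : ∀ᵐ x ∂(sampleLaw f), p x :=
  (withDensity_absolutelyContinuous _ _).ae_le h

lemma ae_sampleLaw_simplex : ∀ᵐ x ∂(sampleLaw f), x ∈ simplex d :=
  ae_sampleLaw_of_ae (ae_restrict_mem measurableSet_simplex)

lemma IsIIDSample.ae_of_ae (hX : IsIIDSample μ X f) {p : (Fin d → ℝ) → Prop}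
    (h : ∀ᵐ x ∂(volume.restrict (simplex d)), p x) : ∀ᵐ ω ∂μ, ∀ i, p (X i ω) := by
  refine ae_all_iff.2 fun i => ae_of_ae_map (hX.measurable i).aemeasurable ?_
  rw [hX.law i]
  exact ae_sampleLaw_of_ae h

lemma measurable_estimator (hX : IsIIDSample μ X f) (n : ℕ) (b : ℝ) (s : Fin d → ℝ) :
    Measurable (estimator X n b s) :=
  (Finset.measurable_sum _ fun i _ => (measurable_kernel b s).comp (hX.measurable i)).const_mul _

omit [MeasurableSpace Ω] in
lemma abs_estimator_le {b C : ℝ} (hb : 0 < b)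
    (hC : ∀ s ∈ simplex d, ∀ x ∈ simplex d, kernel b s x ≤ C) {s : Fin d → ℝ}
    (hs : s ∈ simplex d) {n : ℕ} (hn : 1 ≤ n) {ω : Ω} (hω : ∀ i, X i ω ∈ simplex d) :
    |estimator X n b s ω| ≤ C := by
  have hn0 : (0 : ℝ) < n := by exact_mod_cast hn
  rw [estimator, abs_mul, abs_of_pos (show 0 < 1 / (n : ℝ) by positivity), one_div,
    inv_mul_le_iff₀ hn0]
  refine (Finset.abs_sum_le_sum_abs _ _).trans
    ((Finset.sum_le_sum fun i _ => abs_kernel_le hb hC hs (hω i)).trans ?_)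
  simp

lemma exists_abs_estimator_sub_le (hX : IsIIDSample μ X f) (hfc : ContinuousOn f (simplex d))
    {b : ℝ} (hb : 0 < b) {n : ℕ} (hn : 1 ≤ n) :
    ∃ C, ∀ᵐ ω ∂μ, ∀ s ∈ simplex d, |estimator X n b s ω - f s| ≤ C := by
  obtain ⟨C, hC⟩ := kernel_le_const (d := d) hb
  obtain ⟨F, hF⟩ := isCompact_simplex.exists_bound_of_continuousOn hfc
  refine ⟨C + F, ?_⟩
  filter_upwards [hX.ae_of_ae (ae_restrict_mem measurableSet_simplex)] with ω hω s hs
  exact (abs_sub _ _).trans (add_le_add (abs_estimator_le hb hC hs hn hω) (hF s hs))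

variable [IsProbabilityMeasure μ]

lemma integrable_abs_estimator_sub (hX : IsIIDSample μ X f) (hfc : ContinuousOn f (simplex d))
    {b : ℝ} (hb : 0 < b) {n : ℕ} (hn : 1 ≤ n) {s : Fin d → ℝ} (hs : s ∈ simplex d) :
    Integrable (fun ω => |estimator X n b s ω - f s|) μ := by
  obtain ⟨C, hC⟩ := exists_abs_estimator_sub_le hX hfc hb hn
  refine Integrable.of_bound
    ((measurable_estimator hX n b s).sub_const _).norm.aestronglyMeasurable C ?_
  filter_upwards [hC] with ω hω
  rw [Real.norm_eq_abs, abs_abs]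
  exact hω s hs

lemma integrableOn_pointwiseMAE (hd : 1 ≤ d) (hX : IsIIDSample μ X f)
    (hfc : ContinuousOn f (simplex d)) {b : ℝ} (hb : 0 < b) {n : ℕ} (hn : 1 ≤ n) :
    IntegrableOn (pointwiseMAE μ X f n b) (simplex d) := by
  obtain ⟨C, hC⟩ := exists_abs_estimator_sub_le hX hfc hb hn
  refine integrableOn_of_bound (C := C)
    (aestronglyMeasurable_of_continuousOn_openSimplex hd ?_) fun s hs => ?_
  · refine continuousOn_of_dominated (bound := fun _ => C) (fun s hs => ?_) (fun s hs => ?_)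
      (integrable_const _) ?_
    · exact ((measurable_estimator hX n b s).sub_const _).norm.aestronglyMeasurable
    · filter_upwards [hC] with ω hω
      rw [Real.norm_eq_abs, abs_abs]
      exact hω s (openSimplex_subset hs)
    · filter_upwards [hX.ae_of_ae (ae_openSimplex hd)] with ω hω
      exact ((continuousOn_const.mul (continuousOn_finsetSum _ fun i _ =>
        continuousOn_kernel hb (hω i))).sub (hfc.mono openSimplex_subset)).abs
  · rw [← Real.norm_eq_abs]
    refine (norm_integral_le_of_norm_le (integrable_const C) ?_).trans (by simp)
    filter_upwards [hC] with ω hω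
    rw [Real.norm_eq_abs, abs_abs]
    exact hω s hs

/-- Normal approximation of the pointwise error; the summands are bounded by the peak of the
kernel. -/
lemma abs_pointwiseMAE_sub_le (hd : 1 ≤ d) (hf : IsSimplexDensity f)
    (hX : IsIIDSample μ X f) (hfc : ContinuousOn f (simplex d)) {b : ℝ} (hb : 0 < b) {n : ℕ}
    (hn : 2 ≤ n) {s : Fin d → ℝ} (hs : s ∈ openSimplex d) :
    |pointwiseMAE μ X f n b s - normalAbs ((n : ℝ) ^ (-(1 / 2) : ℝ) * kernelSD f b s)
      (kernelMean f b s - f s)| ≤ cosIntegral⁻¹ * (4 * (kernel b s s / n)) := by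
  have hs' := openSimplex_subset hs
  have hn0 : (0 : ℝ) < n := by exact_mod_cast (by omega : 0 < n)
  have hprob : IsProbabilityMeasure (sampleLaw f) := by
    rw [sampleLaw, ← hX.law 0]
    exact Measure.isProbabilityMeasure_map (hX.measurable 0).aemeasurable
  set m := kernelMean f b s with hm
  set φ : (Fin d → ℝ) → ℝ := fun x => kernel b s x - m with hφ
  have hφm : Measurable φ := (measurable_kernel b s).sub_const m
  set ν := (sampleLaw f).map φ with hν
  have : IsProbabilityMeasure ν := Measure.isProbabilityMeasure_map hφm.aemeasurable
  have hm0 : 0 ≤ m := setIntegral_nonneg measurableSet_simplex fun x hx =>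
    mul_nonneg (kernel_nonneg hb hs' hx) (hf.nonneg x hx)
  have hmM : m ≤ kernel b s s := by
    have h : m ≤ ∫ x in simplex d, kernel b s s * f x :=
      setIntegral_mono_on (integrableOn_kernel_mul_of_continuousOn hd hb hs' hfc)
        ((integrableOn_of_continuousOn hfc).const_mul _) measurableSet_simplex
        fun x hx => mul_le_mul_of_nonneg_right (kernel_le_self hb hs hx) (hf.nonneg x hx)
    rwa [integral_const_mul, hf.integral_eq_one, mul_one] at h
  have iK := integrableOn_kernel_mul_of_continuousOn hd hb hs' hfc
  have iK2 := integrableOn_kernel_sq_mul hd hfc hb hs'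
  have if' := integrableOn_of_continuousOn hfc
  have hM : ∀ᵐ y ∂ν, |y| ≤ kernel b s s := by
    rw [hν, ae_map_iff hφm.aemeasurable (measurableSet_le (by fun_prop) (by fun_prop))]
    filter_upwards [ae_sampleLaw_simplex] with x hx
    have h1 := kernel_nonneg hb hs' hx
    have h2 := kernel_le_self hb hs hx
    exact abs_le.2 ⟨by simp only [hφ]; linarith, by simp only [hφ]; linarith⟩
  have h1 : ∫ y, y ∂ν = 0 := by
    rw [hν, integral_map hφm.aemeasurable (by fun_prop), integral_sampleLaw hf.nonneg hfc]
    simp only [hφ, sub_mul]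
    rw [integral_sub iK (if'.const_mul m), integral_const_mul, hf.integral_eq_one, mul_one]
    exact sub_self _
  have h2 : ∫ y, y ^ 2 ∂ν = kernelSecondMoment f b s - m ^ 2 := by
    rw [hν, integral_map hφm.aemeasurable (by fun_prop), integral_sampleLaw hf.nonneg hfc]
    have e : ∀ x, φ x ^ 2 * f x =
        kernel b s x ^ 2 * f x - 2 * m * (kernel b s x * f x) + m ^ 2 * f x := fun x => by
      simp only [hφ]; ring
    simp_rw [e]
    have i1 : IntegrableOn (fun x => 2 * m * (kernel b s x * f x)) (simplex d) := iK.const_mul _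
    have i2 : IntegrableOn (fun x => m ^ 2 * f x) (simplex d) := if'.const_mul _
    have i3 : IntegrableOn (fun x => kernel b s x ^ 2 * f x - 2 * m * (kernel b s x * f x))
      (simplex d) := iK2.sub i1
    rw [integral_add i3 i2, integral_sub iK2 i1, integral_const_mul, integral_const_mul,
      hf.integral_eq_one]
    have : ∫ x in simplex d, kernel b s x * f x = m := rfl
    rw [this, kernelSecondMoment]
    ring
  have hv0 : 0 ≤ kernelSecondMoment f b s - m ^ 2 := h2 ▸ integral_nonneg fun y => sq_nonneg y
  have key := abs_integral_abs_mean_sub_le (μ := μ) (Y := fun i ω => φ (X i ω))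
    (fun i => hφm.comp (hX.measurable i)) (hX.indep.comp (fun _ => φ) fun _ => hφm) (ν := ν)
    (fun i => by
      rw [hν, sampleLaw, ← hX.law i, Measure.map_map hφm (hX.measurable i)]; rfl)
    (kernel_self_pos hb hs) hM h1 h2 hn (m - f s)
  have e1 : pointwiseMAE μ X f n b s =
      ∫ ω, |1 / (n : ℝ) * ∑ i ∈ Finset.range n, φ (X i ω) + (m - f s)| ∂μ := by
    rw [pointwiseMAE]
    congr 1; ext ω
    congr 1
    simp only [estimator, hφ, Finset.sum_sub_distrib, Finset.sum_const, Finset.card_range,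
      nsmul_eq_mul]
    field_simp
    ring
  have e2 : ((n : ℝ) ^ (-(1 / 2) : ℝ) * kernelSD f b s) ^ 2 =
      (kernelSecondMoment f b s - m ^ 2) / n := by
    rw [mul_pow, kernelSD, Real.sq_sqrt hv0, ← Real.rpow_natCast, ← Real.rpow_mul hn0.le,
      show (-(1 / 2) : ℝ) * ((2 : ℕ) : ℝ) = -1 by norm_num, Real.rpow_neg_one, inv_mul_eq_div]
  rw [e1, normalAbs_eq_integral_gaussianReal, e2]
  exact key

end Sample

/-! ### Decomposition of the integrated error -/

section Errors

variable {f : (Fin d → ℝ) → ℝ}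

lemma integrableOn_normalAbs {w v : (Fin d → ℝ) → ℝ} (hw : IntegrableOn w (simplex d))
    (hv : IntegrableOn v (simplex d)) :
    IntegrableOn (fun s => normalAbs (w s) (v s)) (simplex d) := by
  refine Integrable.mono' ((hw.abs.const_mul (√(2 / Real.pi))).add hv.abs)
    (continuous_normalAbs.comp_aestronglyMeasurable (hw.1.prodMk hv.1))
    (Eventually.of_forall fun s => ?_)
  rw [Real.norm_eq_abs, abs_of_nonneg (normalAbs_nonneg _ _)]
  exact normalAbs_le _ _

lemma integrableOn_kernelSD (hd : 1 ≤ d) (hfc : ContinuousOn f (simplex d))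
    (hf0 : ∀ x ∈ simplex d, 0 ≤ f x) {b : ℝ} (hb : 0 < b) (hb1 : b ≤ 1) :
    IntegrableOn (kernelSD f b) (simplex d) := by
  obtain ⟨C, hC0, hC⟩ := exists_kernelSD_le hd hfc hf0
  refine Integrable.mono' ((integrableOn_sqrt_psi hd).const_mul ((b ^ ((d : ℝ) / 4))⁻¹ * C))
    (aestronglyMeasurable_of_continuousOn_openSimplex hd (continuousOn_kernelSD hd hfc hb)) ?_
  filter_upwards [ae_openSimplex hd] with s hs
  have h0 : 0 ≤ kernelSD f b s := Real.sqrt_nonneg _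
  rw [Real.norm_eq_abs, abs_of_nonneg h0, mul_assoc, ← div_eq_inv_mul,
    le_div_iff₀ (by positivity), mul_comm]
  exact hC b hb hb1 s hs

lemma integrableOn_kernelMean_sub (hd : 1 ≤ d) (hf2 : ContDiffOn ℝ 2 f (simplex d)) {b : ℝ}
    (hb : 0 < b) (hb1 : b ≤ 1) :
    IntegrableOn (fun s => kernelMean f b s - f s) (simplex d) := by
  obtain ⟨C, -, hC⟩ := exists_abs_bias_le hf2 hd
  exact integrableOn_of_bound (aestronglyMeasurable_of_continuousOn_openSimplex hd
    ((continuousOn_kernelMean hd hf2.continuousOn hb).sub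
      (hf2.continuousOn.mono openSimplex_subset))) fun s hs => hC b hb hb1 s hs

lemma integrableOn_weight (hd : 1 ≤ d) (hfc : ContinuousOn f (simplex d)) (n : ℕ) (b : ℝ) :
    IntegrableOn (weight f n b) (simplex d) :=
  (integrableOn_sqrt_psi_mul hd hfc).const_mul _

lemma integrableOn_biasCoeff (hf2 : ContDiffOn ℝ 2 f (simplex d)) :
    IntegrableOn (biasCoeff f) (simplex d) :=
  integrableOn_of_continuousOn (continuousOn_biasCoeff hf2)

lemma weight_nonneg (f : (Fin d → ℝ) → ℝ) (n : ℕ) {b : ℝ} (hb : 0 < b) (s : Fin d → ℝ) :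
    0 ≤ weight f n b s := by
  unfold weight; positivity

/-- The integrated normal approximation with the exact standard deviation and bias. -/
def exactNormalMAE (f : (Fin d → ℝ) → ℝ) (n : ℕ) (b : ℝ) : ℝ :=
  ∫ s in simplex d, normalAbs ((n : ℝ) ^ (-(1 / 2) : ℝ) * kernelSD f b s) (kernelMean f b s - f s)

/-- The integrated normal approximation with the limiting standard deviation and exact bias. -/
def weightNormalMAE (f : (Fin d → ℝ) → ℝ) (n : ℕ) (b : ℝ) : ℝ :=
  ∫ s in simplex d, normalAbs (weight f n b s) (kernelMean f b s - f s)

/-- The integrated error of the normal approximation is `O(n⁻¹ b^{-d/2})` because `ψ` is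
integrable. -/
lemma exists_abs_MAE_sub_le.{u} (hd : 1 ≤ d) (hf : IsSimplexDensity f)
    (hf2 : ContDiffOn ℝ 2 f (simplex d)) :
    ∃ C : ℝ, 0 < C ∧ ∀ (Ω : Type u) [MeasurableSpace Ω] (μ : Measure Ω) [IsProbabilityMeasure μ]
      (X : ℕ → Ω → (Fin d → ℝ)), IsIIDSample μ X f → ∀ (n : ℕ) (b : ℝ), 2 ≤ n → 0 < b → b ≤ 1 →
      |MAE μ X f n b - exactNormalMAE f n b| ≤ C * ((n : ℝ) ^ (-1 : ℝ) * b ^ (-(d : ℝ) / 2)) := by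
  obtain ⟨C, hC, hK⟩ := exists_kernel_self_le d
  have hfc := hf2.continuousOn
  have hpsi0 : 0 ≤ ∫ s in simplex d, psi s :=
    setIntegral_nonneg measurableSet_simplex fun s hs => psi_nonneg hs
  have hκ := cosIntegral_pos
  refine ⟨cosIntegral⁻¹ * (4 * (C * ∫ s in simplex d, psi s)) + 1, by positivity,
    fun Ω _ μ _ X hX n b hn hb hb1 => ?_⟩
  have hn0 : (0 : ℝ) < n := by exact_mod_cast (by omega : 0 < n)
  rw [MAE, exactNormalMAE, ← integral_sub (integrableOn_pointwiseMAE hd hX hfc hb (by omega))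
    (integrableOn_normalAbs ((integrableOn_kernelSD hd hfc hf.nonneg hb hb1).const_mul _)
      (integrableOn_kernelMean_sub hd hf2 hb hb1)), ← Real.norm_eq_abs]
  refine (norm_integral_le_of_norm_le ((integrableOn_psi hd).const_mul
    (cosIntegral⁻¹ * (4 * C) * ((n : ℝ) ^ (-1 : ℝ) * b ^ (-(d : ℝ) / 2)))) ?_).trans ?_
  · filter_upwards [ae_openSimplex hd] with s hs
    rw [Real.norm_eq_abs]
    refine (abs_pointwiseMAE_sub_le hd hf hX hfc hb hn hs).trans ?_
    have h1 := mul_le_mul_of_nonneg_left (hK b hb hb1 s hs)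
      (show 0 ≤ cosIntegral⁻¹ * 4 * (n : ℝ)⁻¹ by positivity)
    rw [Real.rpow_neg_one]
    calc _ = cosIntegral⁻¹ * 4 * (n : ℝ)⁻¹ * kernel b s s := by rw [div_eq_mul_inv]; ring
      _ ≤ _ := h1
      _ = _ := by ring
  · rw [integral_const_mul]
    have : 0 ≤ (n : ℝ) ^ (-1 : ℝ) * b ^ (-(d : ℝ) / 2) := by positivity
    nlinarith

lemma abs_exactNormalMAE_sub_le (hd : 1 ≤ d) (hf0 : ∀ x ∈ simplex d, 0 ≤ f x)
    (hf2 : ContDiffOn ℝ 2 f (simplex d)) (n : ℕ) {b : ℝ} (hb : 0 < b) (hb1 : b ≤ 1) :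
    |exactNormalMAE f n b - weightNormalMAE f n b| ≤
      √(2 / Real.pi) * (∫ s in simplex d,
        |b ^ ((d : ℝ) / 4) * kernelSD f b s - √(psi s * f s)|) *
          ((n : ℝ) ^ (-(1 / 2) : ℝ) * b ^ (-(d : ℝ) / 4)) := by
  have hfc := hf2.continuousOn
  have i1 := (integrableOn_kernelSD hd hfc hf0 hb hb1).const_mul ((n : ℝ) ^ (-(1 / 2) : ℝ))
  have i2 := integrableOn_kernelMean_sub hd hf2 hb hb1
  have i3 := integrableOn_weight hd hfc n b
  have i4 : IntegrableOn (fun s => |b ^ ((d : ℝ) / 4) * kernelSD f b s - √(psi s * f s)|)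
      (simplex d) := (((integrableOn_kernelSD hd hfc hf0 hb hb1).const_mul _).sub
        (integrableOn_sqrt_psi_mul hd hfc)).abs
  rw [exactNormalMAE, weightNormalMAE, ← integral_sub (integrableOn_normalAbs i1 i2)
    (integrableOn_normalAbs i3 i2), ← Real.norm_eq_abs]
  refine (norm_integral_le_of_norm_le (i4.const_mul
    (√(2 / Real.pi) * ((n : ℝ) ^ (-(1 / 2) : ℝ) * b ^ (-(d : ℝ) / 4))))
    (Eventually.of_forall fun s => ?_)).trans (le_of_eq ?_)
  · refine (abs_normalAbs_sub_le _ _ _ _).trans (le_of_eq ?_)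
    rw [sub_self, abs_zero, add_zero, mul_assoc]
    congr 1
    have h1 : b ^ (-(d : ℝ) / 4) * b ^ ((d : ℝ) / 4) = 1 := by
      rw [← Real.rpow_add hb, show -(d : ℝ) / 4 + (d : ℝ) / 4 = 0 by ring, Real.rpow_zero]
    have h2 : (n : ℝ) ^ (-(1 / 2) : ℝ) * kernelSD f b s - weight f n b s =
        ((n : ℝ) ^ (-(1 / 2) : ℝ) * b ^ (-(d : ℝ) / 4)) *
          (b ^ ((d : ℝ) / 4) * kernelSD f b s - √(psi s * f s)) := by
      rw [weight]
      linear_combination (-((n : ℝ) ^ (-(1 / 2) : ℝ) * kernelSD f b s)) * h1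
    rw [h2, abs_mul, abs_of_nonneg (show 0 ≤ (n : ℝ) ^ (-(1 / 2) : ℝ) * b ^ (-(d : ℝ) / 4) by
      positivity)]
  · rw [integral_const_mul]
    ring

lemma abs_weightNormalMAE_sub_le (hd : 1 ≤ d)
    (hf2 : ContDiffOn ℝ 2 f (simplex d)) (n : ℕ) {b : ℝ} (hb : 0 < b) (hb1 : b ≤ 1) :
    |weightNormalMAE f n b -
        ∫ s in simplex d, scaledNormalAbs (weight f n b s) (b * biasCoeff f s)| ≤
      (∫ s in simplex d, |(kernelMean f b s - f s) / b - biasCoeff f s|) * b := by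
  have hfc := hf2.continuousOn
  have i2 := integrableOn_kernelMean_sub hd hf2 hb hb1
  have i3 := integrableOn_weight hd hfc n b
  have i5 := integrableOn_biasCoeff hf2
  have i4 : IntegrableOn (fun s => |(kernelMean f b s - f s) / b - biasCoeff f s|)
      (simplex d) := ((i2.div_const b).sub i5).abs
  simp_rw [scaledNormalAbs_eq (weight_nonneg f n hb _)]
  rw [weightNormalMAE, ← integral_sub (integrableOn_normalAbs i3 i2)
    (integrableOn_normalAbs i3 (i5.const_mul b)), ← Real.norm_eq_abs]
  refine (norm_integral_le_of_norm_le (i4.mul_const b)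
    (Eventually.of_forall fun s => ?_)).trans (le_of_eq ?_)
  · refine (abs_normalAbs_sub_le _ _ _ _).trans (le_of_eq ?_)
    rw [sub_self, abs_zero, mul_zero, zero_add]
    have e : |(kernelMean f b s - f s) / b - biasCoeff f s| * b =
        |((kernelMean f b s - f s) / b - biasCoeff f s) * b| := by rw [abs_mul, abs_of_pos hb]
    rw [e]
    congr 1
    field_simp
  · rw [integral_mul_const]

/-- The main term is at most the leading part of the bound. -/
lemma integral_scaledNormalAbs_le (hd : 1 ≤ d) (hf2 : ContDiffOn ℝ 2 f (simplex d)) (n : ℕ)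
    {b : ℝ} (hb : 0 < b) :
    ∫ s in simplex d, scaledNormalAbs (weight f n b s) (b * biasCoeff f s) ≤
      leadingBound f n b := by
  have hfc := hf2.continuousOn
  have i3 := integrableOn_weight hd hfc n b
  have i5 := integrableOn_biasCoeff hf2
  simp_rw [scaledNormalAbs_eq (weight_nonneg f n hb _)]
  have i6 : IntegrableOn (fun s => √(2 / Real.pi) * weight f n b s) (simplex d) :=
    i3.const_mul _
  have i7 : IntegrableOn (fun s => b * |biasCoeff f s|) (simplex d) := i5.abs.const_mul b
  have h : ∫ s in simplex d, normalAbs (weight f n b s) (b * biasCoeff f s) ≤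
      ∫ s in simplex d, (√(2 / Real.pi) * weight f n b s + b * |biasCoeff f s|) := by
    refine integral_mono (integrableOn_normalAbs i3 (i5.const_mul b)) (i6.add i7) fun s => ?_
    refine (normalAbs_le _ _).trans (le_of_eq ?_)
    rw [abs_of_nonneg (weight_nonneg f n hb s), abs_mul, abs_of_pos hb]
  refine h.trans (le_of_eq ?_)
  rw [integral_add i6 i7, integral_const_mul, integral_const_mul, leadingBound, biasIntegral,
    sdIntegral]
  unfold weight
  rw [integral_const_mul]
  ring

lemma sdIntegral_pos (hd : 1 ≤ d) (hf : IsSimplexDensity f) (hfc : ContinuousOn f (simplex d)) :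
    0 < sdIntegral f := by
  have h0 : 0 ≤ sdIntegral f := integral_nonneg fun s => Real.sqrt_nonneg _
  refine lt_of_le_of_ne h0 fun h => ?_
  have h1 := (integral_eq_zero_iff_of_nonneg (fun s => Real.sqrt_nonneg _)
    (integrableOn_sqrt_psi_mul hd hfc)).1 h.symm
  have h2 : ∀ᵐ s ∂(volume.restrict (simplex d)), f s = 0 := by
    filter_upwards [h1, ae_openSimplex hd] with s hs hso
    have h3 := Real.sqrt_eq_zero'.1 hs
    have h4 := psi_pos hso
    have h5 := hf.nonneg s (openSimplex_subset hso)
    by_contra hne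
    have : 0 < psi s * f s := mul_pos h4 (lt_of_le_of_ne h5 (Ne.symm hne))
    linarith
  have h3 := hf.integral_eq_one
  rw [integral_eq_zero_of_ae h2] at h3
  exact zero_ne_one h3

end Errors

/-! ### Asymptotics along a sequence of bandwidths -/

section Asymptotic

variable {f : (Fin d → ℝ) → ℝ} {b : ℕ → ℝ}

lemma isLittleO_of_abs_le_mul {R ε r : ℕ → ℝ} (h : ∀ᶠ n in atTop, |R n| ≤ ε n * r n)
    (hε : Tendsto ε atTop (𝓝 0)) : R =o[atTop] r := by
  have h1 : R =O[atTop] fun n => ε n * r n := by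
    refine IsBigO.of_bound 1 (h.mono fun n hn => ?_)
    rw [one_mul, Real.norm_eq_abs, Real.norm_eq_abs]
    exact hn.trans (le_abs_self _)
  have h2 := ((isLittleO_one_iff ℝ).2 hε).mul_isBigO (isBigO_refl r atTop)
  simp only [one_mul] at h2
  exact h1.trans_isLittleO h2

lemma isLittleO_exactNormalMAE_sub (hd : 1 ≤ d) (hf0 : ∀ x ∈ simplex d, 0 ≤ f x)
    (hf2 : ContDiffOn ℝ 2 f (simplex d)) (hb : ∀ᶠ n in atTop, 0 < b n)
    (hb0 : Tendsto b atTop (𝓝 0)) :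
    (fun n : ℕ => exactNormalMAE f n (b n) - weightNormalMAE f n (b n)) =o[atTop]
      fun n : ℕ => (n : ℝ) ^ (-(1 / 2) : ℝ) * b n ^ (-(d : ℝ) / 4) := by
  have h := ((tendsto_integral_abs_kernelSD_sub hf2 hf0 hd).comp
    (tendsto_nhdsWithin_iff.2 ⟨hb0, hb⟩)).const_mul √(2 / Real.pi)
  rw [mul_zero] at h
  refine isLittleO_of_abs_le_mul ?_ h
  filter_upwards [hb, hb0.eventually_le_const one_pos] with n h0 h1
  exact abs_exactNormalMAE_sub_le hd hf0 hf2 n h0 h1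

lemma isLittleO_weightNormalMAE_sub (hd : 1 ≤ d) (hf2 : ContDiffOn ℝ 2 f (simplex d))
    (hb : ∀ᶠ n in atTop, 0 < b n) (hb0 : Tendsto b atTop (𝓝 0)) :
    (fun n : ℕ => weightNormalMAE f n (b n) -
      ∫ s in simplex d, scaledNormalAbs (weight f n (b n) s) (b n * biasCoeff f s)) =o[atTop]
      b := by
  refine isLittleO_of_abs_le_mul ?_ ((tendsto_integral_abs_bias_sub hf2 hd).comp
    (tendsto_nhdsWithin_iff.2 ⟨hb0, hb⟩))
  filter_upwards [hb, hb0.eventually_le_const one_pos] with n h0 h1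
  exact abs_weightNormalMAE_sub_le hd hf2 n h0 h1

/-- When the standard deviation tends to zero, its square is of smaller order, and any quantity
within `O(n⁻¹ b^{-d/2})` of the integrated normal approximation obeys the upper bound. -/
lemma exists_le_leadingBound_add (hd : 1 ≤ d) (hf0 : ∀ x ∈ simplex d, 0 ≤ f x)
    (hf2 : ContDiffOn ℝ 2 f (simplex d)) {M : ℕ → ℝ → ℝ} {C : ℝ}
    (hM : ∀ (n : ℕ) (β : ℝ), 2 ≤ n → 0 < β → β ≤ 1 →
      |M n β - exactNormalMAE f n β| ≤ C * ((n : ℝ) ^ (-1 : ℝ) * β ^ (-(d : ℝ) / 2)))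
    (hb : ∀ᶠ n in atTop, 0 < b n) (hb0 : Tendsto b atTop (𝓝 0))
    (hinf : Tendsto (fun n : ℕ => (n : ℝ) ^ (1 / 2 : ℝ) * b n ^ ((d : ℝ) / 4)) atTop atTop) :
    ∃ R₁ R₂ : ℕ → ℝ,
      R₁ =o[atTop] (fun n : ℕ => (n : ℝ) ^ (-(1 / 2) : ℝ) * b n ^ (-(d : ℝ) / 4)) ∧
      R₂ =o[atTop] b ∧
      ∀ᶠ n : ℕ in atTop, M n (b n) ≤ leadingBound f n (b n) + R₁ n + R₂ n := by
  set r : ℕ → ℝ := fun n => (n : ℝ) ^ (-(1 / 2) : ℝ) * b n ^ (-(d : ℝ) / 4) with hr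
  have hr0 : Tendsto r atTop (𝓝 0) := by
    refine hinf.inv_tendsto_atTop.congr' ?_
    filter_upwards [hb] with n hn
    rw [Pi.inv_apply, mul_inv, ← Real.rpow_neg n.cast_nonneg, ← Real.rpow_neg hn.le]
    simp only [hr, neg_div]
  have h1 : (fun n => M n (b n) - exactNormalMAE f n (b n)) =o[atTop] r := by
    have hC := hr0.const_mul C
    rw [mul_zero] at hC
    refine isLittleO_of_abs_le_mul ?_ hC
    filter_upwards [hb, hb0.eventually_le_const one_pos, eventually_ge_atTop 2] with n h0 h1 hn
    refine (hM n _ hn h0 h1).trans (le_of_eq ?_)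
    have hn0 : (0 : ℝ) < n := by exact_mod_cast (by omega : 0 < n)
    rw [show (-1 : ℝ) = -(1 / 2) + -(1 / 2) by norm_num, Real.rpow_add hn0,
      show -(d : ℝ) / 2 = -(d : ℝ) / 4 + -(d : ℝ) / 4 by ring, Real.rpow_add h0]
    simp only [hr]
    ring
  refine ⟨_, _, h1.add (isLittleO_exactNormalMAE_sub hd hf0 hf2 hb hb0),
    isLittleO_weightNormalMAE_sub hd hf2 hb hb0, ?_⟩
  filter_upwards [hb] with n hn
  have := integral_scaledNormalAbs_le hd hf2 n hn
  linarith

end Asymptotic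

/-! ### Bandwidths of the optimal order -/

section Rate

/-- At bandwidths `n^{-2/(d+4)} q` the standard deviation has the order of the bias. -/
lemma natCast_rpow_mul_scaled_rpow {n : ℕ} (hn : 1 ≤ n) {q : ℝ} (hq : 0 < q) :
    (n : ℝ) ^ (-(1 / 2) : ℝ) * ((n : ℝ) ^ (-2 / ((d : ℝ) + 4)) * q) ^ (-(d : ℝ) / 4) =
      (n : ℝ) ^ (-2 / ((d : ℝ) + 4)) * q ^ (-(d : ℝ) / 4) := by
  have hn0 : (0 : ℝ) < n := by exact_mod_cast hn
  have hd : (d : ℝ) + 4 ≠ 0 := by positivity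
  rw [Real.mul_rpow (by positivity) hq.le, ← Real.rpow_mul hn0.le, ← mul_assoc,
    ← Real.rpow_add hn0]
  congr 2
  field_simp
  ring

lemma tendsto_natCast_rpow_rate :
    Tendsto (fun n : ℕ => (n : ℝ) ^ (-2 / ((d : ℝ) + 4))) atTop (𝓝 0) := by
  have h := (tendsto_rpow_neg_atTop (show (0 : ℝ) < 2 / ((d : ℝ) + 4) by positivity)).comp
    (tendsto_natCast_atTop_atTop (R := ℝ))
  refine h.congr fun n => ?_
  rw [Function.comp_apply, neg_div]

variable {b : ℕ → ℝ} {lam : ℝ}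

/-- The rescaled bandwidth `q = n^{2/(d+4)} b`, which recovers `b` and turns `n^{-1/2} b^{-d/4}`
into `n^{-2/(d+4)} q^{-d/4}`. -/
lemma eventually_eq_rate_mul (hb : ∀ᶠ n in atTop, 0 < b n) :
    ∀ᶠ n : ℕ in atTop, b n = (n : ℝ) ^ (-2 / ((d : ℝ) + 4)) *
        ((n : ℝ) ^ (2 / ((d : ℝ) + 4)) * b n) ∧
      (n : ℝ) ^ (-(1 / 2) : ℝ) * b n ^ (-(d : ℝ) / 4) = (n : ℝ) ^ (-2 / ((d : ℝ) + 4)) *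
        ((n : ℝ) ^ (2 / ((d : ℝ) + 4)) * b n) ^ (-(d : ℝ) / 4) := by
  filter_upwards [hb, eventually_ge_atTop 1] with n h0 hn
  have hn0 : (0 : ℝ) < n := by exact_mod_cast hn
  have e : b n = (n : ℝ) ^ (-2 / ((d : ℝ) + 4)) * ((n : ℝ) ^ (2 / ((d : ℝ) + 4)) * b n) := by
    rw [← mul_assoc, ← Real.rpow_add hn0, neg_div, neg_add_cancel, Real.rpow_zero, one_mul]
  refine ⟨e, ?_⟩
  rw [← natCast_rpow_mul_scaled_rpow hn (by positivity), ← e]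

lemma tendsto_zero_of_tendsto_rate (hb : ∀ᶠ n in atTop, 0 < b n)
    (hq : Tendsto (fun n : ℕ => (n : ℝ) ^ (2 / ((d : ℝ) + 4)) * b n) atTop (𝓝 lam)) :
    Tendsto b atTop (𝓝 0) := by
  have h := (tendsto_natCast_rpow_rate (d := d)).mul hq
  rw [zero_mul] at h
  exact h.congr' ((eventually_eq_rate_mul hb).mono fun n hn => hn.1.symm)

lemma tendsto_atTop_of_tendsto_rate (hb : ∀ᶠ n in atTop, 0 < b n) (hlam : 0 < lam)
    (hq : Tendsto (fun n : ℕ => (n : ℝ) ^ (2 / ((d : ℝ) + 4)) * b n) atTop (𝓝 lam)) :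
    Tendsto (fun n : ℕ => (n : ℝ) ^ (1 / 2 : ℝ) * b n ^ ((d : ℝ) / 4)) atTop atTop := by
  have h := (tendsto_natCast_rpow_rate (d := d)).mul
    (hq.rpow_const (p := -(d : ℝ) / 4) (Or.inl hlam.ne'))
  rw [zero_mul] at h
  have h2 : Tendsto (fun n : ℕ => (n : ℝ) ^ (-(1 / 2) : ℝ) * b n ^ (-(d : ℝ) / 4)) atTop
      (𝓝[>] 0) := by
    refine tendsto_nhdsWithin_iff.2
      ⟨h.congr' ((eventually_eq_rate_mul hb).mono fun n hn => hn.2.symm), ?_⟩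
    filter_upwards [hb, eventually_ge_atTop 1] with n h0 hn
    have hn0 : (0 : ℝ) < n := by exact_mod_cast hn
    exact Set.mem_Ioi.2 (by positivity)
  refine h2.inv_tendsto_nhdsGT_zero.congr' ?_
  filter_upwards [hb] with n hn
  rw [Pi.inv_apply, mul_inv, ← Real.rpow_neg n.cast_nonneg, ← Real.rpow_neg hn.le, neg_div,
    neg_neg, neg_neg]

variable {f : (Fin d → ℝ) → ℝ}

/-- With `q = n^{2/(d+4)} b`, the leading bound is
`n^{-2/(d+4)} (q^{-d/4} √(2/π) A + q G)`, so that only the convergence of `q` matters. -/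
lemma exists_le_rate_mul_add (hd : 1 ≤ d) (hf0 : ∀ x ∈ simplex d, 0 ≤ f x)
    (hf2 : ContDiffOn ℝ 2 f (simplex d)) {M : ℕ → ℝ → ℝ} {C : ℝ}
    (hM : ∀ (n : ℕ) (β : ℝ), 2 ≤ n → 0 < β → β ≤ 1 →
      |M n β - exactNormalMAE f n β| ≤ C * ((n : ℝ) ^ (-1 : ℝ) * β ^ (-(d : ℝ) / 2)))
    (hb : ∀ᶠ n in atTop, 0 < b n) (hlam : 0 < lam)
    (hq : Tendsto (fun n : ℕ => (n : ℝ) ^ (2 / ((d : ℝ) + 4)) * b n) atTop (𝓝 lam)) :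
    ∃ R : ℕ → ℝ,
      R =o[atTop] (fun n : ℕ => (n : ℝ) ^ (-2 / ((d : ℝ) + 4))) ∧
      ∀ᶠ n : ℕ in atTop, M n (b n) ≤ (n : ℝ) ^ (-2 / ((d : ℝ) + 4)) *
        (lam ^ (-(d : ℝ) / 4) * √(2 / Real.pi) * sdIntegral f + lam * biasIntegral f) + R n := by
  obtain ⟨R₁, R₂, h1, h2, h3⟩ := exists_le_leadingBound_add hd hf0 hf2 hM hb
    (tendsto_zero_of_tendsto_rate hb hq) (tendsto_atTop_of_tendsto_rate hb hlam hq)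
  set ρ : ℕ → ℝ := fun n => (n : ℝ) ^ (-2 / ((d : ℝ) + 4)) with hρ
  set q : ℕ → ℝ := fun n => (n : ℝ) ^ (2 / ((d : ℝ) + 4)) * b n with hq_def
  have hqp : Tendsto (fun n => q n ^ (-(d : ℝ) / 4)) atTop (𝓝 (lam ^ (-(d : ℝ) / 4))) :=
    hq.rpow_const (Or.inl hlam.ne')
  have he := eventually_eq_rate_mul (d := d) hb
  have o1 : R₁ =o[atTop] ρ := by
    refine h1.trans_isBigO ?_
    have := (isBigO_refl ρ atTop).mul (hqp.isBigO_one ℝ)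
    simp only [mul_one] at this
    exact this.congr' (he.mono fun n hn => hn.2.symm) EventuallyEq.rfl
  have o2 : R₂ =o[atTop] ρ := by
    refine h2.trans_isBigO ?_
    have := (isBigO_refl ρ atTop).mul (hq.isBigO_one ℝ)
    simp only [mul_one] at this
    exact this.congr' (he.mono fun n hn => hn.1.symm) EventuallyEq.rfl
  have o3 : (fun n => ρ n * ((q n ^ (-(d : ℝ) / 4) * √(2 / Real.pi) * sdIntegral f +
      q n * biasIntegral f) - (lam ^ (-(d : ℝ) / 4) * √(2 / Real.pi) * sdIntegral f +
        lam * biasIntegral f))) =o[atTop] ρ := by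
    have h := (((hqp.mul_const √(2 / Real.pi)).mul_const (sdIntegral f)).add
      (hq.mul_const (biasIntegral f))).sub_const
        (lam ^ (-(d : ℝ) / 4) * √(2 / Real.pi) * sdIntegral f + lam * biasIntegral f)
    rw [sub_self] at h
    have := (isBigO_refl ρ atTop).mul_isLittleO ((isLittleO_one_iff ℝ).2 h)
    simpa only [mul_one] using this
  refine ⟨_, (o3.add o1).add o2, ?_⟩
  filter_upwards [h3, he] with n hn hen
  have e : leadingBound f n (b n) = ρ n * (q n ^ (-(d : ℝ) / 4) * √(2 / Real.pi) * sdIntegral f +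
      q n * biasIntegral f) := by
    rw [leadingBound, hen.2]
    nth_rewrite 2 [hen.1]
    simp only [hρ, hq_def]
    ring
  rw [e] at hn
  linarith

end Rate

/-! ### The optimal bandwidth -/

section Optimal

/-- A critical point of `β ↦ a β^{-p} + G β` is its unique minimizer, since
`u^{-p} ≥ 1 - p log u > 1 - p (u - 1)` for the ratio `u ≠ 1` to the critical point. -/
lemma rpow_neg_add_mul_lt_of_critical {p a G β₀ β : ℝ} (hp : 0 < p) (hG : 0 < G) (h0 : 0 < β₀)
    (hβ : 0 < β) (hne : β ≠ β₀) (hcrit : p * (a * β₀ ^ (-p)) = G * β₀) :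
    a * β₀ ^ (-p) + β₀ * G < a * β ^ (-p) + β * G := by
  set u := β / β₀ with hu
  have hu0 : 0 < u := div_pos hβ h0
  have hu1 : u ≠ 1 := fun h => hne ((div_eq_one_iff_eq h0.ne').1 h)
  have hβu : β = β₀ * u := by rw [hu]; field_simp
  have hpow : 1 - p * (u - 1) < u ^ (-p) := by
    have h1 := Real.log_lt_sub_one_of_pos hu0 hu1
    have h2 := Real.add_one_le_exp (Real.log u * -p)
    rw [Real.rpow_def_of_pos hu0]
    nlinarith
  set k := a * β₀ ^ (-p) with hk
  have hk0 : 0 < k := by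
    have : 0 < p * k := hcrit ▸ mul_pos hG h0
    exact pos_of_mul_pos_right this hp.le
  have e : a * β ^ (-p) = k * u ^ (-p) := by
    rw [hβu, Real.mul_rpow h0.le hu0.le, hk]; ring
  have h3 := mul_lt_mul_of_pos_left hpow hk0
  rw [e, hβu]
  linear_combination h3 + (u - 1) * hcrit

/-- The factor of `n^{-2/(d+4)}` in the optimal bandwidth. -/
def optScale (f : (Fin d → ℝ) → ℝ) : ℝ :=
  ((d : ℝ) / 4 * √(2 / Real.pi) * (sdIntegral f / biasIntegral f)) ^ (4 / ((d : ℝ) + 4))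

variable {f : (Fin d → ℝ) → ℝ}

lemma bOpt_eq (n : ℕ) : bOpt f n = (n : ℝ) ^ (-2 / ((d : ℝ) + 4)) * optScale f := rfl

lemma optScale_pos (hd : 1 ≤ d) (hA : 0 < sdIntegral f) (hG : 0 < biasIntegral f) :
    0 < optScale f := by
  have hd0 : (0 : ℝ) < d := by exact_mod_cast hd
  have := Real.pi_pos
  unfold optScale
  positivity

lemma bOpt_pos (hd : 1 ≤ d) (hA : 0 < sdIntegral f) (hG : 0 < biasIntegral f) {n : ℕ}
    (hn : 1 ≤ n) : 0 < bOpt f n := by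
  have hn0 : (0 : ℝ) < n := by exact_mod_cast hn
  exact mul_pos (by positivity) (optScale_pos hd hA hG)

lemma optScale_rpow (hd : 1 ≤ d) (hA : 0 < sdIntegral f) (hG : 0 < biasIntegral f) :
    optScale f ^ (-(d : ℝ) / 4) =
      ((d : ℝ) / 4 * √(2 / Real.pi) * (sdIntegral f / biasIntegral f)) ^
        (-((d : ℝ) / ((d : ℝ) + 4))) := by
  have hd0 : (0 : ℝ) < d := by exact_mod_cast hd
  have := Real.pi_pos
  rw [optScale, ← Real.rpow_mul (by positivity)]
  congr 1
  field_simp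

/-- The optimal `λ` is the critical point of `λ^{-d/4} √(2/π) A + λ G`. -/
lemma optScale_critical (hd : 1 ≤ d) (hA : 0 < sdIntegral f) (hG : 0 < biasIntegral f) :
    (d : ℝ) / 4 * (√(2 / Real.pi) * sdIntegral f * optScale f ^ (-(d : ℝ) / 4)) =
      biasIntegral f * optScale f := by
  have hd0 : (0 : ℝ) < d := by exact_mod_cast hd
  have := Real.pi_pos
  rw [optScale_rpow hd hA hG, optScale]
  set y := (d : ℝ) / 4 * √(2 / Real.pi) * (sdIntegral f / biasIntegral f) with hy
  have hy0 : 0 < y := by positivity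
  have e : y ^ (4 / ((d : ℝ) + 4)) = y * y ^ (-((d : ℝ) / ((d : ℝ) + 4))) := by
    nth_rewrite 2 [← Real.rpow_one y]
    rw [← Real.rpow_add hy0]
    congr 1
    field_simp
    ring
  have e2 : biasIntegral f * y = (d : ℝ) / 4 * √(2 / Real.pi) * sdIntegral f := by
    rw [hy]; field_simp
  rw [e, ← mul_assoc (biasIntegral f), e2]
  ring

/-- The value of `λ^{-d/4} √(2/π) A + λ G` at the optimal `λ`. -/
lemma optScale_value (hd : 1 ≤ d) (hA : 0 < sdIntegral f) (hG : 0 < biasIntegral f) :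
    optScale f ^ (-(d : ℝ) / 4) * √(2 / Real.pi) * sdIntegral f + optScale f * biasIntegral f =
      ((1 + (d : ℝ) / 4) / ((d : ℝ) / 4) ^ ((d : ℝ) / ((d : ℝ) + 4))) *
        ((√(2 / Real.pi) * sdIntegral f) ^ (4 / ((d : ℝ) + 4)) /
          biasIntegral f ^ (-(d : ℝ) / ((d : ℝ) + 4))) := by
  have hd0 : (0 : ℝ) < d := by exact_mod_cast hd
  have := Real.pi_pos
  have h := optScale_critical hd hA hG
  set x := √(2 / Real.pi) * sdIntegral f with hx
  have hx0 : 0 < x := by positivity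
  have e1 : optScale f ^ (-(d : ℝ) / 4) * √(2 / Real.pi) * sdIntegral f +
      optScale f * biasIntegral f = (1 + (d : ℝ) / 4) * (optScale f ^ (-(d : ℝ) / 4) * x) := by
    rw [hx] at h ⊢
    linear_combination -h
  have e2 : (d : ℝ) / 4 * √(2 / Real.pi) * (sdIntegral f / biasIntegral f) =
      (d : ℝ) / 4 * x * (biasIntegral f)⁻¹ := by rw [hx]; ring
  have e3 : x ^ (4 / ((d : ℝ) + 4)) = x ^ (-((d : ℝ) / ((d : ℝ) + 4))) * x := by
    nth_rewrite 3 [← Real.rpow_one x]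
    rw [← Real.rpow_add hx0]
    congr 1
    field_simp
    ring
  rw [e1, optScale_rpow hd hA hG, e2, Real.mul_rpow (by positivity) (by positivity),
    Real.mul_rpow (by positivity) hx0.le, Real.inv_rpow hG.le, e3,
    Real.rpow_neg (show (0 : ℝ) ≤ (d : ℝ) / 4 by positivity), neg_div]
  ring

lemma leadingBound_bOpt_lt (hd : 1 ≤ d) (hA : 0 < sdIntegral f) (hG : 0 < biasIntegral f)
    {n : ℕ} (hn : 1 ≤ n) {β : ℝ} (hβ : 0 < β) (hne : β ≠ bOpt f n) :
    leadingBound f n (bOpt f n) < leadingBound f n β := by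
  have hd0 : (0 : ℝ) < d := by exact_mod_cast hd
  have hl := optScale_pos hd hA hG
  have e : ∀ β, leadingBound f n β = (n : ℝ) ^ (-(1 / 2) : ℝ) * (√(2 / Real.pi) * sdIntegral f) *
      β ^ (-((d : ℝ) / 4)) + β * biasIntegral f := fun β => by
    rw [leadingBound, neg_div]; ring
  rw [e, e]
  refine rpow_neg_add_mul_lt_of_critical (by positivity) hG (bOpt_pos hd hA hG hn) hβ hne ?_
  have h1 := optScale_critical hd hA hG
  have h2 := natCast_rpow_mul_scaled_rpow (d := d) hn hl
  have h3 := bOpt_eq (f := f) n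
  rw [← h3] at h2
  rw [neg_div] at h1 h2
  linear_combination (d / 4 * (√(2 / Real.pi) * sdIntegral f)) * h2 +
    (n : ℝ) ^ (-2 / ((d : ℝ) + 4)) * h1 - biasIntegral f * h3

lemma tendsto_rate_bOpt :
    Tendsto (fun n : ℕ => (n : ℝ) ^ (2 / ((d : ℝ) + 4)) * bOpt f n) atTop (𝓝 (optScale f)) := by
  refine tendsto_const_nhds.congr' ?_
  filter_upwards [eventually_ge_atTop 1] with n hn
  have hn0 : (0 : ℝ) < n := by exact_mod_cast hn
  rw [bOpt_eq, ← mul_assoc, ← Real.rpow_add hn0, neg_div, add_neg_cancel, Real.rpow_zero, one_mul]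

end Optimal

end DirichletKernel

end

open DirichletKernel
theorem mainTheorem5 {d : ℕ} (hd : 1 ≤ d) (f : (Fin d → ℝ) → ℝ)
    (hf : IsSimplexDensity f) (hf2 : ContDiffOn ℝ 2 f (simplex d)) :
    -- the integrals `∫ √(ψ f)`, `∫ |g|` and `∫ w 𝔼|Z - b g / w|` converge
    IntegrableOn (fun s => √(psi s * f s)) (simplex d) ∧
    IntegrableOn (fun s => |biasCoeff f s|) (simplex d) ∧
    (∀ (n : ℕ) (b : ℝ), 1 ≤ n → 0 < b →
      IntegrableOn (fun s => scaledNormalAbs (weight f n b s) (b * biasCoeff f s)) (simplex d)) ∧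
    -- the constant of the `O` term depends on `d` and `f` only
    ∃ C : ℝ, 0 < C ∧
      ∀ (Ω : Type*) [MeasurableSpace Ω] (μ : Measure Ω) [IsProbabilityMeasure μ]
        (X : ℕ → Ω → (Fin d → ℝ)), IsIIDSample μ X f →
        -- the mean absolute error is well defined
        (∀ (n : ℕ) (b : ℝ), 1 ≤ n → 0 < b →
          (∀ s ∈ simplex d, Integrable (fun ω => |estimator X n b s ω - f s|) μ) ∧
          IntegrableOn (pointwiseMAE μ X f n b) (simplex d)) ∧
        -- asymptotic expression
        (∀ b : ℕ → ℝ, (∀ n, 0 < b n) → Tendsto b atTop (𝓝 0) →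
          ∃ R₁ R₂ R₃ : ℕ → ℝ,
            (∀ᶠ n : ℕ in atTop, |R₁ n| ≤ C * ((n : ℝ) ^ (-1 : ℝ) * b n ^ (-(d : ℝ) / 2))) ∧
            R₂ =o[atTop] (fun n : ℕ => (n : ℝ) ^ (-(1 / 2) : ℝ) * b n ^ (-(d : ℝ) / 4)) ∧
            R₃ =o[atTop] b ∧
            ∀ᶠ n : ℕ in atTop, MAE μ X f n (b n) =
              (∫ s in simplex d, scaledNormalAbs (weight f n (b n) s) (b n * biasCoeff f s))
                + R₁ n + R₂ n + R₃ n) ∧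
        -- upper bound
        (∀ b : ℕ → ℝ, (∀ n, 0 < b n) → Tendsto b atTop (𝓝 0) →
          Tendsto (fun n : ℕ => (n : ℝ) ^ (1 / 2 : ℝ) * b n ^ ((d : ℝ) / 4)) atTop atTop →
          ∃ R₁ R₂ : ℕ → ℝ,
            R₁ =o[atTop] (fun n : ℕ => (n : ℝ) ^ (-(1 / 2) : ℝ) * b n ^ (-(d : ℝ) / 4)) ∧
            R₂ =o[atTop] b ∧
            ∀ᶠ n : ℕ in atTop, MAE μ X f n (b n) ≤ leadingBound f n (b n) + R₁ n + R₂ n) ∧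
        -- optimal bandwidth for the upper bound, and the resulting rate
        (0 < biasIntegral f →
          (∀ n : ℕ, 1 ≤ n → 0 < bOpt f n ∧
            ∀ β : ℝ, 0 < β → β ≠ bOpt f n → leadingBound f n (bOpt f n) < leadingBound f n β) ∧
          Tendsto (bOpt f) atTop (𝓝 0) ∧
          Tendsto (fun n : ℕ => (n : ℝ) ^ (1 / 2 : ℝ) * bOpt f n ^ ((d : ℝ) / 4)) atTop atTop ∧
          ∃ R : ℕ → ℝ,
            R =o[atTop] (fun n : ℕ => (n : ℝ) ^ (-2 / ((d : ℝ) + 4))) ∧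
            ∀ᶠ n : ℕ in atTop, MAE μ X f n (bOpt f n) ≤
              (n : ℝ) ^ (-2 / ((d : ℝ) + 4)) *
                ((1 + (d : ℝ) / 4) / ((d : ℝ) / 4) ^ ((d : ℝ) / ((d : ℝ) + 4))) *
                ((√(2 / Real.pi) * sdIntegral f) ^ (4 / ((d : ℝ) + 4)) /
                  biasIntegral f ^ (-(d : ℝ) / ((d : ℝ) + 4)))
                + R n) ∧
        -- bandwidths of order `n^{-2/(d+4)}`
        (∀ (b : ℕ → ℝ) (lam : ℝ), (∀ n, 0 < b n) → 0 < lam →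
          Tendsto (fun n : ℕ => (n : ℝ) ^ (2 / ((d : ℝ) + 4)) * b n) atTop (𝓝 lam) →
          ∃ R : ℕ → ℝ,
            R =o[atTop] (fun n : ℕ => (n : ℝ) ^ (-2 / ((d : ℝ) + 4))) ∧
            ∀ᶠ n : ℕ in atTop, MAE μ X f n (b n) ≤
              (n : ℝ) ^ (-2 / ((d : ℝ) + 4)) *
                (lam ^ (-(d : ℝ) / 4) * √(2 / Real.pi) * sdIntegral f + lam * biasIntegral f)
                + R n) := by
  have hfc := hf2.continuousOn
  have hA := sdIntegral_pos hd hf hfc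
  refine ⟨integrableOn_sqrt_psi_mul hd hfc, (integrableOn_biasCoeff hf2).abs,
    fun n b _ hb => ?_, ?_⟩
  · simp_rw [scaledNormalAbs_eq (weight_nonneg f n hb _)]
    exact integrableOn_normalAbs (integrableOn_weight hd hfc n b)
      ((integrableOn_biasCoeff hf2).const_mul b)
  obtain ⟨C, hC, hMAE⟩ := exists_abs_MAE_sub_le hd hf hf2
  refine ⟨C, hC, fun Ω _ μ _ X hX => ?_⟩
  have hM := hMAE Ω μ X hX
  refine ⟨fun n b hn hb => ⟨fun s hs => integrable_abs_estimator_sub hX hfc hb hn hs,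
    integrableOn_pointwiseMAE hd hX hfc hb hn⟩, fun b hb hb0 => ?_, fun b hb hb0 hinf =>
    exists_le_leadingBound_add hd hf.nonneg hf2 hM (Eventually.of_forall hb) hb0 hinf,
    fun hG => ?_, fun b lam hb hlam hq =>
    exists_le_rate_mul_add hd hf.nonneg hf2 hM (Eventually.of_forall hb) hlam hq⟩
  · refine ⟨_, _, _, ?_,
      isLittleO_exactNormalMAE_sub hd hf.nonneg hf2 (Eventually.of_forall hb) hb0,
      isLittleO_weightNormalMAE_sub hd hf2 (Eventually.of_forall hb) hb0,
      Eventually.of_forall fun n => (?_ : _ = _ + (MAE μ X f n (b n) - exactNormalMAE f n (b n)) +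
        _ + _)⟩
    · filter_upwards [hb0.eventually_le_const one_pos, eventually_ge_atTop 2] with n h1 hn
      exact hM n _ hn (hb n) h1
    · ring
  · have hb : ∀ᶠ n in atTop, 0 < bOpt f n :=
      (eventually_ge_atTop 1).mono fun n hn => bOpt_pos hd hA hG hn
    have hl := optScale_pos hd hA hG
    refine ⟨fun n hn => ⟨bOpt_pos hd hA hG hn, fun β hβ hne =>
      leadingBound_bOpt_lt hd hA hG hn hβ hne⟩, tendsto_zero_of_tendsto_rate hb tendsto_rate_bOpt,
      tendsto_atTop_of_tendsto_rate hb hl tendsto_rate_bOpt, ?_⟩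
    obtain ⟨R, hR, h⟩ := exists_le_rate_mul_add hd hf.nonneg hf2 hM hb hl tendsto_rate_bOpt
    refine ⟨R, hR, h.mono fun n hn => hn.trans (le_of_eq ?_)⟩
    rw [optScale_value hd hA hG, ← mul_assoc]
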